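/- Let $p$ be a prime, $k$ an algebraically closed field of characteristic $p$, $K_0 = \mathrm{Frac}(W(k))$ the fraction field of the ring of Witt vectors of $k$, and $K_n = K_0(\zeta_{p^n})$ for $n \ge 0$, where $\zeta_{p^n}$ is a primitive $p^n$-th root of unity in a fixed algebraic closure of $K_0$. For a finite extension $K/K_0$ let $v_K$ be its valuation normalized so that uniformizers have valuation $1$, put $e_K = v_K(p)$, and write $v_n = v_{K_n}$. For $K \supseteq K_1$, an element $a = 1+t$ of $K$ is called *$p$-primitive for $K$* if either $p \nmid v_K(a)$ (so $a\neq 0$), or $0 < v_K(t) < \frac{p}{p-1}e_K$ and $p \nmid v_K(t)$. For a finite Galois extension $L/K$ of such fields with group $G$, the lower ramification groups are $G_i = \{g \in G : v_L(g\pi_L - \pi_L) \ge i+1\}$ for real $i \ge 0$, where $\pi_L$ is a uniformizer of $L$. The upper ramification groups are $G^i = G_{\psi_{L/K}(i)}$, where $\psi_{L/K}$ is the inverse of $\varphi_{L/K}(u) = \int_0^u \frac{dt}{(G_0:G_t)}$ on $[0,\infty)$. The *conductor* of $L/K$ is $h_{L/K} = \sup\{i \in [0,\infty) : G^i \ne \{\mathrm{id}\}\}$,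 with $h_{L/K}=0$ if $L=K$. **Lemma.** Let $1 \le \ell \le c$ be integers, and let $a = 1+t \in K_\ell$ be $p$-primitive for $K_\ell$, with $v_\ell(a) \ge 0$. Let $\sqrt[p^c]{a}$ be any $p^c$-th root of $a$ in the algebraic closure, and put $\sqrt[p^{c-1}]{a} = (\sqrt[p^c]{a})^p$. Then the extensions $K_c(\sqrt[p^c]{a})/K_\ell(\sqrt[p^c]{a})$ and $K_\ell(\sqrt[p^c]{a})/K_\ell(\sqrt[p^{c-1}]{a})$ are Galois, $v_\ell(t)$ is finite, the conductor of $K_c(\sqrt[p^c]{a})$ over $K_\ell(\sqrt[p^c]{a})$ is at most $p^{c+\ell-1} - v_\ell(t)$, and the conductor of $K_\ell(\sqrt[p^c]{a})$ over $K_\ell(\sqrt[p^{c-1}]{a})$ is equal to $p^{c+\ell-1} - v_\ell(t)$. -/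

import Mathlib

noncomputable section

namespace WildConductor

/-! ### Valuation, higher ramification, conductor

`A` is a complete discrete valuation ring with algebraically closed residue field, and `L` is a
finite extension of its fraction field.  The ring of integers of `L` is the integral closure of `A`
in `L`; it is again a complete discrete valuation ring, with the same residue field. -/

section Ramification

variable (A : Type*) [CommRing A] (L : Type*) [Field L] [Algebra A L]

/-- The uniformizers of `L`: the irreducible elements of its ring of integers. -/
def IsUniformizer (π : integralClosure A L) : Prop := Irreducible π

/-- `x = π ^ n * u` for some uniformizer `π` of `L` and some unit `u` of the ring of integers. -/
def HasVal (x : L) (n : ℤ) : Prop :=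
  ∃ (π : integralClosure A L) (u : (integralClosure A L)ˣ),
    IsUniformizer A L π ∧ x = (π : L) ^ n * ((u : integralClosure A L) : L)

open Classical in
/-- The valuation `v_L`, normalized so that uniformizers have valuation `1`: the integer `n` with
`x = π ^ n * u`, and `⊤` if there is none (that is, if `x = 0`). -/
def val (x : L) : WithTop ℤ :=
  if h : ∃ n : ℤ, HasVal A L x n then ((h.choose : ℤ) : WithTop ℤ) else ⊤

/-- `a = 1 + t` is `p`-primitive for `L`: either `p ∤ v_L(a)` (in particular `a ≠ 0`), or
`0 < v_L(t) < p / (p - 1) * e_L` and `p ∤ v_L(t)`, where `e_L = v_L(p)`. -/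
def IsPrimitiveElt (p : ℕ) (a : L) : Prop :=
  (∃ n : ℤ, val A L a = n ∧ ¬ (p : ℤ) ∣ n) ∨
  (∃ n e : ℤ, val A L (a - 1) = n ∧ val A L (p : L) = e ∧
    0 < n ∧ (n : ℝ) < (p : ℝ) / ((p : ℝ) - 1) * (e : ℝ) ∧ ¬ (p : ℤ) ∣ n)

variable (M : Type*) [Field M] [Algebra M L]

/-- The `i`-th ramification group `G_i` of `L/M` in the lower numbering (`i ≥ 0` real), as a subset
of the Galois group: `g ∈ G_i` iff `v_L(g π - π) ≥ i + 1` for the uniformizers `π` of `L`.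
(As `L/M` is totally ramified, it makes no difference which uniformizer is tested.) -/
def lowerRam (i : ℝ) : Set (L ≃ₐ[M] L) :=
  {g | ∀ π : integralClosure A L, IsUniformizer A L π →
    ((i + 1 : ℝ) : WithTop ℝ) ≤ (val A L (g (π : L) - (π : L))).map (fun n : ℤ => (n : ℝ))}

/-- The Herbrand function `φ_{L/M}(u) = ∫_0^u dt / (G_0 : G_t)`. -/
def phi (u : ℝ) : ℝ :=
  ∫ t in (0 : ℝ)..u, ((lowerRam A L M t).ncard : ℝ) / ((lowerRam A L M 0).ncard : ℝ)

/-- `ψ_{L/M}`, the inverse of `φ_{L/M}` on `[0, ∞)`. -/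
def psi : ℝ → ℝ := Function.invFunOn (phi A L M) (Set.Ici 0)

/-- The `i`-th ramification group in the upper numbering, `G^i = G_{ψ(i)}`. -/
def upperRam (i : ℝ) : Set (L ≃ₐ[M] L) := lowerRam A L M (psi A L M i)

/-- The conductor `h_{L/M}`: the supremum of the `i ∈ [0, ∞)` with `G^i ≠ {id}` (it is `0` for the
trivial extension, as `sSup ∅ = 0`). -/
def ramConductor : ℝ := sSup {i : ℝ | 0 ≤ i ∧ upperRam A L M i ≠ {1}}

end Ramification

/-! ### The fields `K_n` and `K_n(β)` -/

section Fields

open IntermediateField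

variable (p : ℕ) [Fact p.Prime] (k : Type*) [Field k] [CharP k p]

/-- `K_0 = Frac(W(k))`. -/
abbrev K0 : Type _ := FractionRing (WittVector p k)

/-- An algebraic closure of `K_0`, in which all fields are taken. -/
abbrev Kbar : Type _ := AlgebraicClosure (K0 p k)

/-- `K_n = K_0(ζ_{p^n})`, obtained by adjoining all `p^n`-th roots of unity to `K_0`. -/
def cyc (n : ℕ) : IntermediateField (K0 p k) (Kbar p k) :=
  adjoin (K0 p k) {ζ | ζ ^ (p ^ n) = 1}

/-- `K_n(β)`. -/
def cycAdjoin (n : ℕ) (β : Kbar p k) : IntermediateField (K0 p k) (Kbar p k) :=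
  (adjoin (cyc p k n) {β}).restrictScalars (K0 p k)

variable {p k}

theorem cyc_mono {m n : ℕ} (h : m ≤ n) : cyc p k m ≤ cyc p k n := by
  refine adjoin.mono _ _ _ fun ζ hζ => ?_
  obtain ⟨d, hd⟩ := pow_dvd_pow p h
  simp only [Set.mem_ofPred_eq] at hζ ⊢
  rw [hd, pow_mul, hζ, one_pow]

theorem cycAdjoin_le {m n : ℕ} (h : m ≤ n) {β γ : Kbar p k} (hβ : β ∈ cycAdjoin p k n γ) :
    cycAdjoin p k m β ≤ cycAdjoin p k n γ := by
  intro x hx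
  have hx' : x ∈ adjoin (cyc p k m) {β} := hx
  refine adjoin_induction (cyc p k m) (p := fun x _ => x ∈ cycAdjoin p k n γ)
    ?_ ?_ ?_ ?_ ?_ hx'
  · rintro y rfl
    exact hβ
  · intro y
    exact (adjoin (cyc p k n) {γ}).algebraMap_mem ⟨y, cyc_mono h y.2⟩
  · intro y z _ _ hy hz
    exact add_mem hy hz
  · intro y _ hy
    exact inv_mem hy
  · intro y z _ _ hy hz
    exact mul_mem hy hz

theorem self_mem_cycAdjoin (n : ℕ) (β : Kbar p k) : β ∈ cycAdjoin p k n β :=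
  mem_adjoin_simple_self (cyc p k n) β

/-- `K_m(β) ⊆ K_n(β)` for `m ≤ n`. -/
theorem cycAdjoin_mono {m n : ℕ} (h : m ≤ n) (β : Kbar p k) :
    cycAdjoin p k m β ≤ cycAdjoin p k n β :=
  cycAdjoin_le h (self_mem_cycAdjoin n β)

/-- `K_n(β ^ j) ⊆ K_n(β)`. -/
theorem cycAdjoin_pow_le (n j : ℕ) (β : Kbar p k) :
    cycAdjoin p k n (β ^ j) ≤ cycAdjoin p k n β :=
  cycAdjoin_le le_rfl (pow_mem (self_mem_cycAdjoin n β) j)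

/-- For `M ⊆ L ⊆ Kbar`: the extension `L/M` is Galois. -/
def IsGaloisExt {M L : IntermediateField (K0 p k) (Kbar p k)} (h : M ≤ L) : Prop :=
  letI : Algebra M L := (inclusion h).toRingHom.toAlgebra
  IsGalois M L

/-- For `M ⊆ L ⊆ Kbar`, both finite over `K_0`: the conductor of `L/M`. -/
def relConductor {M L : IntermediateField (K0 p k) (Kbar p k)} (h : M ≤ L) : ℝ :=
  letI : Algebra M L := (inclusion h).toRingHom.toAlgebra
  ramConductor (WittVector p k) L M

variable (p k)

/-- `v_n`, the normalized valuation of `K_n`. -/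
def cycVal (n : ℕ) (x : cyc p k n) : WithTop ℤ := val (WittVector p k) (cyc p k n) x

end Fields

end WildConductor

end

/-! The $p$-adic absolute value extends to `Kbar`, and all ramification is read off from
displacements $|g\varpi-\varpi|$ of a uniformizer. Below, $\ell$ is `l + 1`, $n = v_\ell(t)$, $M =
K_\ell(\alpha)$ and $E = K_c(\alpha)$.

Kummer steps. Put $\delta=0$ if $p\nmid v_\ell(a)$ and $\delta=1$ if $a$ is a 1-unit. For each
$p^j$-th root $\beta$ of $a$ in the tower, $\beta-\delta$ keeps the same valuation $N$, prime to
$p$, in $K_\ell(\beta)$; for 1-units this holds because the level stays below $\frac{p}{p-1}e$.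
Hence each step is totally ramified of degree $p$, a monomial in $\beta-\delta$ and the previous
uniformizer is a uniformizer, and replacing $\beta$ by $\eta\beta$ with $\eta$ of order $p$
displaces it by valuation exactly $p^{\ell+j}-n+1$ at the step from level $j$ to $j+1$
(`KummerLevel.succ`). The last step, $j=c-1$, yields the exact conductor through `ramConductor_eq`.

Upper bound. $E/K_\ell$ is Galois. Let $H_j$ be the stabilizer of $\alpha^{p^{c-j}}$, so that $H_0$
is the whole group and $H_c = \mathrm{Gal}(E/M)$. For $1\ne g\in H_c$ with displacement $r$ put
$Y_j=\prod_{h\in H_j}\max(|h\varpi-\varpi|,r)$, a Herbrand function in multiplicative form. By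
`ramConductor_le` it suffices to bound $Y_c$ from below. Comparing cosets (`ramProd_le_mul`) gives
$Y_j\le Y_{j+1}\max(b_j,Y_{j+1})^{p-1}$, where $b_j$ is the displacement in the Kummer step. On the
other side $g$ fixes $\alpha$, so it must move $\zeta_{p^c}$, and the distances between conjugates
of $\zeta_{p^c}$ bound $Y_0$ from below (`pow_mul_le_ramProd_top`). If $Y_c$ were too small, the
recursion would push $Y_0$ under that bound (`pow_le_of_herbrand_recursion`). The exact degree and
ramification of $E/M$ are never needed. -/

noncomputable section

namespace WildConductor

/-! ### Normalized valuations expressed through a real absolute value -/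

section AbsVal

variable {A : Type*} [CommRing A] {L : Type*} [Field L] [Algebra A L]

/-- A nonarchimedean absolute value whose valuation ring is the integral closure of `A`. -/
structure IsIntegralAbs (A : Type*) [CommRing A] {L : Type*} [Field L] [Algebra A L]
    (w : AbsoluteValue L ℝ) : Prop where
  nonarch : IsNonarchimedean w
  isIntegral_iff : ∀ x, IsIntegral A x ↔ w x ≤ 1

/-- `ϖ` generates the value group of `w`, and `w ϖ < 1`. -/
structure IsValueGen (w : AbsoluteValue L ℝ) (ϖ : L) : Prop where
  pos : 0 < w ϖ
  lt_one : w ϖ < 1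
  exists_zpow : ∀ x, x ≠ 0 → ∃ n : ℤ, w x = w ϖ ^ n

theorem abs_sub_le_max {w : AbsoluteValue L ℝ} (hw : IsNonarchimedean w) (x y : L) :
    w (x - y) ≤ max (w x) (w y) := by
  rw [sub_eq_add_neg, ← w.map_neg y]
  exact hw x (-y)

theorem abs_one_add_of_lt {w : AbsoluteValue L ℝ} (hw : IsNonarchimedean w) {x : L}
    (hx : w x < 1) : w (1 + x) = 1 := by
  have := hw.add_eq_max_of_ne (x := 1) (y := x) (by simpa using hx.ne')
  rw [this, map_one, max_eq_left hx.le]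

theorem zpow_eq_iff {r : ℝ} (h0 : 0 < r) (h1 : r < 1) {m n : ℤ} : r ^ m = r ^ n ↔ m = n :=
  (zpow_right_strictAnti₀ h0 h1).injective.eq_iff

namespace IsIntegralAbs

variable {w : AbsoluteValue L ℝ} (hw : IsIntegralAbs A w) {ϖ : L} (hϖ : IsValueGen w ϖ)
include hw

theorem coe_le_one (x : integralClosure A L) : w (x : L) ≤ 1 := (hw.isIntegral_iff _).1 x.2

/-- The element of the ring of integers with underlying element `x`. -/
def toInt (x : L) (hx : w x ≤ 1) : integralClosure A L := ⟨x, (hw.isIntegral_iff x).2 hx⟩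

theorem isUnit_iff (x : integralClosure A L) : IsUnit x ↔ w (x : L) = 1 := by
  constructor
  · rintro ⟨u, rfl⟩
    have h1 := hw.coe_le_one (u : integralClosure A L)
    have h2 := hw.coe_le_one ((u⁻¹ : (integralClosure A L)ˣ) : integralClosure A L)
    have h3 : w ((u : integralClosure A L) : L) *
        w (((u⁻¹ : (integralClosure A L)ˣ) : integralClosure A L) : L) = 1 := by
      rw [← map_mul, ← MulMemClass.coe_mul, Units.mul_inv]
      simp
    have := w.nonneg ((u : integralClosure A L) : L)
    nlinarith
  · intro h
    have hx0 : (x : L) ≠ 0 := by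
      intro h0
      simp [h0] at h
    have hinv : w ((x : L)⁻¹) ≤ 1 := by rw [map_inv₀, h, inv_one]
    refine IsUnit.of_mul_eq_one (hw.toInt _ hinv) ?_
    ext
    simp [toInt, hx0]

include hϖ

theorem isUniformizer_iff (x : integralClosure A L) :
    IsUniformizer A L x ↔ w (x : L) = w ϖ := by
  have hϖ1 := hϖ.lt_one
  have hϖ0 := hϖ.pos
  constructor
  · intro h
    have hx0 : (x : L) ≠ 0 := by
      have := h.ne_zero
      simpa using this
    obtain ⟨n, hn⟩ := hϖ.exists_zpow _ hx0
    have hlt : w (x : L) < 1 := lt_of_le_of_ne (hw.coe_le_one x) fun h1 =>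
      h.not_isUnit ((hw.isUnit_iff x).2 h1)
    have hnpos : 0 < n := by
      by_contra hc
      push Not at hc
      have := one_le_zpow_of_nonpos₀ hϖ0 hϖ1.le hc
      linarith [hn ▸ hlt]
    have hϖne : ϖ ≠ 0 := w.pos_iff.1 hϖ0
    have hq : w ((x : L) / ϖ) ≤ 1 := by
      rw [map_div₀, hn, div_le_one hϖ0]
      calc w ϖ ^ n ≤ w ϖ ^ (1 : ℤ) := zpow_le_zpow_right_of_le_one₀ hϖ0 hϖ1.le (by omega)
        _ = w ϖ := zpow_one _
    have hfac : x = hw.toInt ϖ hϖ1.le * hw.toInt _ hq := by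
      ext
      simp [toInt]
      field_simp
    rcases h.isUnit_or_isUnit hfac with h1 | h1
    · have := (hw.isUnit_iff _).1 h1
      exact absurd this hϖ1.ne
    · have h2 := (hw.isUnit_iff _).1 h1
      have h3 : w ((x : L) / ϖ) = 1 := h2
      rw [map_div₀, div_eq_one_iff_eq hϖ0.ne'] at h3
      exact h3
  · intro h
    refine ⟨fun hu => ?_, fun a b hab => ?_⟩
    · rw [hw.isUnit_iff, h] at hu
      exact hϖ1.ne hu
    · have hab' : w (a : L) * w (b : L) = w ϖ := by
        rw [← map_mul, ← h, hab]
        rfl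
      have ha0 : (a : L) ≠ 0 := by
        intro h0
        rw [h0, map_zero, zero_mul] at hab'
        exact hϖ0.ne hab'
      have hb0 : (b : L) ≠ 0 := by
        intro h0
        rw [h0, map_zero, mul_zero] at hab'
        exact hϖ0.ne hab'
      rw [hw.isUnit_iff, hw.isUnit_iff]
      obtain ⟨m, hm⟩ := hϖ.exists_zpow _ ha0
      obtain ⟨n, hn⟩ := hϖ.exists_zpow _ hb0
      have hmn : m + n = 1 := by
        rw [← zpow_eq_iff hϖ0 hϖ1, zpow_add₀ hϖ0.ne', ← hm, ← hn, hab', zpow_one]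
      have ha := hw.coe_le_one a
      have hb := hw.coe_le_one b
      have hm0 : 0 ≤ m := by
        by_contra hc
        push Not at hc
        have := one_lt_zpow_of_neg₀ hϖ0 hϖ1 hc
        linarith
      have hn0 : 0 ≤ n := by
        by_contra hc
        push Not at hc
        have := one_lt_zpow_of_neg₀ hϖ0 hϖ1 hc
        linarith
      have : m = 0 ∨ n = 0 := by omega
      rcases this with rfl | rfl
      · left; simpa using hm
      · right; simpa using hn

theorem hasVal_iff (x : L) (n : ℤ) : HasVal A L x n ↔ w x = w ϖ ^ n := by
  constructor
  · rintro ⟨π, u, hπ, rfl⟩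
    rw [hw.isUniformizer_iff hϖ] at hπ
    have hu := (hw.isUnit_iff _).1 u.isUnit
    rw [map_mul, map_zpow₀, hπ, hu, mul_one]
  · intro h
    have hϖne : ϖ ≠ 0 := w.pos_iff.1 hϖ.pos
    have hu : w (x / ϖ ^ n) = 1 := by
      rw [map_div₀, map_zpow₀, h, div_self (zpow_pos hϖ.pos n).ne']
    have hu' : IsUnit (hw.toInt _ hu.le) := (hw.isUnit_iff _).2 hu
    refine ⟨hw.toInt ϖ hϖ.lt_one.le, hu'.unit, (hw.isUniformizer_iff hϖ _).2 rfl, ?_⟩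
    change x = ϖ ^ n * (x / ϖ ^ n)
    have := zpow_ne_zero n hϖne
    field_simp

/-- Replaces the choice inside `val` by an equation of real numbers, so that later arguments only
use `w`. -/
theorem val_eq_coe_iff (x : L) (n : ℤ) : val A L x = n ↔ w x = w ϖ ^ n := by
  unfold val
  split_ifs with h
  · have h1 := (hw.hasVal_iff hϖ x _).1 h.choose_spec
    rw [WithTop.coe_inj, h1, zpow_eq_iff hϖ.pos hϖ.lt_one]
  · simp only [WithTop.top_ne_coe, false_iff]
    exact fun h2 => h ⟨n, (hw.hasVal_iff hϖ x n).2 h2⟩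

theorem val_zero_eq_top : val A L (0 : L) = ⊤ := by
  unfold val
  split_ifs with h
  · have h1 := (hw.hasVal_iff hϖ _ _).1 h.choose_spec
    rw [map_zero] at h1
    exact absurd h1 (zpow_pos hϖ.pos _).ne
  · rfl

end IsIntegralAbs

end AbsVal

/-! ### Displacements of integral elements under automorphisms -/

section AbsDiff

variable {A : Type*} [CommRing A] {L : Type*} [Field L] [Algebra A L]

/-- Over the ring of integers, $x-y$ divides $P(x)-P(y)$. -/
theorem IsIntegralAbs.abs_aeval_sub_le {w : AbsoluteValue L ℝ} (hw : IsIntegralAbs A w) {x y : L}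
    (hx : w x ≤ 1) (hy : w y ≤ 1) (P : Polynomial A) :
    w (Polynomial.aeval x P - Polynomial.aeval y P) ≤ w (x - y) := by
  obtain ⟨z, hz⟩ := Polynomial.sub_dvd_eval_sub (hw.toInt x hx) (hw.toInt y hy)
    (P.map (algebraMap A (integralClosure A L)))
  have key : ∀ t : integralClosure A L,
      (((P.map (algebraMap A (integralClosure A L))).eval t : integralClosure A L) : L) = Polynomial.aeval (t : L) P := by
    intro t
    rw [Polynomial.eval_map_algebraMap]
    exact (Polynomial.aeval_algebraMap_apply L t P).symm
  have h := congrArg (Subtype.val) hz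
  simp only [AddSubgroupClass.coe_sub, MulMemClass.coe_mul, key] at h
  change Polynomial.aeval x P - Polynomial.aeval y P = (x - y) * z at h
  rw [h, map_mul]
  exact mul_le_of_le_one_right (w.nonneg _) (hw.coe_le_one z)

/-- Every integral element is a polynomial in `ϖ` over `A`. -/
def Generates (A : Type*) [CommRing A] {L : Type*} [Field L] [Algebra A L]
    (w : AbsoluteValue L ℝ) (ϖ : L) : Prop :=
  ∀ x, w x ≤ 1 → ∃ P : Polynomial A, Polynomial.aeval ϖ P = x

variable {M : Type*} [Field M] [Algebra A M] [Algebra M L] [IsScalarTower A M L]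

theorem algEquiv_aeval (g : L ≃ₐ[M] L) (P : Polynomial A) (x : L) :
    g (Polynomial.aeval x P) = Polynomial.aeval (g x) P := by
  have := Polynomial.aeval_algHom_apply ((g : L →ₐ[M] L).restrictScalars A) x P
  exact this.symm

theorem IsIntegralAbs.abs_map_sub_le {w : AbsoluteValue L ℝ} (hw : IsIntegralAbs A w) {ϖ : L}
    (hϖ1 : w ϖ ≤ 1) (hgen : Generates A w ϖ) (hinv : ∀ (g : L ≃ₐ[M] L) x, w (g x) = w x)
    (g : L ≃ₐ[M] L) {x : L} (hx : w x ≤ 1) : w (g x - x) ≤ w (g ϖ - ϖ) := by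
  obtain ⟨P, rfl⟩ := hgen x hx
  rw [algEquiv_aeval]
  exact hw.abs_aeval_sub_le (by rwa [hinv]) hϖ1 P

theorem eq_one_of_map_eq {w : AbsoluteValue L ℝ} {ϖ : L} (hgen : Generates A w ϖ)
    (g : L ≃ₐ[M] L) (hg : g ϖ = ϖ) : g = 1 := by
  have h1 : ∀ x, w x ≤ 1 → g x = x := by
    intro x hx
    obtain ⟨P, rfl⟩ := hgen x hx
    rw [algEquiv_aeval, hg]
  ext x
  rcases le_total (w x) 1 with hx | hx
  · exact h1 x hx
  · have hx' : w x⁻¹ ≤ 1 := by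
      rw [map_inv₀]
      exact inv_le_one_of_one_le₀ hx
    have := h1 _ hx'
    rw [map_inv₀, inv_inj] at this
    exact this

end AbsDiff

/-! ### The Herbrand function and criteria for the conductor -/

section Conductor

open Finset

theorem integral_indicator_le (a u : ℝ) (ha : 0 ≤ a) (hu : 0 ≤ u) :
    ∫ t in (0 : ℝ)..u, (if t ≤ a then (1 : ℝ) else 0) = min u a := by
  rcases le_total a u with h | h
  · have := intervalIntegral.integral_indicator (μ := MeasureTheory.volume)
      (f := fun _ : ℝ => (1 : ℝ)) (a₁ := 0) (a₂ := a) (a₃ := u) ⟨ha, h⟩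
    simp only [Set.indicator, Set.mem_ofPred_eq] at this
    rw [this]
    simp [h]
  · rw [intervalIntegral.integral_congr (g := fun _ => (1 : ℝ))]
    · simp [h]
    · intro t ht
      rw [Set.uIcc_of_le hu] at ht
      simp [ht.2.trans h]

theorem intervalIntegrable_indicator_le (a u : ℝ) :
    IntervalIntegrable (fun t : ℝ => if t ≤ a then (1 : ℝ) else 0) MeasureTheory.volume 0 u := by
  refine Antitone.intervalIntegrable fun x y hxy => ?_
  split_ifs with h1 h2 <;> first | rfl | norm_num
  exact h2 (hxy.trans h1)

variable {A : Type*} [CommRing A] {L : Type*} [Field L] [Algebra A L]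
  {M : Type*} [Field M] [Algebra A M] [Algebra M L] [IsScalarTower A M L]
  {w : AbsoluteValue L ℝ} (hw : IsIntegralAbs A w) {ϖ : L} (hϖ : IsValueGen w ϖ)
  (hgen : ∀ π, w π = w ϖ → Generates A w π) (hinv : ∀ (g : L ≃ₐ[M] L) x, w (g x) = w x)
include hw hϖ hgen hinv

/-- Each uniformizer generates the ring of integers, so the displacement of either one bounds that
of the other. This removes the quantifier over uniformizers in `lowerRam`. -/
theorem abs_map_sub_eq (g : L ≃ₐ[M] L) {π : L} (hπ : w π = w ϖ) :
    w (g π - π) = w (g ϖ - ϖ) := by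
  have h1 := hϖ.lt_one.le
  exact le_antisymm (hw.abs_map_sub_le h1 (hgen ϖ rfl) hinv g (hπ ▸ h1))
    (hw.abs_map_sub_le (hπ ▸ h1) (hgen π hπ) hinv g h1)

theorem exists_ramIndex : ∃ i : (L ≃ₐ[M] L) → ℕ,
    ∀ g, g ≠ 1 → 1 ≤ i g ∧ w (g ϖ - ϖ) = w ϖ ^ i g := by
  have : ∀ g : L ≃ₐ[M] L, ∃ n : ℕ, g ≠ 1 → 1 ≤ n ∧ w (g ϖ - ϖ) = w ϖ ^ n := by
    intro g
    by_cases hg : g = 1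
    · exact ⟨0, fun h => absurd hg h⟩
    have hne : g ϖ - ϖ ≠ 0 := fun h =>
      hg (eq_one_of_map_eq (hgen ϖ rfl) g (sub_eq_zero.1 h))
    obtain ⟨n, hn⟩ := hϖ.exists_zpow _ hne
    have hle : w (g ϖ - ϖ) ≤ w ϖ := by
      have := abs_sub_le_max hw.nonarch (g ϖ) ϖ
      rwa [hinv, max_self] at this
    have hn1 : 1 ≤ n := by
      rw [hn] at hle
      by_contra hc
      have : w ϖ ^ (1 : ℤ) < w ϖ ^ n := zpow_right_strictAnti₀ hϖ.pos hϖ.lt_one (by omega)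
      rw [zpow_one] at this
      linarith
    refine ⟨n.toNat, fun _ => ⟨by omega, ?_⟩⟩
    rw [hn, ← zpow_natCast, Int.toNat_of_nonneg (by omega)]
  choose i hi using this
  exact ⟨i, hi⟩

theorem mem_lowerRam_iff {i : (L ≃ₐ[M] L) → ℕ}
    (hi : ∀ g, g ≠ 1 → 1 ≤ i g ∧ w (g ϖ - ϖ) = w ϖ ^ i g) (t : ℝ) (g : L ≃ₐ[M] L) :
    g ∈ lowerRam A L M t ↔ g = 1 ∨ t ≤ (i g : ℝ) - 1 := by
  by_cases hg : g = 1
  · subst hg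
    simp only [true_or, iff_true]
    intro π _
    simp [hw.val_zero_eq_top hϖ]
  · simp only [hg, false_or]
    have hval : ∀ π : L, w π = w ϖ → val A L (g π - π) = ((i g : ℤ) : WithTop ℤ) := by
      intro π hπ
      rw [hw.val_eq_coe_iff hϖ, abs_map_sub_eq hw hϖ hgen hinv g hπ, (hi g hg).2, zpow_natCast]
    have key : ((t + 1 : ℝ) : WithTop ℝ) ≤
        (((i g : ℤ) : WithTop ℤ)).map (fun n : ℤ => (n : ℝ)) ↔ t ≤ (i g : ℝ) - 1 := by
      rw [WithTop.map_coe, WithTop.coe_le_coe]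
      push_cast
      constructor <;> intro h <;> linarith
    constructor
    · intro h
      have h1 := h (hw.toInt ϖ hϖ.lt_one.le) ((hw.isUniformizer_iff hϖ _).2 rfl)
      have h2 : ((t + 1 : ℝ) : WithTop ℝ) ≤ (val A L (g ϖ - ϖ)).map (fun n : ℤ => (n : ℝ)) := h1
      rwa [hval ϖ rfl, key] at h2
    · intro h π hπ
      rw [hval π ((hw.isUniformizer_iff hϖ _).1 hπ), key]
      exact h

-- The order of $G_t$ is a sum of indicators of $t\le i_g-1$, each integrating to $\min(u,i_g-1)$.
-- The identity has infinite index; capping it at $u$ changes nothing on $[0,u]$.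
open Classical in
theorem phi_eq [Fintype (L ≃ₐ[M] L)] {i : (L ≃ₐ[M] L) → ℕ}
    (hi : ∀ g, g ≠ 1 → 1 ≤ i g ∧ w (g ϖ - ϖ) = w ϖ ^ i g) {u : ℝ} (hu : 0 ≤ u) :
    phi A L M u =
      (∑ g : L ≃ₐ[M] L, min u (if g = 1 then u else (i g : ℝ) - 1)) /
        Fintype.card (L ≃ₐ[M] L) := by
  have hcard : ∀ t : ℝ, t ∈ Set.uIcc 0 u → ((lowerRam A L M t).ncard : ℝ) =
      ∑ g : L ≃ₐ[M] L, if t ≤ (if g = 1 then u else (i g : ℝ) - 1) then (1 : ℝ) else 0 := by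
    intro t ht
    rw [Set.uIcc_of_le hu] at ht
    rw [Set.ncard_eq_toFinset_card', sum_boole]
    congr 2
    ext g
    rw [Set.mem_toFinset, mem_lowerRam_iff hw hϖ hgen hinv hi]
    by_cases hg : g = 1 <;> simp [hg, ht.2]
  have hcard0 : (lowerRam A L M 0).ncard = Fintype.card (L ≃ₐ[M] L) := by
    have : lowerRam A L M 0 = Set.univ := by
      ext g
      rw [mem_lowerRam_iff hw hϖ hgen hinv hi]
      simp only [Set.mem_univ, iff_true]
      by_cases hg : g = 1
      · exact Or.inl hg
      · right
        have := (hi g hg).1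
        have : (1 : ℝ) ≤ i g := by exact_mod_cast this
        linarith
    rw [this, Set.ncard_univ, Nat.card_eq_fintype_card]
  unfold phi
  rw [hcard0, intervalIntegral.integral_div]
  congr 1
  rw [intervalIntegral.integral_congr hcard, intervalIntegral.integral_finsetSum]
  · refine sum_congr rfl fun g _ => ?_
    refine integral_indicator_le _ _ ?_ hu
    split_ifs with hg
    · exact hu
    · have := (hi g hg).1
      have : (1 : ℝ) ≤ i g := by exact_mod_cast this
      linarith
  · intro g _
    exact intervalIntegrable_indicator_le _ _

open Classical in
theorem phi_mono [Fintype (L ≃ₐ[M] L)] {u v : ℝ} (hu : 0 ≤ u) (huv : u < v) :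
    phi A L M u < phi A L M v := by
  obtain ⟨i, hi⟩ := exists_ramIndex hw hϖ hgen hinv (M := M)
  rw [phi_eq hw hϖ hgen hinv hi hu, phi_eq hw hϖ hgen hinv hi (hu.trans huv.le)]
  have hc : (0 : ℝ) < Fintype.card (L ≃ₐ[M] L) := by exact_mod_cast Fintype.card_pos
  refine div_lt_div_of_pos_right ?_ hc
  refine sum_lt_sum (fun g _ => ?_) ⟨1, mem_univ _, by simpa using huv⟩
  split_ifs
  · simpa using huv.le
  · exact min_le_min_right _ huv.le

open Classical in
theorem exists_phi_eq [Fintype (L ≃ₐ[M] L)] {x : ℝ} (hx : 0 ≤ x) :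
    ∃ u ∈ Set.Ici (0 : ℝ), phi A L M u = x := by
  obtain ⟨i, hi⟩ := exists_ramIndex hw hϖ hgen hinv (M := M)
  have hc : (0 : ℝ) < Fintype.card (L ≃ₐ[M] L) := by exact_mod_cast Fintype.card_pos
  set F : ℝ → ℝ := fun u => (∑ g : L ≃ₐ[M] L, min u (if g = 1 then u else (i g : ℝ) - 1)) /
        Fintype.card (L ≃ₐ[M] L) with hF
  have hcont : Continuous F := by
    refine Continuous.div_const (continuous_finsetSum _ fun g _ => ?_) _
    by_cases hg : g = 1 <;> simp only [hg, if_true, if_false] <;> fun_prop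
  have hi1 : ∀ g : L ≃ₐ[M] L, g ≠ 1 → (0 : ℝ) ≤ (i g : ℝ) - 1 := fun g hg => by
    have := (hi g hg).1
    have : (1 : ℝ) ≤ i g := by exact_mod_cast this
    linarith
  have h0 : F 0 = 0 := by
    rw [hF]
    simp only
    rw [sum_eq_zero, zero_div]
    intro g _
    split_ifs with hg
    · simp
    · exact min_eq_left (hi1 g hg)
  have hy : 0 ≤ x * Fintype.card (L ≃ₐ[M] L) := by positivity
  have hbig : x ≤ F (x * Fintype.card (L ≃ₐ[M] L)) := by
    rw [hF]
    simp only
    rw [le_div_iff₀ hc]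
    have := single_le_sum (s := univ) (f := fun g : L ≃ₐ[M] L =>
      min (x * Fintype.card (L ≃ₐ[M] L))
        (if g = 1 then x * Fintype.card (L ≃ₐ[M] L) else (i g : ℝ) - 1))
      (fun g _ => ?_) (mem_univ 1)
    · simpa using this
    · refine le_min hy ?_
      split_ifs with hg
      · exact hy
      · exact hi1 g hg
  obtain ⟨u, hu, hux⟩ := intermediate_value_Icc hy hcont.continuousOn
    (show x ∈ Set.Icc (F 0) (F (x * Fintype.card (L ≃ₐ[M] L))) from ⟨by rwa [h0], hbig⟩)
  exact ⟨u, hu.1, by rw [phi_eq hw hϖ hgen hinv hi hu.1]; exact hux⟩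

/-- Surjectivity of $\varphi$ already makes the chosen preimage a right inverse. Strict monotonicity
is needed only to identify $\psi(m)$ in `ramConductor_eq`. -/
theorem psi_spec [Fintype (L ≃ₐ[M] L)] {x : ℝ} (hx : 0 ≤ x) :
    0 ≤ psi A L M x ∧ phi A L M (psi A L M x) = x :=
  ⟨Function.invFunOn_mem (exists_phi_eq hw hϖ hgen hinv hx),
    Function.invFunOn_eq (exists_phi_eq hw hϖ hgen hinv hx)⟩

/-- If $1\ne g\in G^x$ then $\psi(x)\le i_g-1$, hence $x\le\varphi(i_g-1)$. Since
$|G|(\varphi(i_g-1)+1)=\sum_h\min(i_h,i_g)$, the product in `hbd` says precisely that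
$\varphi(i_g-1)\le m$. -/
theorem le_of_upperRam_ne [Fintype (L ≃ₐ[M] L)] (m : ℕ)
    (hbd : ∀ g : L ≃ₐ[M] L, g ≠ 1 → w ϖ ^ (Fintype.card (L ≃ₐ[M] L) * (m + 1)) ≤
      ∏ h : L ≃ₐ[M] L, max (w (h ϖ - ϖ)) (w (g ϖ - ϖ))) {x : ℝ} (hx : 0 ≤ x)
    (hne : upperRam A L M x ≠ {1}) : x ≤ m := by
  classical
  obtain ⟨i, hi⟩ := exists_ramIndex hw hϖ hgen hinv (M := M)
  obtain ⟨hpsi0, hpsi⟩ := psi_spec hw hϖ hgen hinv (M := M) hx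
  have hmem := fun g => mem_lowerRam_iff hw hϖ hgen hinv hi (psi A L M x) g
  have h1 : (1 : L ≃ₐ[M] L) ∈ upperRam A L M x := (hmem 1).2 (Or.inl rfl)
  obtain ⟨g, hg, hg1⟩ : ∃ g ∈ upperRam A L M x, g ≠ 1 := by
    by_contra hc
    push Not at hc
    exact hne (Set.Subset.antisymm (fun g hg => hc g hg) (by simpa using h1))
  have hle : psi A L M x ≤ (i g : ℝ) - 1 := by
    rcases (hmem g).1 hg with h | h
    · exact absurd h hg1
    · exact h
  have hc : (0 : ℝ) < Fintype.card (L ≃ₐ[M] L) := by exact_mod_cast Fintype.card_pos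
  -- the product bound in terms of the exponents
  have hprod : ∏ h : L ≃ₐ[M] L, max (w (h ϖ - ϖ)) (w (g ϖ - ϖ)) =
      w ϖ ^ ∑ h : L ≃ₐ[M] L, (if h = 1 then i g else min (i h) (i g)) := by
    rw [← prod_pow_eq_pow_sum]
    refine prod_congr rfl fun h _ => ?_
    split_ifs with hh
    · subst hh
      simp [(hi g hg1).2]
    · rw [(hi g hg1).2, (hi h hh).2]
      have hanti : Antitone fun n : ℕ => w ϖ ^ n := fun a b hab =>
        pow_le_pow_of_le_one hϖ.pos.le hϖ.lt_one.le hab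
      exact (hanti.map_min).symm
  have hsum : ∑ h : L ≃ₐ[M] L, (if h = 1 then i g else min (i h) (i g)) ≤
      Fintype.card (L ≃ₐ[M] L) * (m + 1) := by
    have := hbd g hg1
    rw [hprod] at this
    exact (pow_le_pow_iff_right_of_lt_one₀ hϖ.pos hϖ.lt_one).1 this
  have hsum' : ∑ h : L ≃ₐ[M] L, (if h = 1 then (i g : ℝ) else min (i h : ℝ) (i g)) ≤
      Fintype.card (L ≃ₐ[M] L) * ((m : ℝ) + 1) := by
    have : ((∑ h : L ≃ₐ[M] L, (if h = 1 then i g else min (i h) (i g)) : ℕ) : ℝ) ≤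
      ((Fintype.card (L ≃ₐ[M] L) * (m + 1) : ℕ) : ℝ) := by exact_mod_cast hsum
    push_cast at this
    exact this
  have hphi : phi A L M (psi A L M x) ≤ m := by
    rw [phi_eq hw hϖ hgen hinv hi hpsi0, div_le_iff₀ hc]
    calc ∑ h : L ≃ₐ[M] L, min (psi A L M x) (if h = 1 then psi A L M x else (i h : ℝ) - 1)
        ≤ ∑ h : L ≃ₐ[M] L, ((if h = 1 then (i g : ℝ) else min (i h : ℝ) (i g)) - 1) := by
          refine sum_le_sum fun h _ => ?_
          split_ifs with hh
          · simpa using hle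
          · refine le_sub_iff_add_le.2 (le_min ?_ ?_)
            · linarith [min_le_right (psi A L M x) ((i h : ℝ) - 1)]
            · linarith [min_le_left (psi A L M x) ((i h : ℝ) - 1)]
      _ ≤ _ := by
          rw [sum_sub_distrib]
          simp only [sum_const, card_univ, nsmul_eq_mul, mul_one]
          linarith
  rwa [hpsi] at hphi

/-- An upper bound for the conductor of `L/M`. -/
theorem ramConductor_le [Fintype (L ≃ₐ[M] L)] (m : ℕ)
    (hbd : ∀ g : L ≃ₐ[M] L, g ≠ 1 → w ϖ ^ (Fintype.card (L ≃ₐ[M] L) * (m + 1)) ≤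
      ∏ h : L ≃ₐ[M] L, max (w (h ϖ - ϖ)) (w (g ϖ - ϖ))) :
    ramConductor A L M ≤ m :=
  Real.sSup_le (fun _ hx => le_of_upperRam_ne hw hϖ hgen hinv m hbd hx.1 hx.2) m.cast_nonneg

/-- The conductor of an extension all of whose nontrivial automorphisms have the same index. -/
theorem ramConductor_eq [Fintype (L ≃ₐ[M] L)] (m : ℕ)
    (heq : ∀ g : L ≃ₐ[M] L, g ≠ 1 → w (g ϖ - ϖ) = w ϖ ^ (m + 1)) (hnt : ∃ g : L ≃ₐ[M] L, g ≠ 1) :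
    ramConductor A L M = m := by
  classical
  have hbd : ∀ g : L ≃ₐ[M] L, g ≠ 1 → w ϖ ^ (Fintype.card (L ≃ₐ[M] L) * (m + 1)) ≤
      ∏ h : L ≃ₐ[M] L, max (w (h ϖ - ϖ)) (w (g ϖ - ϖ)) := by
    intro g hg
    rw [mul_comm, pow_mul, ← card_univ, ← prod_const]
    refine prod_le_prod (fun _ _ => pow_nonneg hϖ.pos.le _) fun h _ => ?_
    rw [heq g hg]
    exact le_max_right _ _
  refine le_antisymm (ramConductor_le hw hϖ hgen hinv m hbd) ?_
  have hi : ∀ g : L ≃ₐ[M] L, g ≠ 1 →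
      1 ≤ (fun _ => m + 1) g ∧ w (g ϖ - ϖ) = w ϖ ^ (fun _ => m + 1) g :=
    fun g hg => ⟨Nat.le_add_left _ _, heq g hg⟩
  have hm0 : (0 : ℝ) ≤ m := m.cast_nonneg
  refine le_csSup ⟨m, fun x hx => le_of_upperRam_ne hw hϖ hgen hinv m hbd hx.1 hx.2⟩ ⟨hm0, ?_⟩
  -- All indices equal $m+1$, so $\varphi(m)=m=\psi(m)$ and $G^m$ still contains every $g$: the
  -- supremum is attained at $m$.
  have hphi : phi A L M m = m := by
    rw [phi_eq hw hϖ hgen hinv hi hm0]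
    have : ∀ g : L ≃ₐ[M] L, min (m : ℝ) (if g = 1 then (m : ℝ) else ((m + 1 : ℕ) : ℝ) - 1) = m := by
      intro g
      split_ifs <;> simp
    simp only [this, sum_const, card_univ, nsmul_eq_mul]
    have hc : (Fintype.card (L ≃ₐ[M] L) : ℝ) ≠ 0 := by exact_mod_cast Fintype.card_ne_zero
    field_simp
  obtain ⟨hpsi0, hpsi⟩ := psi_spec hw hϖ hgen hinv (M := M) hm0
  have hpsim : psi A L M m = m := by
    rcases lt_trichotomy (psi A L M m) m with h | h | h
    · have := phi_mono hw hϖ hgen hinv (M := M) hpsi0 h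
      rw [hpsi, hphi] at this
      exact absurd this (lt_irrefl _)
    · exact h
    · have := phi_mono hw hϖ hgen hinv (M := M) hm0 h
      rw [hpsi, hphi] at this
      exact absurd this (lt_irrefl _)
  obtain ⟨g, hg⟩ := hnt
  intro h
  have hgm : g ∈ upperRam A L M m := by
    refine (mem_lowerRam_iff hw hϖ hgen hinv hi _ g).2 (Or.inr ?_)
    rw [hpsim]
    simp
  rw [h] at hgm
  exact hg hgm

end Conductor

/-! ### Multiplicative Herbrand functions of subgroups -/

section Products

open Finset

/-- Omitting factors that are at most 1 only increases a product, so distinct elements or cosets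
suffice and no index has to be computed. -/
theorem prod_le_prod_comp_of_injective {α β : Type*} [Fintype α] [Fintype β] (f : β → ℝ)
    (h0 : ∀ b, 0 ≤ f b) (h1 : ∀ b, f b ≤ 1) {φ : α → β} (hφ : Function.Injective φ) :
    ∏ b, f b ≤ ∏ a, f (φ a) := by
  classical
  have h2 : ∏ a, f (φ a) = ∏ b ∈ univ.image φ, f b := (prod_image hφ.injOn).symm
  rw [h2, ← prod_sdiff (subset_univ (univ.image φ))]
  exact mul_le_of_le_one_left (prod_nonneg fun b _ => h0 b)
    (prod_le_one (fun b _ => h0 b) fun b _ => h1 b)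

end Products

section Herbrand

open Finset Polynomial

variable {A : Type*} [CommRing A] {B : Type*} [Field B] {E : Type*} [Field E] [Algebra A E]
  [Algebra B E] {w : AbsoluteValue E ℝ}

section Basic

variable (hna : IsNonarchimedean w) (hinv : ∀ (g : E ≃ₐ[B] E) x, w (g x) = w x) (ϖ : E)
include hinv

theorem abs_inv_map_sub (g : E ≃ₐ[B] E) : w (g⁻¹ ϖ - ϖ) = w (g ϖ - ϖ) := by
  rw [← hinv g, map_sub, ← AlgEquiv.mul_apply, mul_inv_cancel, w.map_sub]
  rfl

include hna

theorem abs_mul_map_sub_le (g h : E ≃ₐ[B] E) :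
    w ((g * h) ϖ - ϖ) ≤ max (w (g ϖ - ϖ)) (w (h ϖ - ϖ)) := by
  have : (g * h) ϖ - ϖ = (g ϖ - ϖ) + g (h ϖ - ϖ) := by
    rw [map_sub, AlgEquiv.mul_apply]
    ring
  rw [this, ← hinv g (h ϖ - ϖ)]
  exact hna _ _

/-- In each left coset there is an element at which the ramification function is minimal, and
the coset is then the sphere-like translate of the subgroup. -/
theorem exists_coset_min [Finite (E ≃ₐ[B] E)] (N : Subgroup (E ≃ₐ[B] E)) (s : E ≃ₐ[B] E) :
    ∃ n ∈ N, ∀ h ∈ N, w ((s * n * h) ϖ - ϖ) = max (w ((s * n) ϖ - ϖ)) (w (h ϖ - ϖ)) := by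
  obtain ⟨n, hn⟩ := Finite.exists_min fun n : N => w ((s * (n : E ≃ₐ[B] E)) ϖ - ϖ)
  refine ⟨n, n.2, fun h hh => le_antisymm (abs_mul_map_sub_le hna hinv ϖ _ _) ?_⟩
  have h1 : w ((s * n) ϖ - ϖ) ≤ w ((s * n * h) ϖ - ϖ) := by
    have := hn (n * ⟨h, hh⟩)
    simpa [mul_assoc] using this
  refine max_le h1 ?_
  have h2 := abs_mul_map_sub_le hna hinv ϖ (s * n)⁻¹ (s * n * h)
  rw [inv_mul_cancel_left, abs_inv_map_sub hinv] at h2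
  exact h2.trans (max_le h1 le_rfl)

end Basic

variable [Fintype (E ≃ₐ[B] E)]

open scoped Classical in
/-- The Herbrand function of a subgroup `N` in multiplicative form. -/
def ramProd (w : AbsoluteValue E ℝ) (ϖ : E) (N : Subgroup (E ≃ₐ[B] E)) (r : ℝ) : ℝ :=
  ∏ h : N, max (w ((h : E ≃ₐ[B] E) ϖ - ϖ)) r

-- Normalize the representative of $sN$ to have minimal displacement $d$. If $d\le r$, the truncated
-- factors are those of $N$ itself; if $r\le d$, truncation has no effect and `hb` applies.
open scoped Classical in
theorem prod_coset_max_le (hna : IsNonarchimedean w)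
    (hinv : ∀ (g : E ≃ₐ[B] E) x, w (g x) = w x) (ϖ : E)
    (N : Subgroup (E ≃ₐ[B] E)) (s : E ≃ₐ[B] E) {b : ℝ}
    (hb : ∏ h : N, w ((s * (h : E ≃ₐ[B] E)) ϖ - ϖ) ≤ b) (r : ℝ) :
    ∏ h : N, max (w ((s * (h : E ≃ₐ[B] E)) ϖ - ϖ)) r ≤ max b (ramProd w ϖ N r) := by
  obtain ⟨n, hn, hmin⟩ := exists_coset_min hna hinv ϖ N s
  have hre : ∀ F : (E ≃ₐ[B] E) → ℝ, ∏ h : N, F (s * h) = ∏ h : N, F (s * n * h) := by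
    intro F
    refine (Fintype.prod_equiv (Equiv.mulLeft (⟨n, hn⟩ : N)) _ _ fun h => ?_).symm
    simp [mul_assoc]
  rw [hre fun g => w (g ϖ - ϖ)] at hb
  rw [hre fun g => max (w (g ϖ - ϖ)) r]
  rcases le_total (w ((s * n) ϖ - ϖ)) r with h | h
  · refine le_trans (le_of_eq ?_) (le_max_right _ _)
    refine prod_congr rfl fun h' _ => ?_
    rw [hmin _ h'.2, max_comm (w ((s * n) ϖ - ϖ)), max_assoc, max_eq_right h]
  · refine le_trans (le_of_eq ?_) (hb.trans (le_max_left _ _))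
    refine prod_congr rfl fun h' _ => ?_
    rw [hmin _ h'.2]
    exact max_eq_left (h.trans (le_max_left _ _))

variable (hw : IsIntegralAbs A w) (hinv : ∀ (g : E ≃ₐ[B] E) x, w (g x) = w x) {ϖ : E}
  (hϖ1 : w ϖ ≤ 1)
include hw hinv hϖ1

-- Let $f=\prod_{h\in N}(X-h\varpi)$, whose coefficients $a_i$ are integral and fixed by $N$. As
-- $f(\varpi)=0$, the product $\prod(\varpi-sh\varpi)=(sf)(\varpi)$ equals $\sum(sa_i-a_i)\varpi^i$.
open scoped Classical in
theorem prod_coset_le (N : Subgroup (E ≃ₐ[B] E)) (s : E ≃ₐ[B] E) {b : ℝ}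
    (hb : ∀ x, (∀ h ∈ N, h x = x) → w x ≤ 1 → w (s x - x) ≤ b) :
    ∏ h : N, w ((s * (h : E ≃ₐ[B] E)) ϖ - ϖ) ≤ b := by
  set fO : (integralClosure A E)[X] :=
    ∏ h : N, (X - C (hw.toInt ((h : E ≃ₐ[B] E) ϖ) (by rwa [hinv]))) with hfO
  set f : E[X] := fO.map (algebraMap (integralClosure A E) E) with hf
  have hfprod : f = ∏ h : N, (X - C ((h : E ≃ₐ[B] E) ϖ)) := by
    rw [hf, hfO, Polynomial.map_prod]
    refine prod_congr rfl fun h _ => ?_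
    rw [Polynomial.map_sub, map_X, map_C]
    rfl
  have hcoeff : ∀ i, w (f.coeff i) ≤ 1 := fun i => by
    rw [hf, coeff_map]
    exact hw.coe_le_one _
  have hfix : ∀ i, ∀ h ∈ N, h (f.coeff i) = f.coeff i := by
    intro i h hh
    have : f.map ((h : E ≃ₐ[B] E) : E →+* E) = f := by
      rw [hfprod, Polynomial.map_prod]
      refine Fintype.prod_equiv (Equiv.mulLeft (⟨h, hh⟩ : N)) _ _ fun h' => ?_
      simp
    have h1 := congrArg (fun F : E[X] => F.coeff i) this
    simp only [coeff_map] at h1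
    exact h1
  have hroot : f.eval ϖ = 0 := by
    rw [hfprod, eval_prod]
    refine prod_eq_zero (mem_univ 1) ?_
    simp
  have hmap : (f.map (s : E →+* E)).eval ϖ = ∏ h : N, (ϖ - (s * (h : E ≃ₐ[B] E)) ϖ) := by
    rw [hfprod, Polynomial.map_prod, eval_prod]
    refine prod_congr rfl fun h _ => ?_
    simp
  have hdiff : ∏ h : N, (ϖ - (s * (h : E ≃ₐ[B] E)) ϖ) =
      ∑ i ∈ range (f.natDegree + 1), (s (f.coeff i) - f.coeff i) * ϖ ^ i := by
    rw [← hmap, ← sub_zero ((f.map (s : E →+* E)).eval ϖ), ← hroot, eval_eq_sum_range,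
      eval_eq_sum_range, natDegree_map, ← sum_sub_distrib]
    refine sum_congr rfl fun i _ => ?_
    rw [coeff_map]
    simp [sub_mul]
  have hlhs : ∏ h : N, w ((s * (h : E ≃ₐ[B] E)) ϖ - ϖ) =
      w (∏ h : N, (ϖ - (s * (h : E ≃ₐ[B] E)) ϖ)) := by
    rw [map_prod]
    exact prod_congr rfl fun h _ => w.map_sub _ _
  rw [hlhs, hdiff]
  refine (hw.nonarch.apply_sum_le_sup ⟨0, mem_range.2 (Nat.succ_pos _)⟩).trans ?_
  refine sup'_le _ _ fun i _ => ?_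
  rw [map_mul, map_pow]
  exact (mul_le_of_le_one_right (w.nonneg _) (pow_le_one₀ (w.nonneg _) hϖ1)).trans
    (hb _ (hfix i) (hcoeff i))

-- Write $y=P(\varpi)$. For $h\in N$ every $h\varpi$ is a root of $P-y$, and these roots are
-- distinct, so $\prod_{h\in N}(X-h\varpi)$ divides $P-y$ over the integers.
open scoped Classical in
theorem le_prod_coset (hgen : Generates A w ϖ) [Algebra A B] [IsScalarTower A B E]
    (N : Subgroup (E ≃ₐ[B] E)) (s : E ≃ₐ[B] E) {y : E}
    (hy : ∀ h ∈ N, h y = y) (hy1 : w y ≤ 1) :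
    w (s y - y) ≤ ∏ h : N, w ((s * (h : E ≃ₐ[B] E)) ϖ - ϖ) := by
  have hle : ∀ g : E ≃ₐ[B] E, w (g ϖ) ≤ 1 := fun g => by rwa [hinv]
  obtain ⟨P, hP⟩ := hgen y hy1
  set v : N → integralClosure A E := fun h => hw.toInt ((h : E ≃ₐ[B] E) ϖ) (hle _) with hv
  have hvinj : Function.Injective v := by
    intro a b hab
    have h1 : (a : E ≃ₐ[B] E) ϖ = (b : E ≃ₐ[B] E) ϖ := congrArg Subtype.val hab
    have h2 : ((a : E ≃ₐ[B] E)⁻¹ * (b : E ≃ₐ[B] E)) ϖ = ϖ := by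
      rw [AlgEquiv.mul_apply, ← h1, ← AlgEquiv.mul_apply, inv_mul_cancel]
      rfl
    have h3 := eq_one_of_map_eq hgen _ h2
    exact Subtype.ext (inv_mul_eq_one.1 h3)
  set R : (integralClosure A E)[X] :=
    P.map (algebraMap A (integralClosure A E)) - C (hw.toInt y hy1) with hR
  have heval : ∀ t : integralClosure A E, ((R.eval t : integralClosure A E) : E) =
      aeval (t : E) P - y := by
    intro t
    rw [hR, eval_sub, eval_C, eval_map_algebraMap, AddSubgroupClass.coe_sub]
    congr 1
    exact (aeval_algebraMap_apply E t P).symm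
  have hdvd : (∏ h : N, (X - C (v h))) ∣ R := by
    rcases eq_or_ne R 0 with h0 | h0
    · rw [h0]; exact dvd_zero _
    have h1 : ∏ h : N, (X - C (v h)) = ((univ.val.map v).map fun a => X - C a).prod := by
      rw [Multiset.map_map]
      rfl
    rw [h1, Multiset.prod_X_sub_C_dvd_iff_le_roots h0,
      Multiset.le_iff_subset (univ.nodup.map hvinj)]
    intro t ht
    obtain ⟨h, -, rfl⟩ := Multiset.mem_map.1 ht
    rw [mem_roots h0, IsRoot.def]
    ext
    rw [heval]
    change aeval ((h : E ≃ₐ[B] E) ϖ) P - y = 0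
    rw [← algEquiv_aeval, hP, hy _ h.2, sub_self]
  obtain ⟨Q, hQ⟩ := hdvd
  -- Evaluating at $s^{-1}\varpi$ turns $P-y$ into $s^{-1}y-y$; applying $s$ afterwards turns the
  -- factors into $\varpi-sh\varpi$.
  have h1 := congrArg (fun F : (integralClosure A E)[X] =>
    ((F.eval (hw.toInt (s⁻¹ ϖ) (hle _)) : integralClosure A E) : E)) hQ
  simp only [heval, eval_mul, eval_prod, eval_sub, eval_X, eval_C, MulMemClass.coe_mul] at h1
  have h2 : ((∏ h : N, (hw.toInt (s⁻¹ ϖ) (hle _) - v h) : integralClosure A E) : E) =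
      ∏ h : N, (s⁻¹ ϖ - (h : E ≃ₐ[B] E) ϖ) :=
    map_prod (algebraMap (integralClosure A E) E) _ _
  have h3 : aeval (s⁻¹ ϖ) P - y = s⁻¹ y - y := by rw [← algEquiv_aeval, hP]
  rw [h2] at h1
  replace h1 : s⁻¹ y - y = _ := h3.symm.trans h1
  rw [← abs_inv_map_sub hinv, h1, map_mul, map_prod]
  refine (mul_le_of_le_one_right (prod_nonneg fun _ _ => w.nonneg _)
    (hw.coe_le_one _)).trans (le_of_eq ?_)
  refine prod_congr rfl fun h _ => ?_
  rw [← hinv s, map_sub, ← AlgEquiv.mul_apply, mul_inv_cancel, w.map_sub]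
  rfl

omit [Fintype (E ≃ₐ[B] E)] in
theorem abs_map_sub_le_one (g : E ≃ₐ[B] E) : w (g ϖ - ϖ) ≤ 1 := by
  have := abs_sub_le_max hw.nonarch (g ϖ) ϖ
  rw [hinv, max_self] at this
  exact this.trans hϖ1

/-- One step of the Herbrand recursion: passing from a subgroup `N` of `H` to `H`, when the powers
of `σ ∈ H` represent `p` different cosets of `N`. -/
theorem ramProd_le_mul {N H : Subgroup (E ≃ₐ[B] E)} (hNH : N ≤ H) {σ : E ≃ₐ[B] E} (hσ : σ ∈ H)
    {p : ℕ} (hp : 0 < p) (hσN : ∀ i, 0 < i → i < p → σ ^ i ∉ N) {b : ℝ}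
    (hb : ∀ i, 0 < i → i < p → ∀ x, (∀ h ∈ N, h x = x) → w x ≤ 1 → w ((σ ^ i) x - x) ≤ b)
    {r : ℝ} (hr0 : 0 ≤ r) (hr1 : r ≤ 1) :
    ramProd w ϖ H r ≤ ramProd w ϖ N r * max b (ramProd w ϖ N r) ^ (p - 1) := by
  classical
  set φ : Fin p × N → H := fun x =>
    ⟨σ ^ (x.1 : ℕ) * (x.2 : E ≃ₐ[B] E), mul_mem (pow_mem hσ _) (hNH x.2.2)⟩ with hφ
  have hinj : Function.Injective φ := by
    have key : ∀ i j : ℕ, i < p → j < p → i ≤ j → ∀ g h : N,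
        σ ^ i * (g : E ≃ₐ[B] E) = σ ^ j * (h : E ≃ₐ[B] E) → i = j := by
      intro i j hi hj hij g h hgh
      by_contra hne
      refine hσN (j - i) (by omega) (by omega) ?_
      have : σ ^ (j - i) = (g : E ≃ₐ[B] E) * (h : E ≃ₐ[B] E)⁻¹ := by
        rw [eq_mul_inv_iff_mul_eq, ← mul_right_inj (σ ^ i), hgh, ← mul_assoc, ← pow_add,
          Nat.add_sub_cancel' hij]
      rw [this]
      exact mul_mem g.2 (inv_mem h.2)
    rintro ⟨i, g⟩ ⟨j, h⟩ hij
    have h1 : σ ^ (i : ℕ) * (g : E ≃ₐ[B] E) = σ ^ (j : ℕ) * (h : E ≃ₐ[B] E) :=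
      congrArg Subtype.val hij
    have h2 : (i : ℕ) = j := by
      rcases le_total (i : ℕ) j with hle | hle
      · exact key i j i.2 j.2 hle g h h1
      · exact (key j i j.2 i.2 hle h g h1.symm).symm
    rw [h2, mul_right_inj] at h1
    exact Prod.ext (Fin.ext h2) (Subtype.ext h1)
  have hbound := prod_le_prod_comp_of_injective
    (fun h : H => max (w ((h : E ≃ₐ[B] E) ϖ - ϖ)) r)
    (fun h => hr0.trans (le_max_right _ _))
    (fun h => max_le (abs_map_sub_le_one hw hinv hϖ1 _) hr1) hinj
  refine hbound.trans ?_
  rw [Fintype.prod_prod_type]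
  obtain ⟨m, rfl⟩ : ∃ m, p = m + 1 := ⟨p - 1, by omega⟩
  -- The coset of $\sigma^0$ contributes the function of $N$; each of the other $p-1$ cosets is
  -- bounded by the maximum.
  rw [Fin.prod_univ_succ]
  have hN0 : 0 ≤ ramProd w ϖ N r := prod_nonneg fun _ _ => hr0.trans (le_max_right _ _)
  refine mul_le_mul (le_of_eq ?_) ?_ (prod_nonneg fun _ _ => prod_nonneg fun _ _ =>
    hr0.trans (le_max_right _ _)) hN0
  · simp [hφ, ramProd]
  · rw [Nat.add_sub_cancel]
    have h1 : ∀ i : Fin m, ∏ h : N, max (w ((φ (i.succ, h) : E ≃ₐ[B] E) ϖ - ϖ)) r ≤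
        max b (ramProd w ϖ N r) := fun i =>
      prod_coset_max_le hw.nonarch hinv ϖ N (σ ^ ((i.succ : Fin (m + 1)) : ℕ))
        (prod_coset_le hw hinv hϖ1 N _ (hb _ (by simp) i.succ.2)) r
    calc _ ≤ ∏ i : Fin m, max b (ramProd w ϖ N r) :=
          prod_le_prod (fun _ _ => prod_nonneg fun _ _ => hr0.trans (le_max_right _ _))
            fun i _ => h1 i
      _ = _ := by simp

/-- The Herbrand function of the whole group is bounded below in terms of the conjugates of an
integral element `y`. -/
theorem mul_le_ramProd_top (hgen : Generates A w ϖ) [Algebra A B] [IsScalarTower A B E]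
    [DecidableEq E] {y : E} (hy1 : w y ≤ 1) {g : E ≃ₐ[B] E} {C : ℝ}
    (hC0 : 0 ≤ C)
    (hC : C ≤ ∏ η ∈ (univ.image fun h : E ≃ₐ[B] E => h y).erase y, w (η - y)) :
    C * w (g y - y) ≤ ramProd w ϖ (⊤ : Subgroup (E ≃ₐ[B] E)) (w (g ϖ - ϖ)) := by
  classical
  obtain ⟨Z, hZ⟩ : ∃ Z : Subgroup (E ≃ₐ[B] E), ∀ h, h ∈ Z ↔ h y = y :=
    ⟨MulAction.stabilizer (E ≃ₐ[B] E) y, fun h => Iff.rfl⟩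
  have hZfix : ∀ h ∈ Z, h y = y := fun h hh => (hZ h).1 hh
  set F : (E ≃ₐ[B] E) → ℝ := fun h => max (w (h ϖ - ϖ)) (w (g ϖ - ϖ)) with hF
  have hF0 : ∀ h, 0 ≤ F h := fun h => (w.nonneg _).trans (le_max_left _ _)
  have htop : ramProd w ϖ (⊤ : Subgroup (E ≃ₐ[B] E)) (w (g ϖ - ϖ)) = ∏ h, F h := by
    refine Fintype.prod_equiv (Subgroup.topEquiv (G := E ≃ₐ[B] E)).toEquiv _ F fun h => rfl
  have hcoset : ∀ (s : E ≃ₐ[B] E) (F' : (E ≃ₐ[B] E) → ℝ),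
      ∏ h with h y = s y, F' h = ∏ h : Z, F' (s * h) := by
    intro s F'
    refine (prod_bij (fun (h : Z) _ => s * (h : E ≃ₐ[B] E)) ?_ ?_ ?_ ?_).symm
    · intro h _
      rw [mem_filter]
      refine ⟨mem_univ _, ?_⟩
      rw [AlgEquiv.mul_apply, hZfix _ h.2]
    · intro a _ b _ hab
      exact Subtype.ext (mul_left_cancel hab)
    · intro h hh
      rw [mem_filter] at hh
      refine ⟨⟨s⁻¹ * h, ?_⟩, mem_univ _, by simp⟩
      rw [hZ, AlgEquiv.mul_apply, hh.2, ← AlgEquiv.mul_apply, inv_mul_cancel]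
      rfl
    · intro h _
      rfl
  have hyim : y ∈ univ.image fun h : E ≃ₐ[B] E => h y := mem_image.2 ⟨1, mem_univ _, rfl⟩
  rw [htop, ← prod_fiberwise_of_maps_to
    (s := univ) (t := univ.image fun h : E ≃ₐ[B] E => h y) (g := fun h : E ≃ₐ[B] E => h y)
    (fun h _ => mem_image_of_mem (fun h : E ≃ₐ[B] E => h y) (mem_univ h)) F,
    ← mul_prod_erase _ _ hyim, mul_comm]
  refine mul_le_mul ?_ (hC.trans ?_) hC0 (prod_nonneg fun _ _ => hF0 _)
  -- In the fibre over $y$, the factor $\max(|h\varpi-\varpi|,|g\varpi-\varpi|)$ dominates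
  -- $|gh\varpi-\varpi|$, so the coset $gZ$ supplies $|gy-y|$. In the other fibres the truncation is
  -- simply dropped.
  · have h1 := hcoset 1 F
    rw [AlgEquiv.one_apply] at h1
    rw [h1]
    refine (le_prod_coset hw hinv hϖ1 hgen Z g hZfix hy1).trans ?_
    refine prod_le_prod (fun _ _ => w.nonneg _) fun h _ => ?_
    rw [one_mul]
    have := abs_mul_map_sub_le hw.nonarch hinv ϖ g h
    rwa [max_comm] at this
  · refine prod_le_prod (fun _ _ => w.nonneg _) fun η hη => ?_
    obtain ⟨s, -, rfl⟩ := mem_image.1 (mem_of_mem_erase hη)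
    rw [hcoset s F]
    refine (le_prod_coset hw hinv hϖ1 hgen Z s hZfix hy1).trans ?_
    exact prod_le_prod (fun _ _ => w.nonneg _) fun h _ => le_max_left _ _

end Herbrand

/-! ### Extending a complete absolute value to an algebraic extension -/

section Spectral

open Polynomial

/-- The spectral norm works: it is at most 1 exactly when the minimal polynomial has coefficients in
the integrally closed ring $A$. The last clause will give discreteness on finite subextensions. -/
theorem exists_spectral_abs {A K L : Type*} [CommRing A] [IsDomain A] [IsIntegrallyClosed A]
    [NontriviallyNormedField K] [CompleteSpace K] [IsUltrametricDist K] [Algebra A K]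
    [IsFractionRing A K] [Field L] [Algebra K L] [Algebra.IsAlgebraic K L] [Algebra A L]
    [IsScalarTower A K L] (hA : ∀ x : K, ‖x‖ ≤ 1 ↔ ∃ a : A, algebraMap A K a = x) :
    ∃ w : AbsoluteValue L ℝ, IsIntegralAbs A w ∧ (∀ x : K, w (algebraMap K L x) = ‖x‖) ∧
      (∀ (σ : L ≃ₐ[K] L) x, w (σ x) = w x) ∧
      ∀ x, w x ^ (minpoly K x).natDegree = ‖(minpoly K x).coeff 0‖ := by
  let w : AbsoluteValue L ℝ :=
    { toFun := spectralNorm K L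
      map_mul' := fun x y => spectralAlgNorm_mul x y
      nonneg' := spectralNorm_nonneg
      eq_zero' := fun x =>
        ⟨fun h => eq_zero_of_map_spectralNorm_eq_zero h (Algebra.IsAlgebraic.isAlgebraic x),
          fun h => by rw [h]; exact spectralNorm_zero⟩
      add_le' := fun x y => isNonarchimedean_spectralNorm.add_le spectralNorm_nonneg }
  have hmonic : ∀ x : L, (minpoly K x).Monic := fun x =>
    minpoly.monic (Algebra.IsAlgebraic.isAlgebraic x).isIntegral
  refine ⟨w, ⟨isNonarchimedean_spectralNorm, fun x => ?_⟩, fun x => spectralNorm_extends x,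
    fun σ x => (spectralNorm_eq_of_equiv σ x).symm, fun x => ?_⟩
  · change _ ↔ spectralNorm K L x ≤ 1
    rw [spectralNorm, spectralValue_le_one_iff (hmonic x)]
    constructor
    · intro hx n
      rw [hA, minpoly.isIntegrallyClosed_eq_field_fractions' K hx, coeff_map]
      exact ⟨_, rfl⟩
    · intro h
      have hl : minpoly K x ∈ lifts (algebraMap A K) := by
        rw [lifts_iff_coeff_lifts]
        intro n
        exact (hA _).1 (h n)
      obtain ⟨P, hP, -, hPm⟩ := lifts_and_natDegree_eq_and_monic hl (hmonic x)
      refine ⟨P, hPm, ?_⟩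
      have := minpoly.aeval K x
      rw [← hP, aeval_map_algebraMap] at this
      exact this
  · change spectralNorm K L x ^ _ = _
    rw [spectralNorm.spectralNorm_eq_norm_coeff_zero_rpow, ← Real.rpow_natCast, ← Real.rpow_mul
      (norm_nonneg _), one_div, inv_mul_cancel₀, Real.rpow_one]
    have := minpoly.natDegree_pos (Algebra.IsAlgebraic.isAlgebraic x : IsAlgebraic K x).isIntegral
    exact_mod_cast this.ne'

end Spectral

/-! ### The adic absolute value of a discrete valuation ring and completeness -/

section Complete

variable {A K : Type*} [CommRing A] [IsDomain A] [IsDiscreteValuationRing A] [Field K]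
  [Algebra A K] [IsFractionRing A K]

theorem exists_adic_abs {ϖ : A} (hϖ : Irreducible ϖ) :
    ∃ w : AbsoluteValue K ℝ, IsNonarchimedean w ∧ 0 < w (algebraMap A K ϖ) ∧
      w (algebraMap A K ϖ) < 1 ∧ (∀ x, w x ≤ 1 ↔ ∃ a : A, algebraMap A K a = x) ∧
      (∀ x, x ≠ 0 → ∃ n : ℤ, w x = w (algebraMap A K ϖ) ^ n) ∧
      ∀ (a : A) (n : ℕ), w (algebraMap A K a) ≤ w (algebraMap A K ϖ) ^ n → ϖ ^ n ∣ a := by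
  set v := IsDiscreteValuationRing.maximalIdeal A with hv
  have hb : (1 : NNReal) < 2 := one_lt_two
  set w : AbsoluteValue K ℝ := v.adicAbv hb with hw
  have hle : ∀ a : A, w (algebraMap A K a) ≤ 1 := fun a => v.adicAbv_coe_le_one hb a
  have hϖ0 : algebraMap A K ϖ ≠ 0 := by
    simpa using hϖ.ne_zero
  have hlt : w (algebraMap A K ϖ) < 1 := by
    rw [hw, v.adicAbv_coe_lt_one_iff]
    have : v.asIdeal = IsLocalRing.maximalIdeal A := rfl
    rw [this]
    exact (IsLocalRing.mem_maximalIdeal _).2 hϖ.not_isUnit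
  have hunit : ∀ u : Aˣ, w (algebraMap A K u) = 1 := by
    intro u
    refine le_antisymm (hle _) ?_
    have h1 : w (algebraMap A K u) * w (algebraMap A K (u⁻¹ : Aˣ)) = 1 := by
      rw [← map_mul, ← map_mul, Units.mul_inv, map_one, map_one]
    have := hle (u⁻¹ : Aˣ)
    have := w.nonneg (algebraMap A K u)
    nlinarith
  have hpos : 0 < w (algebraMap A K ϖ) := w.pos hϖ0
  have hrep : ∀ x : K, x ≠ 0 → ∃ (n : ℤ) (u : Aˣ), x = algebraMap A K ϖ ^ n * algebraMap A K u := by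
    intro x hx
    obtain ⟨a, b, hb0, rfl⟩ := IsFractionRing.div_surjective (A := A) x
    have hb' : b ≠ 0 := nonZeroDivisors.ne_zero hb0
    have ha' : a ≠ 0 := by
      rintro rfl
      simp at hx
    obtain ⟨m, u, rfl⟩ := IsDiscreteValuationRing.eq_unit_mul_pow_irreducible ha' hϖ
    obtain ⟨n, u', rfl⟩ := IsDiscreteValuationRing.eq_unit_mul_pow_irreducible hb' hϖ
    refine ⟨(m : ℤ) - n, u * u'⁻¹, ?_⟩
    have hu' : algebraMap A K u' ≠ 0 := by simp
    have hinv : algebraMap A K ((u'⁻¹ : Aˣ) : A) = (algebraMap A K u')⁻¹ := by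
      refine eq_inv_of_mul_eq_one_left ?_
      rw [← map_mul, Units.inv_mul, map_one]
    rw [Units.val_mul, map_mul, map_mul, map_mul, map_pow, map_pow, zpow_sub₀ hϖ0, zpow_natCast,
      zpow_natCast, hinv]
    field_simp
  refine ⟨w, v.isNonarchimedean_adicAbv hb, hpos, hlt, fun x => ⟨fun hx => ?_, ?_⟩,
    fun x hx => ?_, fun a n h => ?_⟩
  · rcases eq_or_ne x 0 with rfl | h0
    · exact ⟨0, map_zero _⟩
    obtain ⟨n, u, rfl⟩ := hrep x h0
    rw [map_mul, hunit, mul_one, map_zpow₀] at hx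
    have hn : 0 ≤ n := by
      by_contra hc
      have := one_lt_zpow_of_neg₀ hpos hlt (not_le.1 hc)
      linarith
    lift n to ℕ using hn
    exact ⟨ϖ ^ n * u, by simp⟩
  · rintro ⟨a, rfl⟩
    exact hle a
  · obtain ⟨n, u, rfl⟩ := hrep x hx
    exact ⟨n, by rw [map_mul, hunit, mul_one, map_zpow₀]⟩
  · rcases eq_or_ne a 0 with rfl | h0
    · exact dvd_zero _
    obtain ⟨m, u, rfl⟩ := IsDiscreteValuationRing.eq_unit_mul_pow_irreducible h0 hϖ
    rw [map_mul, map_mul, hunit, one_mul, map_pow, map_pow,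
      pow_le_pow_iff_right_of_lt_one₀ hpos hlt] at h
    exact Dvd.dvd.mul_left (pow_dvd_pow _ h) _

-- For a rapidly convergent sequence the differences $u_n-u_0$ lie in $A$ and are compatible modulo
-- powers of $\varpi$, so precompleteness of $A$ provides the limit.
omit [IsDomain A] [IsDiscreteValuationRing A] [IsFractionRing A K] in
theorem completeSpace_of_isAdicComplete {ϖ : A} [IsPrecomplete (Ideal.span {ϖ}) A]
    (w : AbsoluteValue K ℝ) (hpos : 0 < w (algebraMap A K ϖ)) (hlt : w (algebraMap A K ϖ) < 1)
    (hint : ∀ x, w x ≤ 1 ↔ ∃ a : A, algebraMap A K a = x)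
    (hdvd : ∀ (a : A) (n : ℕ), w (algebraMap A K a) ≤ w (algebraMap A K ϖ) ^ n → ϖ ^ n ∣ a) :
    letI := w.toNormedField
    CompleteSpace K := by
  let := w.toNormedField
  have hdist : ∀ x y : K, dist x y = w (x - y) := fun x y => dist_eq_norm x y
  refine Metric.complete_of_convergent_controlled_sequences
    (fun n => w (algebraMap A K ϖ) ^ n) (fun n => pow_pos hpos n) fun u hu => ?_
  have h1 : ∀ n, ∃ a : A, algebraMap A K a = u n - u 0 := fun n => by
    rw [← hint, ← hdist]
    have := hu 0 n 0 (Nat.zero_le _) le_rfl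
    simpa using this.le
  choose a ha using h1
  have h2 : ∀ {m n : ℕ}, m ≤ n →
      a m ≡ a n [SMOD (Ideal.span {ϖ} ^ m • ⊤ : Submodule A A)] := by
    intro m n hmn
    rw [SModEq.sub_mem, smul_eq_mul, Ideal.mul_top, Ideal.span_singleton_pow,
      Ideal.mem_span_singleton]
    refine hdvd _ _ ?_
    rw [map_sub, ha, ha, sub_sub_sub_cancel_right, ← hdist]
    exact (hu m m n le_rfl hmn).le
  obtain ⟨l, hl⟩ := IsPrecomplete.prec ‹_› h2
  refine ⟨u 0 + algebraMap A K l, ?_⟩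
  rw [tendsto_iff_dist_tendsto_zero]
  refine squeeze_zero (fun _ => dist_nonneg) (fun n => ?_)
    (tendsto_pow_atTop_nhds_zero_of_lt_one hpos.le hlt)
  have h3 := hl n
  rw [SModEq.sub_mem, smul_eq_mul, Ideal.mul_top, Ideal.span_singleton_pow,
    Ideal.mem_span_singleton] at h3
  obtain ⟨z, hz⟩ := h3
  have h4 : u n - (u 0 + algebraMap A K l) = algebraMap A K ϖ ^ n * algebraMap A K z := by
    rw [← map_pow, ← map_mul, ← hz, map_sub, ha]
    ring
  rw [hdist, h4, map_mul, map_pow]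
  exact mul_le_of_le_one_right (pow_nonneg hpos.le _) ((hint _).2 ⟨z, rfl⟩)

end Complete

/-! ### The absolute value on an algebraic closure of the fraction field of the Witt vectors -/

section Witt

open Polynomial

variable (p : ℕ) [Fact p.Prime] (k : Type*) [Field k] [CharP k p] [IsAlgClosed k]

/-- The absolute value of an algebraic closure of `Frac W(k)`. -/
theorem exists_abs_Kbar : ∃ w : AbsoluteValue (Kbar p k) ℝ,
    IsIntegralAbs (WittVector p k) w ∧ (∀ (σ : Kbar p k ≃ₐ[K0 p k] Kbar p k) x, w (σ x) = w x) ∧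
    0 < w p ∧ w p < 1 ∧ ∀ (L : IntermediateField (K0 p k) (Kbar p k)) [FiniteDimensional (K0 p k) L],
      ∀ x ∈ L, x ≠ 0 → ∃ n : ℤ, w x ^ Module.finrank (K0 p k) L = w p ^ n := by
  have hirr : Irreducible (p : WittVector p k) := WittVector.irreducible p
  obtain ⟨w₀, hna, hpos, hlt, hint, hval, hdvd⟩ := exists_adic_abs (K := K0 p k) hirr
  have hcomp := completeSpace_of_isAdicComplete w₀ hpos hlt hint hdvd
  let nf : NormedField (K0 p k) := w₀.toNormedField
  have hp0 : algebraMap (WittVector p k) (K0 p k) p ≠ 0 := w₀.pos_iff.1 hpos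
  let : NontriviallyNormedField (K0 p k) :=
    { nf with
      non_trivial := by
        refine ⟨(algebraMap (WittVector p k) (K0 p k) p)⁻¹, ?_⟩
        change 1 < w₀ _
        rw [map_inv₀]
        exact (one_lt_inv₀ hpos).2 hlt }
  have : CompleteSpace (K0 p k) := hcomp
  have : IsUltrametricDist (K0 p k) :=
    IsUltrametricDist.isUltrametricDist_of_isNonarchimedean_norm hna
  obtain ⟨w, hw, hext, hinv, hdeg⟩ := exists_spectral_abs (A := WittVector p k) (K := K0 p k)
    (L := Kbar p k) hint
  have hwp : w p = w₀ (algebraMap (WittVector p k) (K0 p k) p) := by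
    have := hext (algebraMap (WittVector p k) (K0 p k) p)
    rw [map_natCast, map_natCast] at this
    rw [this, map_natCast]
    rfl
  refine ⟨w, hw, hinv, hwp ▸ hpos, hwp ▸ hlt, fun L _ x hxL hx => ?_⟩
  -- The degree of the minimal polynomial divides $[L:K_0]$, and its nonzero constant term has value
  -- an integral power of $|p|$.
  have h1 : minpoly (K0 p k) (⟨x, hxL⟩ : L) = minpoly (K0 p k) x :=
    IntermediateField.minpoly_eq _
  obtain ⟨d, hd⟩ := minpoly.degree_dvd (K := K0 p k) (x := (⟨x, hxL⟩ : L))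
    (Algebra.IsIntegral.isIntegral _)
  have h2 : (minpoly (K0 p k) x).coeff 0 ≠ 0 :=
    minpoly.coeff_zero_ne_zero (Algebra.IsIntegral.isIntegral x) hx
  obtain ⟨n, hn⟩ := hval _ h2
  refine ⟨n * d, ?_⟩
  rw [hd, h1, pow_mul, hdeg, hwp, zpow_mul, ← hn, zpow_natCast]
  rfl

variable {p k}

/-- The residue field of the valuation ring of `Kbar` is `k`. -/
theorem exists_abs_sub_lt_one {w : AbsoluteValue (Kbar p k) ℝ}
    (hw : IsIntegralAbs (WittVector p k) w) (hp : w p < 1) {x : Kbar p k} (hx : w x ≤ 1) :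
    ∃ a : WittVector p k, w (x - algebraMap _ _ a) < 1 := by
  obtain ⟨f, hf, hfx⟩ := (hw.isIntegral_iff x).2 hx
  set c := (WittVector.constantCoeff : WittVector p k →+* k) with hc
  obtain ⟨s, hs⟩ := (WittVector.constantCoeff_surjective (R := k) p).hasRightInverse
  have hsplit := IsAlgClosed.splits (f.map c)
  -- Over the algebraically closed residue field $f$ splits; lift the roots arbitrarily. Then
  -- $F\equiv f$ modulo $p$, so $|F(x)|<1$ and one of the linear factors must be small at $x$.
  set F : (WittVector p k)[X] := ((f.map c).roots.map fun r => X - C (s r)).prod with hF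
  have hFmap : F.map c = f.map c := by
    conv_rhs => rw [hsplit.eq_prod_roots_of_monic (hf.map c)]
    rw [hF, Polynomial.map_multiset_prod, Multiset.map_map]
    congr 1
    refine Multiset.map_congr rfl fun r _ => ?_
    simp only [Function.comp, Polynomial.map_sub, map_X, map_C]
    rw [hc, hs r]
  have hdvd : C (p : WittVector p k) ∣ f - F := by
    rw [C_dvd_iff_dvd_coeff]
    intro i
    rw [← Ideal.mem_span_singleton, ← WittVector.ker_constantCoeff, RingHom.mem_ker, ← hc,
      ← coeff_map, Polynomial.map_sub, hFmap, sub_self, coeff_zero]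
  obtain ⟨g, hg⟩ := hdvd
  have hgx : w (aeval x g) ≤ 1 := by
    have h0 := hw.abs_aeval_sub_le hx (y := 0) (by simp) g
    have h1 := hw.nonarch (aeval x g - aeval 0 g) (aeval 0 g)
    rw [sub_add_cancel] at h1
    refine h1.trans (max_le (h0.trans (by simpa using hx)) ?_)
    rw [← hw.isIntegral_iff, ← coeff_zero_eq_aeval_zero']
    exact isIntegral_algebraMap
  have hFx : w (aeval x F) < 1 := by
    have h1 : aeval x F = - ((p : Kbar p k) * aeval x g) := by
      have h2 := congrArg (aeval x) hg
      rw [map_sub, map_mul, aeval_C, map_natCast, aeval_def x f, hfx, zero_sub] at h2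
      rw [← h2, neg_neg]
    rw [h1, w.map_neg, map_mul]
    exact (mul_le_of_le_one_right (w.nonneg _) hgx).trans_lt hp
  by_contra! hcon
  rw [hF, map_multiset_prod, map_multiset_prod, Multiset.map_map, Multiset.map_map] at hFx
  refine absurd hFx (not_lt.2 ?_)
  refine Multiset.one_le_prod_map fun r _ => ?_
  simpa using hcon (s r)

end Witt

section Instances

variable (p : ℕ) [Fact p.Prime] (k : Type*) [Field k] [CharP k p]

instance charZero_wittVector : CharZero (WittVector p k) := by
  obtain ⟨r, hr⟩ := CharP.exists (WittVector p k)
  have hr0 : r = 0 := by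
    by_contra h0
    have hprime : r.Prime := (CharP.char_is_prime_or_zero (WittVector p k) r).resolve_right h0
    have h1 : (r : k) = 0 := by
      have := congrArg (WittVector.constantCoeff : WittVector p k →+* k)
        (CharP.cast_eq_zero (WittVector p k) r)
      rwa [map_natCast, map_zero] at this
    rw [CharP.cast_eq_zero_iff k p, Nat.prime_dvd_prime_iff_eq Fact.out hprime] at h1
    subst h1
    exact WittVector.p_nonzero p k (CharP.cast_eq_zero _ _)
  subst hr0
  exact CharP.charP_to_charZero _

instance charZero_K0 : CharZero (K0 p k) :=
  charZero_of_injective_algebraMap (IsFractionRing.injective (WittVector p k) (K0 p k))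

instance charZero_Kbar : CharZero (Kbar p k) :=
  charZero_of_injective_algebraMap (algebraMap (K0 p k) (Kbar p k)).injective

instance isScalarTower_witt (L : IntermediateField (K0 p k) (Kbar p k)) :
    IsScalarTower (WittVector p k) L (Kbar p k) :=
  IsScalarTower.of_algebraMap_eq fun _ => rfl

end Instances

/-! ### Uniformizers and monogenic rings of integers in finite subextensions -/

section Fields

open IntermediateField Polynomial

variable {p : ℕ} [Fact p.Prime] {k : Type*} [Field k] [CharP k p]

/-- The properties of the extension of the `p`-adic absolute value to `Kbar` that are used. -/
structure IsPadicAbs (w : AbsoluteValue (Kbar p k) ℝ) : Prop where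
  integral : IsIntegralAbs (WittVector p k) w
  invariant : ∀ (σ : Kbar p k ≃ₐ[K0 p k] Kbar p k) x, w (σ x) = w x
  pos : 0 < w p
  lt_one : w p < 1
  exists_zpow : ∀ (L : IntermediateField (K0 p k) (Kbar p k)) [FiniteDimensional (K0 p k) L],
      ∀ x ∈ L, x ≠ 0 → ∃ n : ℤ, w x ^ Module.finrank (K0 p k) L = w p ^ n

/-- The restriction of an absolute value of `Kbar` to a subfield. -/
def absRestrict (w : AbsoluteValue (Kbar p k) ℝ) (L : IntermediateField (K0 p k) (Kbar p k)) :
    AbsoluteValue L ℝ :=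
  w.comp (f := algebraMap L (Kbar p k)) (algebraMap L (Kbar p k)).injective

theorem absRestrict_apply (w : AbsoluteValue (Kbar p k) ℝ)
    (L : IntermediateField (K0 p k) (Kbar p k)) (x : L) : absRestrict w L x = w (x : Kbar p k) :=
  rfl

theorem IsIntegralAbs.absRestrict {w : AbsoluteValue (Kbar p k) ℝ}
    (hw : IsIntegralAbs (WittVector p k) w) (L : IntermediateField (K0 p k) (Kbar p k)) :
    IsIntegralAbs (WittVector p k) (absRestrict w L) where
  nonarch x y := hw.nonarch (x : Kbar p k) y
  isIntegral_iff x := by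
    rw [absRestrict_apply, ← hw.isIntegral_iff]
    exact (isIntegral_algebraMap_iff (algebraMap L (Kbar p k)).injective).symm

variable {w : AbsoluteValue (Kbar p k) ℝ}

namespace IsPadicAbs

variable (hw : IsPadicAbs w) (L : IntermediateField (K0 p k) (Kbar p k))
  [FiniteDimensional (K0 p k) L]
include hw

theorem exists_isValueGen : ∃ ϖ : L, IsValueGen (absRestrict w L) ϖ := by
  set D := Module.finrank (K0 p k) L with hD
  have hDpos : 0 < D := Module.finrank_pos
  have hq := hw.pos
  -- The exponents of $|p|$ occurring in $|x|^D$ form a subgroup of $\mathbb Z$ containing $D\ne0$;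
  -- an element realizing its positive generator is a uniformizer.
  let H : AddSubgroup ℤ :=
    { carrier := {m | ∃ x : L, x ≠ 0 ∧ w (x : Kbar p k) ^ D = w p ^ m}
      zero_mem' := ⟨1, one_ne_zero, by simp⟩
      add_mem' := by
        rintro a b ⟨x, hx, hxa⟩ ⟨y, hy, hyb⟩
        exact ⟨x * y, mul_ne_zero hx hy, by
          rw [zpow_add₀ hq.ne', ← hxa, ← hyb, ← mul_pow, ← map_mul]; rfl⟩
      neg_mem' := by
        rintro a ⟨x, hx, hxa⟩
        exact ⟨x⁻¹, inv_ne_zero hx, by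
          rw [zpow_neg, ← hxa, ← inv_pow, ← map_inv₀]; rfl⟩ }
  obtain ⟨a, ha⟩ := Int.subgroup_cyclic H
  have hmem : ∀ m, m ∈ H ↔ ∃ n : ℤ, n * a = m := by
    intro m
    rw [ha, AddSubgroup.mem_closure_singleton]
    simp
  have hDH : (D : ℤ) ∈ H := ⟨(p : L), by
    have : (p : Kbar p k) ≠ 0 := w.pos_iff.1 hq
    intro h
    exact this (by exact_mod_cast congrArg (Subtype.val) h), by simp⟩
  have ha0 : a ≠ 0 := by
    rintro rfl
    obtain ⟨n, hn⟩ := (hmem _).1 hDH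
    simp at hn
    omega
  have key : ∀ b : ℤ, 0 < b → (∀ m ∈ H, ∃ n : ℤ, n * b = m) → b ∈ H →
      ∃ ϖ : L, IsValueGen (WildConductor.absRestrict w L) ϖ := by
    rintro b hb hgen ⟨ϖ, hϖ0, hϖ⟩
    have hϖpos : 0 < w (ϖ : Kbar p k) := w.pos_iff.2 (by simpa using hϖ0)
    refine ⟨ϖ, hϖpos, ?_, fun x hx => ?_⟩
    · have h1 : w (ϖ : Kbar p k) ^ D < 1 := by
        rw [hϖ]
        exact zpow_lt_one₀ hq hw.lt_one hb
      by_contra hc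
      exact absurd h1 (not_lt.2 (one_le_pow₀ (not_lt.1 hc)))
    · have hx' : (x : Kbar p k) ≠ 0 := by simpa using hx
      obtain ⟨m, hm⟩ := hw.exists_zpow L x x.2 hx'
      obtain ⟨n, hn⟩ := hgen m ⟨x, hx, hm⟩
      refine ⟨n, ?_⟩
      refine (pow_left_inj₀ (w.nonneg _) (zpow_nonneg hϖpos.le _) hDpos.ne').1 ?_
      change w (x : Kbar p k) ^ D = (w (ϖ : Kbar p k) ^ n) ^ D
      rw [hm, ← hn, mul_comm n b, zpow_mul, ← hϖ, ← zpow_natCast, ← zpow_natCast, ← zpow_mul,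
        ← zpow_mul, mul_comm]
  rcases lt_or_gt_of_ne ha0 with h | h
  · refine key (-a) (by omega) (fun m hm => ?_) (H.neg_mem ((hmem a).2 ⟨1, one_mul a⟩))
    obtain ⟨n, hn⟩ := (hmem m).1 hm
    exact ⟨-n, by rw [← hn]; ring⟩
  · exact key a h (fun m hm => (hmem m).1 hm) ((hmem a).2 ⟨1, one_mul a⟩)

/-- If the ramification index of `L` is its degree over `K_0`, a `[L : K_0]`-th root of `p` up to
units generates the value group. -/
theorem isValueGen_of_pow_eq {ϖ : L} (h : w (ϖ : Kbar p k) ^ Module.finrank (K0 p k) L = w p) :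
    IsValueGen (WildConductor.absRestrict w L) ϖ := by
  have hD : Module.finrank (K0 p k) L ≠ 0 := Module.finrank_pos.ne'
  have hpos : 0 < w (ϖ : Kbar p k) := by
    refine lt_of_le_of_ne (w.nonneg _) fun h0 => ?_
    rw [← h0, zero_pow hD] at h
    exact hw.pos.ne h
  refine ⟨hpos, ?_, fun x hx => ?_⟩
  · by_contra hc
    have := one_le_pow₀ (not_lt.1 hc) (n := Module.finrank (K0 p k) L)
    rw [absRestrict_apply, h] at this
    exact absurd hw.lt_one (not_lt.2 this)
  · obtain ⟨m, hm⟩ := hw.exists_zpow L x x.2 (by simpa using hx)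
    refine ⟨m, ?_⟩
    refine (pow_left_inj₀ (w.nonneg _) (zpow_nonneg hpos.le _) hD).1 ?_
    change w (x : Kbar p k) ^ _ = (w (ϖ : Kbar p k) ^ m) ^ _
    rw [hm, ← h, ← zpow_natCast, ← zpow_natCast, ← zpow_mul, ← zpow_mul, mul_comm]

variable [IsAlgClosed k] {L}

omit [FiniteDimensional (K0 p k) L] in
theorem exists_abs_sub_lt {x : L} (hx : w (x : Kbar p k) ≤ 1) :
    ∃ a : WittVector p k, w ((x - algebraMap _ L a : L) : Kbar p k) < 1 :=
  exists_abs_sub_lt_one hw.integral hw.lt_one hx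

/-- The ring of integers of `L` is generated by a uniformizer. -/
theorem generates {ϖ : L} (hϖ : IsValueGen (WildConductor.absRestrict w L) ϖ) :
    Generates (WittVector p k) (WildConductor.absRestrict w L) ϖ := by
  set wL := WildConductor.absRestrict w L with hwL
  have hL : IsIntegralAbs (WittVector p k) wL := hw.integral.absRestrict L
  set O := integralClosure (WittVector p k) L
  have hfin : Module.Finite (WittVector p k) O :=
    IsIntegralClosure.finite (WittVector p k) (K0 p k) L O
  set ϖO : O := hL.toInt ϖ hϖ.lt_one.le with hϖO
  set S : Submodule (WittVector p k) O :=
    Subalgebra.toSubmodule (Algebra.adjoin (WittVector p k) {ϖO}) with hS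
  have hϖS : ϖO ∈ Algebra.adjoin (WittVector p k) {ϖO} := Algebra.self_mem_adjoin_singleton _ _
  have hϖ0 : ϖ ≠ 0 := wL.pos_iff.1 hϖ.pos
  -- A $\varpi$-adic expansion with digits from $W(k)$, available because the residue field does not
  -- grow.
  have hstep : ∀ (e : ℕ) (x : O), ∃ s ∈ S, ∃ y : O, x = s + ϖO ^ e * y := by
    intro e
    induction e with
    | zero => exact fun x => ⟨0, S.zero_mem, x, by simp⟩
    | succ e ih =>
      intro x
      obtain ⟨s, hs, y, rfl⟩ := ih x
      obtain ⟨a, ha⟩ := hw.exists_abs_sub_lt (hL.coe_le_one y)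
      set z : L := (y : L) - algebraMap _ L a with hz
      have hz1 : wL (z / ϖ) ≤ 1 := by
        rw [map_div₀, div_le_one hϖ.pos]
        rcases eq_or_ne z 0 with h0 | h0
        · rw [h0, map_zero]
          exact hϖ.pos.le
        · obtain ⟨n, hn⟩ := hϖ.exists_zpow z h0
          have hlt : wL z < 1 := ha
          rw [hn] at hlt ⊢
          have hn1 : 0 < n := by
            by_contra hc
            have := one_le_zpow_of_nonpos₀ hϖ.pos hϖ.lt_one.le (not_lt.1 hc)
            linarith
          calc wL ϖ ^ n ≤ wL ϖ ^ (1 : ℤ) :=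
                zpow_le_zpow_right_of_le_one₀ hϖ.pos hϖ.lt_one.le (by omega)
            _ = wL ϖ := zpow_one _
      refine ⟨s + ϖO ^ e * algebraMap (WittVector p k) O a, ?_, hL.toInt _ hz1, ?_⟩
      · refine S.add_mem hs ?_
        exact Subalgebra.mul_mem _ (pow_mem hϖS e) (Subalgebra.algebraMap_mem _ _)
      · have hy : y = algebraMap (WittVector p k) O a + ϖO * hL.toInt _ hz1 := by
          apply Subtype.ext
          change (y : L) = algebraMap _ L a + ϖ * (z / ϖ)
          field_simp
          rw [hz]
          ring
        conv_lhs => rw [hy]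
        ring
  have hp0 : (p : L) ≠ 0 := by
    have := NeZero.ne (p : L)
    exact this
  obtain ⟨e, he⟩ : ∃ e : ℕ, wL (p : L) = wL ϖ ^ e := by
    obtain ⟨n, hn⟩ := hϖ.exists_zpow (p : L) hp0
    have hn0 : 0 ≤ n := by
      by_contra hc
      have h1 := one_lt_zpow_of_neg₀ hϖ.pos hϖ.lt_one (not_le.1 hc)
      rw [← hn] at h1
      have h2 : wL (p : L) = w p := by
        rw [hwL, absRestrict_apply]
        simp
      rw [h2] at h1
      exact absurd h1 (not_lt.2 hw.lt_one.le)
    exact ⟨n.toNat, by rw [hn, ← zpow_natCast, Int.toNat_of_nonneg hn0]⟩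
  have hunit : wL (ϖ ^ e / (p : L)) ≤ 1 := by
    rw [map_div₀, map_pow, he, div_self (pow_pos hϖ.pos e).ne']
  -- With $e$ the valuation of $p$, the remainder of the expansion lies in $pO$. Nakayama then
  -- applies, since $O$ is finite over $W(k)$.
  have htop : (⊤ : Submodule (WittVector p k) O) ≤
      S ⊔ (Ideal.span {(p : WittVector p k)}) • ⊤ := by
    intro x _
    obtain ⟨s, hs, y, rfl⟩ := hstep e x
    refine Submodule.add_mem_sup hs ?_
    have h1 : ϖO ^ e * y = (p : WittVector p k) • (hL.toInt _ hunit * y) := by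
      apply Subtype.ext
      rw [Algebra.smul_def, map_natCast]
      change ϖ ^ e * (y : L) = ((p : O) : L) * (ϖ ^ e / (p : L) * y)
      have : ((p : O) : L) = (p : L) := map_natCast (algebraMap O L) p
      rw [this]
      field_simp
    rw [h1]
    exact Submodule.smul_mem_smul (Ideal.mem_span_singleton_self _) trivial
  have hjac : Ideal.span {(p : WittVector p k)} ≤ (⊥ : Ideal (WittVector p k)).jacobson := by
    rw [IsLocalRing.jacobson_eq_maximalIdeal _ bot_ne_top, Ideal.span_singleton_le_iff_mem,
      IsLocalRing.mem_maximalIdeal]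
    exact (WittVector.irreducible p).not_isUnit
  have hall := Submodule.le_of_le_smul_of_le_jacobson_bot hfin.1 hjac htop
  intro x hx
  have hxS : hL.toInt x hx ∈ S := hall trivial
  have hxS' : hL.toInt x hx ∈ Algebra.adjoin (WittVector p k) {ϖO} := hxS
  rw [Algebra.adjoin_singleton_eq_range_aeval] at hxS'
  obtain ⟨P, hP⟩ := hxS'
  refine ⟨P, ?_⟩
  have h1 : ((aeval ϖO P : O) : L) = x := congrArg Subtype.val hP
  rw [← h1]
  exact aeval_algebraMap_apply L ϖO P

end IsPadicAbs

end Fields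

/-! ### Roots of unity, cyclotomic degrees and Kummer degrees -/

section Roots

open IntermediateField Polynomial

variable {p : ℕ} [Fact p.Prime] {k : Type*} [Field k] [CharP k p]

theorem abs_eq_one_of_pow_eq_one {L : Type*} [Field L] (w : AbsoluteValue L ℝ) {η : L} {n : ℕ}
    (hn : n ≠ 0) (h : η ^ n = 1) : w η = 1 := by
  have : w η ^ n = 1 := by rw [← map_pow, h, map_one]
  exact (pow_eq_one_iff_of_nonneg (w.nonneg _) hn).1 this

theorem exists_isPrimitiveRoot (n : ℕ) : ∃ ζ : Kbar p k, IsPrimitiveRoot ζ (p ^ n) := by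
  have hp : p ≠ 0 := (Fact.out : p.Prime).ne_zero
  have : NeZero (((p ^ n : ℕ)) : Kbar p k) := ⟨by exact_mod_cast pow_ne_zero n hp⟩
  exact HasEnoughRootsOfUnity.exists_primitiveRoot (Kbar p k) (p ^ n)

variable {w : AbsoluteValue (Kbar p k) ℝ}

namespace IsPadicAbs

variable (hw : IsPadicAbs w)
include hw

theorem abs_pow_sub_one_le {x : Kbar p k} (hx : w x ≤ 1) (i : ℕ) : w (x ^ i - 1) ≤ w (x - 1) := by
  have := hw.integral.abs_aeval_sub_le hx (y := 1) (by simp) (X ^ i)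
  simpa using this

theorem abs_natCast_le_one (n : ℕ) : w (n : Kbar p k) ≤ 1 := by
  have h : IsIntegral (WittVector p k) (algebraMap (WittVector p k) (Kbar p k) n) :=
    isIntegral_algebraMap
  rwa [map_natCast, hw.integral.isIntegral_iff] at h

/-- From $p=\Phi_{p^{n+1}}(1)=\prod(1-\mu)$: the factors have equal size, as any two primitive roots
are powers of each other. -/
theorem abs_primitiveRoot_sub_one {n : ℕ} {ζ : Kbar p k} (hζ : IsPrimitiveRoot ζ (p ^ (n + 1))) :
    w (ζ - 1) ^ (p ^ n * (p - 1)) = w p := by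
  have hp : p.Prime := Fact.out
  have h1 : ((p : ℕ) : Kbar p k) = ∏ μ ∈ primitiveRoots (p ^ (n + 1)) (Kbar p k), (1 - μ) := by
    rw [← eval_one_cyclotomic_prime_pow (R := Kbar p k) n,
      cyclotomic_eq_prod_X_sub_primitiveRoots hζ, eval_prod]
    simp
  have h2 : ∀ μ ∈ primitiveRoots (p ^ (n + 1)) (Kbar p k), w (1 - μ) = w (ζ - 1) := by
    intro μ hμ
    have hμ' := isPrimitiveRoot_of_mem_primitiveRoots hμ
    have hne : p ^ (n + 1) ≠ 0 := pow_ne_zero _ hp.ne_zero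
    rw [w.map_sub]
    refine le_antisymm ?_ ?_
    · obtain ⟨i, -, rfl⟩ := hζ.eq_pow_of_pow_eq_one hμ'.pow_eq_one
      exact hw.abs_pow_sub_one_le (abs_eq_one_of_pow_eq_one w hne hζ.pow_eq_one).le i
    · have : NeZero (p ^ (n + 1)) := ⟨hne⟩
      obtain ⟨i, -, hi⟩ := hμ'.eq_pow_of_pow_eq_one hζ.pow_eq_one
      rw [← hi]
      exact hw.abs_pow_sub_one_le (abs_eq_one_of_pow_eq_one w hne hμ'.pow_eq_one).le i
  rw [h1, map_prod, Finset.prod_congr rfl h2, Finset.prod_const, hζ.card_primitiveRoots,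
    Nat.totient_prime_pow_succ hp]

theorem abs_root_sub_one {η : Kbar p k} (h : η ^ p = 1) (h1 : η ≠ 1) :
    w (η - 1) ^ (p - 1) = w p := by
  have hη : IsPrimitiveRoot η (p ^ (0 + 1)) := by
    rw [zero_add, pow_one]
    have h2 := IsPrimitiveRoot.orderOf η
    rwa [orderOf_eq_prime h h1] at h2
  simpa using hw.abs_primitiveRoot_sub_one hη

/-- Some power $\eta^i$ has order exactly $p$, and $|\eta^i-1|\le|\eta-1|$. -/
theorem le_abs_root_sub_one {η : Kbar p k} {n : ℕ} (h : η ^ p ^ n = 1) (h1 : η ≠ 1) {ρ : ℝ}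
    (hρ0 : 0 ≤ ρ) (hρ : ρ ^ (p - 1) = w p) : ρ ≤ w (η - 1) := by
  have hp : p.Prime := Fact.out
  induction n with
  | zero => exact absurd (by simpa using h) h1
  | succ n ih =>
    by_cases h2 : η ^ p ^ n = 1
    · exact ih h2
    · have h3 : (η ^ p ^ n) ^ p = 1 := by rw [← pow_mul, ← pow_succ, h]
      have h4 := hw.abs_root_sub_one h3 h2
      rw [← hρ, pow_left_inj₀ (w.nonneg _) hρ0 (by have := hp.two_le; omega)] at h4
      rw [← h4]
      exact hw.abs_pow_sub_one_le
        (abs_eq_one_of_pow_eq_one w (pow_ne_zero _ hp.ne_zero) h).le _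

/-- A lower bound for the product of the `η - 1` over a set of nontrivial `p ^ m`-th roots of
unity `η`. -/
theorem pow_le_prod_root_sub_one {m : ℕ} (T : Finset (Kbar p k))
    (hT : ∀ η ∈ T, η ^ p ^ m = 1 ∧ η ≠ 1) : w p ^ m ≤ ∏ η ∈ T, w (η - 1) := by
  classical
  have hp : p.Prime := Fact.out
  obtain ⟨μ, hμ⟩ := exists_isPrimitiveRoot (p := p) (k := k) m
  have hne : p ^ m ≠ 0 := pow_ne_zero _ hp.ne_zero
  obtain ⟨n, hn⟩ : ∃ n, p ^ m = n + 1 := ⟨p ^ m - 1, by omega⟩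
  have h1 := IsPrimitiveRoot.prod_one_sub_pow_eq_order (hn ▸ hμ)
  have h2 : w p ^ m = ∏ i ∈ Finset.range n, w (μ ^ (i + 1) - 1) := by
    have : ((n : Kbar p k) + 1) = (p : Kbar p k) ^ m := by exact_mod_cast hn.symm
    rw [← map_pow, ← this, ← h1, map_prod]
    exact Finset.prod_congr rfl fun i _ => w.map_sub _ _
  have hinj : Set.InjOn (fun i => μ ^ (i + 1)) (Finset.range n : Set ℕ) := by
    intro i hi j hj hij
    simp only [Finset.coe_range, Set.mem_Iio] at hi hj
    have := hμ.pow_inj (by omega) (by omega) hij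
    omega
  have hsub : T ⊆ (Finset.range n).image fun i => μ ^ (i + 1) := by
    intro η hη
    obtain ⟨h3, h4⟩ := hT η hη
    have : NeZero (p ^ m) := ⟨hne⟩
    obtain ⟨i, hi, rfl⟩ := hμ.eq_pow_of_pow_eq_one h3
    have hi0 : i ≠ 0 := by
      rintro rfl
      exact h4 (pow_zero _)
    refine Finset.mem_image.2 ⟨i - 1, Finset.mem_range.2 (by omega), ?_⟩
    congr 1
    omega
  rw [h2, ← Finset.prod_image (f := fun η => w (η - 1)) hinj, ← Finset.prod_sdiff hsub]
  refine mul_le_of_le_one_left (Finset.prod_nonneg fun _ _ => w.nonneg _)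
    (Finset.prod_le_one (fun _ _ => w.nonneg _) fun η hη => ?_)
  obtain ⟨i, -, rfl⟩ := Finset.mem_image.1 (Finset.sdiff_subset hη)
  have hμ1 := abs_eq_one_of_pow_eq_one w hne hμ.pow_eq_one
  refine (abs_sub_le_max hw.integral.nonarch _ _).trans ?_
  simp [hμ1]

end IsPadicAbs

theorem mem_cyc_of_pow_eq_one {n : ℕ} {η : Kbar p k} (h : η ^ p ^ n = 1) : η ∈ cyc p k n :=
  subset_adjoin _ _ h

theorem cyc_eq_adjoin {n : ℕ} {ζ : Kbar p k} (hζ : IsPrimitiveRoot ζ (p ^ n)) :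
    cyc p k n = adjoin (K0 p k) {ζ} := by
  have hp : p.Prime := Fact.out
  have : NeZero (p ^ n) := ⟨pow_ne_zero _ hp.ne_zero⟩
  refine le_antisymm (adjoin_le_iff.2 fun η hη => ?_) (adjoin_le_iff.2 ?_)
  · obtain ⟨i, -, rfl⟩ := hζ.eq_pow_of_pow_eq_one hη
    exact pow_mem (mem_adjoin_simple_self _ ζ) i
  · rintro _ rfl
    exact mem_cyc_of_pow_eq_one hζ.pow_eq_one

theorem cycAdjoin_le_iff {n : ℕ} {β : Kbar p k} {E : IntermediateField (K0 p k) (Kbar p k)} :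
    cycAdjoin p k n β ≤ E ↔ cyc p k n ≤ E ∧ β ∈ E := by
  constructor
  · intro h
    refine ⟨fun x hx => h ?_, h (self_mem_cycAdjoin n β)⟩
    exact (adjoin (cyc p k n) {β}).algebraMap_mem ⟨x, hx⟩
  · rintro ⟨h1, h2⟩ x hx
    have hx' : x ∈ adjoin (cyc p k n) {β} := hx
    have : adjoin (cyc p k n) {β} ≤ extendScalars h1 := by
      rw [adjoin_simple_le_iff]
      exact h2
    exact this hx'

theorem cyc_le_cycAdjoin (n : ℕ) (β : Kbar p k) : cyc p k n ≤ cycAdjoin p k n β :=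
  (cycAdjoin_le_iff.1 le_rfl).1

theorem cycAdjoin_eq_cyc {n : ℕ} {β : Kbar p k} (h : β ∈ cyc p k n) :
    cycAdjoin p k n β = cyc p k n :=
  le_antisymm (cycAdjoin_le_iff.2 ⟨le_rfl, h⟩) (cyc_le_cycAdjoin n β)

instance finiteDimensional_cyc (n : ℕ) : FiniteDimensional (K0 p k) (cyc p k n) := by
  obtain ⟨ζ, hζ⟩ := exists_isPrimitiveRoot (p := p) (k := k) n
  rw [cyc_eq_adjoin hζ]
  exact adjoin.finiteDimensional (Algebra.IsIntegral.isIntegral ζ)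

instance finiteDimensional_cycAdjoin (n : ℕ) (β : Kbar p k) :
    FiniteDimensional (K0 p k) (cycAdjoin p k n β) := by
  have : FiniteDimensional (cyc p k n) (adjoin (cyc p k n) {β}) :=
    adjoin.finiteDimensional (Algebra.IsIntegral.isIntegral β)
  exact FiniteDimensional.trans (K0 p k) (cyc p k n) (adjoin (cyc p k n) {β})

/-- Only the upper bound coming from $X^m-\beta^m$; ramification later forces equality for $m=p$. -/
theorem finrank_cycAdjoin_le {n m : ℕ} (hm : 0 < m) {β : Kbar p k}
    {M : IntermediateField (K0 p k) (Kbar p k)} (hM : cyc p k n ≤ M)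
    (hML : M ≤ cycAdjoin p k n β) (hβ : β ^ m ∈ M) :
    ∃ d, 0 < d ∧ d ≤ m ∧
      Module.finrank (K0 p k) (cycAdjoin p k n β) = Module.finrank (K0 p k) M * d := by
  have hfin : FiniteDimensional (K0 p k) M :=
    FiniteDimensional.of_injective (inclusion hML).toLinearMap (inclusion_injective hML)
  have hpos : 0 < Module.finrank (K0 p k) (cycAdjoin p k n β) := Module.finrank_pos
  refine ⟨relfinrank M (cycAdjoin p k n β), ?_, ?_, (finrank_bot_mul_relfinrank hML).symm⟩
  · rw [← finrank_bot_mul_relfinrank hML] at hpos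
    exact Nat.pos_of_mul_pos_left hpos
  · rw [relfinrank_eq_finrank_of_le hML]
    have h1 : extendScalars hML ≤ adjoin M {β} := by
      have h2 : cycAdjoin p k n β ≤ (adjoin M {β}).restrictScalars (K0 p k) :=
        cycAdjoin_le_iff.2 ⟨fun x hx => (adjoin M {β}).algebraMap_mem ⟨x, hM hx⟩,
          mem_adjoin_simple_self M β⟩
      exact fun x hx => h2 hx
    have hint : IsIntegral M β := Algebra.IsIntegral.isIntegral β
    have : FiniteDimensional M (adjoin M {β}) := adjoin.finiteDimensional hint
    refine (LinearMap.finrank_le_finrank_of_injective (f := (inclusion h1).toLinearMap)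
      (inclusion_injective h1)).trans ?_
    rw [adjoin.finrank hint]
    have hmon : (X ^ m - C (⟨β ^ m, hβ⟩ : M)).Monic := monic_X_pow_sub_C _ hm.ne'
    have h3 := natDegree_le_natDegree (minpoly.min M β hmon (by
      rw [map_sub, map_pow, aeval_X, aeval_C]
      exact sub_self _))
    rwa [natDegree_X_pow_sub_C] at h3

variable {w : AbsoluteValue (Kbar p k) ℝ}

/-- The cyclotomic polynomial bounds the degree above; the valuation of $\zeta-1$, of denominator
$p^n(p-1)$ relative to $p$, bounds it below. -/
theorem IsPadicAbs.finrank_cyc (hw : IsPadicAbs w) (n : ℕ) :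
    Module.finrank (K0 p k) (cyc p k (n + 1)) = p ^ n * (p - 1) := by
  have hp : p.Prime := Fact.out
  obtain ⟨ζ, hζ⟩ := exists_isPrimitiveRoot (p := p) (k := k) (n + 1)
  set N := Module.finrank (K0 p k) (cyc p k (n + 1)) with hN
  have hNpos : 0 < N := Module.finrank_pos
  have hle : N ≤ p ^ n * (p - 1) := by
    have hint : IsIntegral (K0 p k) ζ := Algebra.IsIntegral.isIntegral ζ
    rw [hN, cyc_eq_adjoin hζ, adjoin.finrank hint, ← Nat.totient_prime_pow_succ hp,
      ← natDegree_cyclotomic (p ^ (n + 1)) (K0 p k)]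
    refine natDegree_le_of_dvd (minpoly.dvd _ _ ?_) (cyclotomic_ne_zero _ _)
    rw [aeval_def, ← eval_map, map_cyclotomic]
    have : NeZero ((p ^ (n + 1) : ℕ) : Kbar p k) :=
      ⟨by exact_mod_cast pow_ne_zero _ hp.ne_zero⟩
    exact (isRoot_cyclotomic_iff.2 hζ)
  have hmem : ζ - 1 ∈ cyc p k (n + 1) :=
    sub_mem (mem_cyc_of_pow_eq_one hζ.pow_eq_one) (one_mem _)
  have hval := hw.abs_primitiveRoot_sub_one hζ
  have hne : ζ - 1 ≠ 0 := by
    intro h0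
    rw [h0, map_zero, zero_pow] at hval
    · exact hw.pos.ne hval
    · have := hp.two_le
      have : 0 < p ^ n * (p - 1) := Nat.mul_pos (pow_pos hp.pos n) (by omega)
      omega
  obtain ⟨m, hm⟩ := hw.exists_zpow _ _ hmem hne
  rw [← hN] at hm
  have h1 : w p ^ (m * ((p ^ n * (p - 1) : ℕ) : ℤ)) = w p ^ ((N : ℕ) : ℤ) := by
    rw [zpow_mul, ← hm, zpow_natCast, zpow_natCast, ← hval, ← pow_mul, ← pow_mul, mul_comm]
  rw [zpow_eq_iff hw.pos hw.lt_one] at h1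
  have hm1 : 1 ≤ m := by
    by_contra hc
    have : m * ((p ^ n * (p - 1) : ℕ) : ℤ) ≤ 0 :=
      mul_nonpos_of_nonpos_of_nonneg (by omega) (Int.natCast_nonneg _)
    omega
  have : ((p ^ n * (p - 1) : ℕ) : ℤ) ≤ N := by
    rw [← h1]
    exact le_mul_of_one_le_left (Int.natCast_nonneg _) hm1
  omega

/-- A Kummer step in which an element of valuation prime to `p` becomes a `p`-th power up to
units is totally ramified. -/
theorem IsPadicAbs.finrank_eq_of_not_dvd (hw : IsPadicAbs w)
    {L : IntermediateField (K0 p k) (Kbar p k)} [FiniteDimensional (K0 p k) L]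
    {e d N : ℕ} (hd0 : 0 < d) (hdp : d ≤ p) (he0 : 0 < e)
    (hL : Module.finrank (K0 p k) L = e * d) {s : Kbar p k} (hs : s ∈ L)
    (hsN : w s ^ (e * p) = w p ^ N) (hN : ¬ p ∣ N) :
    d = p := by
  have hp : p.Prime := Fact.out
  have hs0 : s ≠ 0 := by
    rintro rfl
    rw [map_zero, zero_pow (Nat.mul_pos he0 hp.pos).ne'] at hsN
    exact (pow_pos hw.pos N).ne hsN
  obtain ⟨m, hm⟩ := hw.exists_zpow L s hs hs0
  rw [hL] at hm
  have h1 : w p ^ (m * (p : ℤ)) = w p ^ ((N * d : ℕ) : ℤ) := by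
    rw [zpow_mul, ← hm, zpow_natCast, zpow_natCast, pow_mul (w p), ← hsN, ← pow_mul, ← pow_mul]
    congr 1
    ring
  rw [zpow_eq_iff hw.pos hw.lt_one] at h1
  have h2 : p ∣ N * d := by
    have : (p : ℤ) ∣ ((N * d : ℕ) : ℤ) := ⟨m, by rw [← h1]; ring⟩
    exact_mod_cast this
  have h3 := (hp.dvd_mul.1 h2).resolve_left hN
  exact le_antisymm hdp (Nat.le_of_dvd hd0 h3)

end Roots

/-! ### The Kummer tower of a primitive element -/

section Tower

open IntermediateField

variable {p : ℕ} [Fact p.Prime] {k : Type*} [Field k] [CharP k p]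
  {w : AbsoluteValue (Kbar p k) ℝ}

namespace IsPadicAbs

variable (hw : IsPadicAbs w)
include hw

theorem abs_natCast_eq_one {r : ℕ} (hr : ¬ p ∣ r) : w (r : Kbar p k) = 1 := by
  have hp : p.Prime := Fact.out
  obtain ⟨m, hm⟩ := Nat.exists_mul_mod_eq_one_of_coprime
    ((hp.coprime_iff_not_dvd.2 hr).symm) hp.one_lt
  have h1 : r * m = 1 + p * (r * m / p) := by
    have := Nat.mod_add_div (r * m) p
    omega
  have h2 : w ((r * m : ℕ) : Kbar p k) = 1 := by
    rw [h1]
    push_cast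
    refine abs_one_add_of_lt hw.integral.nonarch ?_
    rw [map_mul]
    refine (mul_le_of_le_one_right (w.nonneg _) ?_).trans_lt hw.lt_one
    exact_mod_cast hw.abs_natCast_le_one (r * m / p)
  push_cast at h2
  rw [map_mul] at h2
  have h3 := hw.abs_natCast_le_one r
  have h4 := hw.abs_natCast_le_one m
  have := w.nonneg (r : Kbar p k)
  nlinarith

/-- Expanding, $(1+y)^r-1=y(r+yz)$ with $z$ integral and $r$ a unit. -/
theorem abs_one_add_pow_sub_one {r : ℕ} (hr : ¬ p ∣ r) {y : Kbar p k} (hy : w y < 1) :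
    w ((1 + y) ^ r - 1) = w y := by
  have key : ∀ r : ℕ, ∃ z, w z ≤ 1 ∧ (1 + y) ^ r = 1 + r * y + y ^ 2 * z := by
    intro r
    induction r with
    | zero => exact ⟨0, by simp, by simp⟩
    | succ r ih =>
      obtain ⟨z, hz, h⟩ := ih
      refine ⟨r + z + y * z, ?_, ?_⟩
      · have h1 : w (y * z) ≤ 1 := by
          rw [map_mul]
          exact mul_le_one₀ hy.le (w.nonneg _) hz
        have h2 := hw.integral.nonarch (r : Kbar p k) z
        exact (hw.integral.nonarch _ _).trans
          (max_le (h2.trans (max_le (hw.abs_natCast_le_one r) hz)) h1)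
      · rw [pow_succ, h]
        push_cast
        ring
  obtain ⟨z, hz, h⟩ := key r
  have h1 : (1 + y) ^ r - 1 = y * (r + y * z) := by
    rw [h]
    ring
  have h2 : w (y * z) < w (r : Kbar p k) := by
    rw [hw.abs_natCast_eq_one hr, map_mul]
    exact (mul_le_of_le_one_right (w.nonneg _) hz).trans_lt hy
  rw [h1, map_mul, hw.integral.nonarch.add_eq_max_of_ne h2.ne', max_eq_left h2.le,
    hw.abs_natCast_eq_one hr, mul_one]

/-- Extracting a `p`-th root of a `1`-unit of small level. -/
theorem abs_sub_one_pow {β : Kbar p k} (hβ : w β ≤ 1)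
    (h : w p ^ p < w (β ^ p - 1) ^ (p - 1)) : w (β - 1) ^ p = w (β ^ p - 1) := by
  have hp : p.Prime := Fact.out
  have hp1 : p - 1 ≠ 0 := by have := hp.two_le; omega
  set x := β - 1 with hx
  have hx1 : w x ≤ 1 := (abs_sub_le_max hw.integral.nonarch _ _).trans (by simpa using hβ)
  obtain ⟨r, hr⟩ := exists_add_pow_prime_eq hp (hw.integral.toInt x hx1) 1
  have hr' : β ^ p - 1 = x ^ p + p * x * r := by
    have h1 : ((((hw.integral.toInt x hx1) + 1) ^ p : integralClosure _ _) : Kbar p k) = β ^ p := by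
      change (x + 1) ^ p = β ^ p
      rw [hx, sub_add_cancel]
    have h2 := congrArg (algebraMap (integralClosure (WittVector p k) (Kbar p k)) (Kbar p k)) hr
    simp only [map_add, map_mul, map_pow, map_one, mul_one, one_pow, map_natCast] at h2
    change (x + 1) ^ p = x ^ p + 1 + p * x * (r : Kbar p k) at h2
    rw [hx, sub_add_cancel] at h2
    rw [h2]
    ring
  have hr1 := hw.integral.coe_le_one r
  have hsmall : w (p * x * r) ≤ w p * w x := by
    rw [map_mul, map_mul]
    exact mul_le_of_le_one_right (mul_nonneg (w.nonneg _) (w.nonneg _)) hr1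
  rcases lt_or_ge (w p * w x) (w x ^ p) with hlt | hge
  · have h1 : w (p * x * r) < w (x ^ p) := by
      rw [map_pow]
      exact hsmall.trans_lt hlt
    rw [hr', hw.integral.nonarch.add_eq_max_of_ne h1.ne', max_eq_left h1.le, map_pow]
  -- If $px$ dominated $x^p$, then $|x|^{p-1}\le|p|$ and so $|\beta^p-1|^{p-1}\le|p|^p$, contrary to
  -- the level hypothesis.
  · exfalso
    have h1 : w (β ^ p - 1) ≤ w p * w x := by
      rw [hr']
      refine (hw.integral.nonarch _ _).trans (max_le ?_ hsmall)
      rwa [map_pow]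
    have h2 : w x ^ (p - 1) ≤ w p := by
      rcases eq_or_lt_of_le (w.nonneg x) with h0 | h0
      · rw [← h0, zero_pow hp1]
        exact hw.pos.le
      · have h3 : w x ^ p = w x ^ (p - 1) * w x := by
          rw [← pow_succ, Nat.sub_add_cancel hp.one_le]
        rw [h3] at hge
        exact le_of_mul_le_mul_right hge h0
    have h3 : w (β ^ p - 1) ^ (p - 1) ≤ w p ^ p := by
      calc w (β ^ p - 1) ^ (p - 1) ≤ (w p * w x) ^ (p - 1) :=
            pow_le_pow_left₀ (w.nonneg _) h1 _
        _ = w p ^ (p - 1) * w x ^ (p - 1) := mul_pow _ _ _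
        _ ≤ w p ^ (p - 1) * w p := by
            gcongr
        _ = w p ^ p := by rw [← pow_succ, Nat.sub_add_cancel hp.one_le]
    exact absurd h (not_lt.2 h3)

end IsPadicAbs

/-- Bookkeeping for the Kummer tower of a `p`-primitive element: `β` is a `p ^ j`-th root of the
given element, and `β - δ` (with `δ = 0` or `δ = 1`) is the element of `K_l(β)` whose valuation `N`
is prime to `p`; `n` is the valuation of `a - 1`. -/
structure KummerLevel (w : AbsoluteValue (Kbar p k) ℝ) (l : ℕ) (δ : Kbar p k) (N n j : ℕ)
    (β : Kbar p k) : Prop where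
  finrank_eq : Module.finrank (K0 p k) (cycAdjoin p k (l + 1) β) = p ^ l * (p - 1) * p ^ j
  abs_sub : w (β - δ) ^ (p ^ l * (p - 1) * p ^ j) = w p ^ N
  abs_mul : w β ^ (p ^ l * (p - 1) * p ^ j) * w p ^ n = w p ^ N
  exists_gen : ∃ π ∈ cycAdjoin p k (l + 1) β, w π ^ (p ^ l * (p - 1) * p ^ j) = w p

/-- The numerical conditions on the data of a `KummerLevel`. -/
def KummerCond (p : ℕ) [Fact p.Prime] (k : Type*) [Field k] [CharP k p] (l : ℕ) (δ : Kbar p k)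
    (N n : ℕ) : Prop :=
  ¬ p ∣ N ∧ ((δ = 0 ∧ n = 0) ∨ (δ = 1 ∧ n = N ∧ n < p ^ (l + 1)))

theorem KummerCond.delta {l N n : ℕ} {δ : Kbar p k} (h : KummerCond p k l δ N n) :
    δ = 0 ∨ δ = 1 := by
  rcases h.2 with h | h
  · exact Or.inl h.1
  · exact Or.inr h.1

theorem KummerCond.lt {l N n : ℕ} {δ : Kbar p k} (h : KummerCond p k l δ N n) :
    n < p ^ (l + 1) := by
  rcases h.2 with h | h
  · rw [h.2]
    exact pow_pos (Fact.out : p.Prime).pos _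
  · exact h.2.2

theorem KummerCond.delta_mem {l N n : ℕ} {δ : Kbar p k} (h : KummerCond p k l δ N n)
    (L : IntermediateField (K0 p k) (Kbar p k)) : δ ∈ L := by
  rcases h.delta with rfl | rfl
  · exact zero_mem _
  · exact one_mem _

theorem ramIdx_pos (p : ℕ) [Fact p.Prime] (l j : ℕ) : 0 < p ^ l * (p - 1) * p ^ j := by
  have hp : p.Prime := Fact.out
  have := hp.two_le
  exact Nat.mul_pos (Nat.mul_pos (pow_pos hp.pos _) (by omega)) (pow_pos hp.pos _)

variable {l : ℕ} {δ : Kbar p k} {N n j : ℕ} {β : Kbar p k}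

theorem KummerLevel.abs_sub_pow (hw : IsPadicAbs w) (hc : KummerCond p k l δ N n)
    (hj : KummerLevel w l δ N n j (β ^ p)) : w (β - δ) ^ p = w (β ^ p - δ) := by
  have hp : p.Prime := Fact.out
  rcases hc.2 with ⟨rfl, -⟩ | ⟨rfl, hnN, hlt⟩
  · simp
  · have he := ramIdx_pos p l j
    have hβ : w β ≤ 1 := by
      have h1 := hj.abs_mul
      rw [hnN] at h1
      have h2 : w (β ^ p) ^ (p ^ l * (p - 1) * p ^ j) = 1 :=
        mul_right_cancel₀ (pow_pos hw.pos N).ne' (by rw [h1, one_mul])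
      rw [map_pow, ← pow_mul] at h2
      exact ((pow_eq_one_iff_of_nonneg (w.nonneg _) (Nat.mul_pos hp.pos he).ne').1 h2).le
    refine hw.abs_sub_one_pow hβ ?_
    refine lt_of_pow_lt_pow_left₀ (p ^ l * (p - 1) * p ^ j) (pow_nonneg (w.nonneg _) _) ?_
    rw [← pow_mul (w (β ^ p - 1)), mul_comm (p - 1), pow_mul (w (β ^ p - 1)), hj.abs_sub,
      ← pow_mul, ← pow_mul, pow_lt_pow_iff_right_of_lt_one₀ hw.pos hw.lt_one, ← hnN]
    have hp1 : 0 < p - 1 := by have := hp.two_le; omega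
    calc n * (p - 1) < p ^ (l + 1) * (p - 1) := Nat.mul_lt_mul_of_pos_right hlt hp1
      _ = p * (p ^ l * (p - 1)) * 1 := by rw [pow_succ]; ring
      _ ≤ p * (p ^ l * (p - 1)) * p ^ j := Nat.mul_le_mul_left _ (pow_pos hp.pos j)
      _ = p * (p ^ l * (p - 1) * p ^ j) := by ring

/-- The inductive step, together with the displacement of the new uniformizer. The field $E$ and the
endomorphism $g$ are arbitrary so that it serves both $\mathrm{Gal}(K_\ell(\beta)/K_\ell(\beta^p))$
and automorphisms of the larger field $K_c(\alpha)$. -/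
theorem KummerLevel.succ (hw : IsPadicAbs w) (hc : KummerCond p k l δ N n)
    (hj : KummerLevel w l δ N n j (β ^ p)) :
    ∃ ϖ ∈ cycAdjoin p k (l + 1) β, w ϖ ^ (p ^ l * (p - 1) * p ^ (j + 1)) = w p ∧
      KummerLevel w l δ N n (j + 1) β ∧
      ∀ (E : IntermediateField (K0 p k) (Kbar p k)) (g : E →+* E) (b v : E) (η : Kbar p k),
        (b : Kbar p k) = β → (v : Kbar p k) = ϖ →
        (∀ x : E, (x : Kbar p k) ∈ cycAdjoin p k (l + 1) (β ^ p) → g x = x) →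
        cycAdjoin p k (l + 1) (β ^ p) ≤ E →
        (g b : Kbar p k) = η * β → η ^ p = 1 → η ≠ 1 →
        w ((g v : Kbar p k) - v) = w ϖ ^ (p ^ (l + 1 + j) - n + 1) := by
  have hp : p.Prime := Fact.out
  have hp2 := hp.two_le
  set e := p ^ l * (p - 1) * p ^ j with he
  have he' : p ^ l * (p - 1) * p ^ (j + 1) = e * p := by rw [he, pow_succ]; ring
  have hepos : 0 < e := ramIdx_pos p l j
  have hs := hj.abs_sub_pow hw hc
  set s := β - δ with hsdef
  set L := cycAdjoin p k (l + 1) β with hLdef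
  have hML : cycAdjoin p k (l + 1) (β ^ p) ≤ L := cycAdjoin_pow_le _ _ _
  have hβL : β ∈ L := self_mem_cycAdjoin _ _
  have hsL : s ∈ L := sub_mem hβL (hc.delta_mem L)
  have hsN : w s ^ (e * p) = w p ^ N := by
    rw [mul_comm, pow_mul, hs, hj.abs_sub]
  have hs0 : s ≠ 0 := by
    intro h0
    rw [h0, map_zero, zero_pow (Nat.mul_pos hepos hp.pos).ne'] at hsN
    exact (pow_pos hw.pos N).ne hsN
  obtain ⟨d, hd0, hdp, hd⟩ := finrank_cycAdjoin_le hp.pos (cyc_le_cycAdjoin (l + 1) (β ^ p)) hML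
    (self_mem_cycAdjoin _ _)
  rw [hj.finrank_eq, ← he] at hd
  -- From here on the prime itself is called `d`.
  obtain rfl : d = p := hw.finrank_eq_of_not_dvd hd0 hdp hepos hd hsL hsN hc.1
  obtain ⟨π, hπ, hπe⟩ := hj.exists_gen
  rw [← he] at hπe
  have hπ0 : π ≠ 0 := by
    rintro rfl
    rw [map_zero, zero_pow hepos.ne'] at hπe
    exact hw.pos.ne hπe
  -- In $K_\ell(\beta)$, $s$ has valuation $N$ and $\pi$ has valuation $p$; with $Nr=1+pt$ the
  -- quotient $s^r/\pi^t$ has valuation 1.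
  obtain ⟨r, hr⟩ := Nat.exists_mul_mod_eq_one_of_coprime
    ((hp.coprime_iff_not_dvd.2 hc.1).symm) hp.one_lt
  have hrt : N * r = 1 + d * (N * r / d) := by
    have := Nat.mod_add_div (N * r) d
    omega
  set t := N * r / d with ht
  have hdr : ¬ d ∣ r := by
    intro h
    have h1 := (Nat.dvd_add_left (Dvd.intro t rfl)).1 (hrt ▸ Dvd.dvd.mul_left h N)
    have := Nat.le_of_dvd one_pos h1
    omega
  set ϖ := s ^ r / π ^ t with hϖ
  have hϖL : ϖ ∈ L := div_mem (pow_mem hsL r) (pow_mem (hML hπ) t)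
  have hϖe : w ϖ ^ (e * d) = w d := by
    rw [hϖ, map_div₀, map_pow, map_pow, div_pow, ← pow_mul, mul_comm r, pow_mul, hsN, ← pow_mul (w π),
      show t * (e * d) = e * (d * t) by ring, pow_mul (w π), hπe, ← pow_mul, hrt, pow_add, pow_one,
      mul_div_assoc, div_self (pow_pos hw.pos _).ne', mul_one]
  have hϖpos : 0 < w ϖ := by
    refine lt_of_le_of_ne (w.nonneg _) fun h0 => ?_
    rw [← h0, zero_pow (Nat.mul_pos hepos hp.pos).ne'] at hϖe
    exact hw.pos.ne hϖe
  have hβe : w β ^ (e * d) * w d ^ n = w d ^ N := by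
    rw [mul_comm e, pow_mul, ← map_pow]
    exact hj.abs_mul
  refine ⟨ϖ, hϖL, by rw [he']; exact hϖe, ⟨by rw [he']; exact hd, by rw [he']; exact hsN,
    by rw [he']; exact hβe, ϖ, hϖL, by rw [he']; exact hϖe⟩, ?_⟩
  rintro E g b v η hb hv hfix hME hgb hη hη1
  have hP : n < d ^ (l + 1 + j) := by
    refine hc.lt.trans_le ?_
    exact Nat.pow_le_pow_right hp.pos (by omega)
  -- the multiplier of `s`
  set y := (η - 1) * β / s with hy
  have hgs : η * β - δ = s * (1 + y) := by
    rw [hy]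
    field_simp
    rw [hsdef]
    ring
  have hyw : w y = w ϖ ^ (d ^ (l + 1 + j) - n) := by
    have hη2 : w (η - 1) ^ (e * d) = w d ^ (d ^ (l + 1 + j)) := by
      have h1 : e * d = (d - 1) * d ^ (l + 1 + j) := by
        rw [he, show l + 1 + j = l + j + 1 by ring, pow_succ, pow_add]
        ring
      rw [h1, pow_mul, hw.abs_root_sub_one hη hη1]
    refine (pow_left_inj₀ (w.nonneg _) (pow_nonneg hϖpos.le _) (Nat.mul_pos hepos hp.pos).ne').1 ?_
    rw [← pow_mul, mul_comm _ (e * d), pow_mul (w ϖ), hϖe, hy, map_div₀, map_mul, div_pow, mul_pow, hη2,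
      hsN, ← hβe]
    have h2 : w d ^ d ^ (l + 1 + j) = w d ^ (d ^ (l + 1 + j) - n) * w d ^ n := by
      rw [← pow_add, Nat.sub_add_cancel hP.le]
    have h3 : w β ^ (e * d) ≠ 0 := by
      intro h0
      rw [h0, zero_mul] at hβe
      exact (pow_pos hw.pos N).ne hβe
    have h4 := (pow_pos hw.pos n).ne'
    rw [h2]
    field_simp
  have hy1 : w y < 1 := by
    rw [hyw]
    refine pow_lt_one₀ hϖpos.le ?_ (by omega)
    by_contra hcon
    have := one_le_pow₀ (not_lt.1 hcon) (n := e * d)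
    rw [hϖe] at this
    exact absurd hw.lt_one (not_lt.2 this)
  have hgv : (g v : Kbar d k) = (s * (1 + y)) ^ r / π ^ t := by
    have hδE := hc.delta_mem E
    have hgδ : g ⟨δ, hδE⟩ = ⟨δ, hδE⟩ := by
      rcases hc.delta with h | h
      · have : (⟨δ, hδE⟩ : E) = 0 := Subtype.ext h
        rw [this, map_zero]
      · have : (⟨δ, hδE⟩ : E) = 1 := Subtype.ext h
        rw [this, map_one]
    have hgπ := hfix ⟨π, hME hπ⟩ hπ
    have hv' : v = (b - ⟨δ, hδE⟩) ^ r / ⟨π, hME hπ⟩ ^ t := by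
      apply Subtype.ext
      rw [hv]
      change ϖ = ((b : Kbar d k) - δ) ^ r / π ^ t
      rw [hb]
    rw [hv', map_div₀, map_pow, map_pow, map_sub, hgδ, hgπ]
    change ((g b : Kbar d k) - δ) ^ r / π ^ t = _
    rw [hgb, hgs]
  have hfin : (g v : Kbar d k) - v = ϖ * ((1 + y) ^ r - 1) := by
    rw [hgv, hv, hϖ, mul_pow]
    ring
  rw [hfin, map_mul, hw.abs_one_add_pow_sub_one hdr hy1, hyw, pow_succ, mul_comm]

end Tower

/-! ### The numerical recursion -/

section Numeric

/-- The recursion for the Herbrand functions along the Kummer tower forces the final bound. -/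
theorem pow_le_of_herbrand_recursion {p l c n : ℕ} (hp : 2 ≤ p) (hlc : l + 1 ≤ c)
    (hn : n < p ^ (l + 1)) {ω : ℝ} (h0 : 0 < ω) (h1 : ω < 1) (Y : ℕ → ℝ)
    (hY0 : ω ^ (p ^ (c + l) * ((p - 1) * (c - (l + 1)) + 1)) ≤ Y 0)
    (hstep : ∀ j < c, Y j ≤ Y (j + 1) *
      max (ω ^ (p ^ (c - (j + 1)) * (p ^ (l + 1 + j) - n + 1))) (Y (j + 1)) ^ (p - 1)) :
    ω ^ (p ^ (c + l) - n + 1) ≤ Y c := by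
  by_contra! hcon
  have hanti := zpow_right_strictAnti₀ h0 h1
  have hppos : 0 < p := by omega
  have hnP : ∀ s ≤ c, n * p ^ s ≤ p ^ (c + l + 1) := by
    intro s hs
    calc n * p ^ s ≤ p ^ (l + 1) * p ^ c :=
          Nat.mul_le_mul hn.le (Nat.pow_le_pow_right hppos hs)
      _ = p ^ (c + l + 1) := by rw [← pow_add]; congr 1; ring
  have hnPs : ∀ s < c, n ≤ p ^ (l + (c - s)) := fun s hs =>
    hn.le.trans (Nat.pow_le_pow_right hppos (by omega))
  -- Going down the tower, $Y_{c-s}$ stays below the Kummer term $\omega^\beta$, so each maximum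
  -- equals $\omega^\beta$ and the exponent grows by $(p-1)\beta$. Integer exponents avoid truncated
  -- subtraction.
  have claim : ∀ s ≤ c, Y (c - s) < ω ^ ((p : ℤ) ^ (c + l) * (1 + ((p : ℤ) - 1) * s) -
      ((n : ℤ) - 1) * (p : ℤ) ^ s) := by
    intro s
    induction s with
    | zero =>
      intro _
      have h2 : n ≤ p ^ (c + l) := hn.le.trans (Nat.pow_le_pow_right hppos (by omega))
      have h3 : ((p ^ (c + l) - n + 1 : ℕ) : ℤ) = (p : ℤ) ^ (c + l) * (1 + ((p : ℤ) - 1) * (0 : ℕ)) -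
          ((n : ℤ) - 1) * (p : ℤ) ^ 0 := by
        push_cast [Nat.cast_sub h2]
        ring
      rw [← h3, zpow_natCast]
      simpa using hcon
    | succ s ih =>
      intro hs
      have h2 := ih (by omega)
      have hj := hstep (c - (s + 1)) (by omega)
      have e1 : c - (s + 1) + 1 = c - s := by omega
      have e2 : c - (c - (s + 1) + 1) = s := by omega
      have e3 : l + 1 + (c - (s + 1)) = l + (c - s) := by omega
      rw [e2, e3, e1] at hj
      set β : ℤ := (p : ℤ) ^ (c + l) - ((n : ℤ) - 1) * (p : ℤ) ^ s with hβ
      have hβc : ω ^ (p ^ s * (p ^ (l + (c - s)) - n + 1)) = ω ^ β := by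
        rw [← zpow_natCast]
        congr 1
        push_cast [Nat.cast_sub (hnPs s (by omega))]
        have e4 : (p : ℤ) ^ (c + l) = (p : ℤ) ^ s * (p : ℤ) ^ (l + (c - s)) := by
          rw [← pow_add]
          congr 1
          omega
        rw [hβ, e4]
        ring
      rw [hβc] at hj
      have hle : Y (c - s) ≤ ω ^ β := by
        refine h2.le.trans (hanti.antitone ?_)
        have : (0 : ℤ) ≤ (p : ℤ) ^ (c + l) * (((p : ℤ) - 1) * s) := by
          have : (2 : ℤ) ≤ p := by exact_mod_cast hp
          have : (0 : ℤ) ≤ (p : ℤ) - 1 := by omega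
          positivity
        rw [hβ]
        linarith
      rw [max_eq_left hle] at hj
      refine hj.trans_lt ?_
      have h4 : Y (c - s) * (ω ^ β) ^ (p - 1) < ω ^ ((p : ℤ) ^ (c + l) * (1 + ((p : ℤ) - 1) * s) -
          ((n : ℤ) - 1) * (p : ℤ) ^ s) * (ω ^ β) ^ (p - 1) :=
        mul_lt_mul_of_pos_right h2 (pow_pos (zpow_pos h0 β) _)
      refine h4.trans_eq ?_
      rw [← zpow_natCast, ← zpow_mul, ← zpow_add₀ h0.ne']
      congr 1
      rw [hβ]
      push_cast [Nat.cast_sub (show 1 ≤ p by omega)]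
      ring
  have h2 := claim c le_rfl
  rw [Nat.sub_self] at h2
  have h3 := hY0.trans_lt h2
  rw [← zpow_natCast, hanti.lt_iff_gt] at h3
  push_cast [Nat.cast_sub hlc, Nat.cast_sub (show 1 ≤ p by omega)] at h3
  have hp2 : (2 : ℤ) ≤ p := by exact_mod_cast hp
  have hn' : (n : ℤ) + 1 ≤ (p : ℤ) ^ l * p := by
    rw [← pow_succ]
    exact_mod_cast hn
  have hpl : (1 : ℤ) ≤ (p : ℤ) ^ l := one_le_pow₀ (by omega)
  -- What remains of the comparison of exponents at $Y_0$. For $l=0$ it needs $n\le p-1$; for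
  -- $l\ge1$ it follows from $(p-1)(l+1)\ge p$.
  have hkey : (n : ℤ) - 1 ≤ (p : ℤ) ^ l * (((p : ℤ) - 1) * (l + 1)) := by
    rcases Nat.eq_zero_or_pos l with rfl | hl
    · simp at hn' ⊢
      omega
    · have : (1 : ℤ) ≤ l := by exact_mod_cast hl
      have h5 : (p : ℤ) ≤ ((p : ℤ) - 1) * (l + 1) := by nlinarith
      have := mul_le_mul_of_nonneg_left h5 (by linarith : (0 : ℤ) ≤ (p : ℤ) ^ l)
      linarith
  have hpc : (0 : ℤ) ≤ (p : ℤ) ^ c := by positivity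
  have h6 := mul_le_mul_of_nonneg_left hkey hpc
  have e5 : (p : ℤ) ^ (c + l) = (p : ℤ) ^ c * (p : ℤ) ^ l := pow_add _ _ _
  rw [e5] at h3
  linarith [h6, h3]

end Numeric

/-! ### Galois extensions among the fields $K_n(\beta)$ -/

section GaloisExt

open IntermediateField

variable {p : ℕ} [Fact p.Prime] {k : Type*} [Field k] [CharP k p]

theorem isGaloisExt_of_map_mem {M L : IntermediateField (K0 p k) (Kbar p k)} (h : M ≤ L)
    (hσ : ∀ σ : Kbar p k ≃ₐ[K0 p k] Kbar p k, (∀ x ∈ M, σ x = x) → ∀ x ∈ L, σ x ∈ L) :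
    IsGaloisExt h := by
  unfold IsGaloisExt
  let _ : Algebra M L := (inclusion h).toRingHom.toAlgebra
  have hcz : CharZero M := charZero_of_injective_algebraMap (algebraMap (K0 p k) M).injective
  have halg : Algebra.IsAlgebraic M (Kbar p k) := Algebra.IsAlgebraic.tower_top (K := K0 p k) M
  have hcl : IsAlgClosure M (Kbar p k) := ⟨inferInstance, halg⟩
  have hn : Normal M (Kbar p k) := IsAlgClosure.normal M (Kbar p k)
  have hnorm : Normal M (extendScalars h) := by
    rw [normal_iff_forall_map_le]
    intro σ
    rintro _ ⟨x, hx, rfl⟩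
    have hbij : Function.Bijective (σ.restrictScalars (K0 p k)) :=
      Algebra.IsAlgebraic.algHom_bijective _
    exact hσ (AlgEquiv.ofBijective (σ.restrictScalars (K0 p k)) hbij)
      (fun y hy => σ.commutes ⟨y, hy⟩) x hx
  have hgal : IsGalois M (extendScalars h) := ⟨⟩
  let e : extendScalars h ≃ₐ[M] L :=
    { toFun := fun x => ⟨x.1, x.2⟩
      invFun := fun x => ⟨x.1, x.2⟩
      left_inv := fun _ => rfl
      right_inv := fun _ => rfl
      map_mul' := fun _ _ => rfl
      map_add' := fun _ _ => rfl
      commutes' := fun _ => rfl }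
  exact IsGalois.of_algEquiv e

theorem map_mem_cyc (σ : Kbar p k ≃ₐ[K0 p k] Kbar p k) (n : ℕ) {x : Kbar p k}
    (hx : x ∈ cyc p k n) : σ x ∈ cyc p k n := by
  have : cyc p k n ≤ (cyc p k n).comap (σ : Kbar p k →ₐ[K0 p k] Kbar p k) := by
    refine adjoin_le_iff.2 fun ζ hζ => ?_
    refine mem_cyc_of_pow_eq_one ?_
    have h1 : ζ ^ p ^ n = 1 := hζ
    change (σ ζ) ^ p ^ n = 1
    rw [← map_pow, h1, map_one]
  exact this hx

theorem map_mem_cycAdjoin (σ : Kbar p k ≃ₐ[K0 p k] Kbar p k) (n : ℕ) {β : Kbar p k}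
    (hβ : σ β ∈ cycAdjoin p k n β) {x : Kbar p k} (hx : x ∈ cycAdjoin p k n β) :
    σ x ∈ cycAdjoin p k n β := by
  have : cycAdjoin p k n β ≤ (cycAdjoin p k n β).comap (σ : Kbar p k →ₐ[K0 p k] Kbar p k) :=
    cycAdjoin_le_iff.2 ⟨fun y hy => cyc_le_cycAdjoin n β (map_mem_cyc σ n hy), hβ⟩
  exact this hx

/-- `σ β ∈ K_n(β)` when `σ` fixes a `p ^ m`-th power of `β`, `m ≤ n`. -/
theorem map_root_mem_cycAdjoin (σ : Kbar p k ≃ₐ[K0 p k] Kbar p k) {n m : ℕ} (hmn : m ≤ n)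
    {β : Kbar p k} (hβ : σ (β ^ p ^ m) = β ^ p ^ m) : σ β ∈ cycAdjoin p k n β := by
  rcases eq_or_ne β 0 with rfl | h0
  · rw [map_zero]
    exact zero_mem _
  have h1 : (σ β / β) ^ p ^ m = 1 := by
    rw [div_pow, ← map_pow, hβ, div_self (pow_ne_zero _ h0)]
  have h2 : σ β / β ∈ cyc p k n := cyc_mono hmn (mem_cyc_of_pow_eq_one h1)
  have h3 := mul_mem (cyc_le_cycAdjoin n β h2) (self_mem_cycAdjoin n β)
  rwa [div_mul_cancel₀ _ h0] at h3

theorem isGaloisExt_cycAdjoin_mono {l c : ℕ} (hlc : l ≤ c) (β : Kbar p k) :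
    IsGaloisExt (cycAdjoin_mono hlc β) :=
  isGaloisExt_of_map_mem _ fun σ hσ _ hx => map_mem_cycAdjoin σ c
    (by rw [hσ β (self_mem_cycAdjoin l β)]; exact self_mem_cycAdjoin c β) hx

theorem isGaloisExt_cycAdjoin_pow {l : ℕ} (hl : 1 ≤ l) (β : Kbar p k) :
    IsGaloisExt (cycAdjoin_pow_le l p β) :=
  isGaloisExt_of_map_mem _ fun σ hσ _ hx => map_mem_cycAdjoin σ l
    (map_root_mem_cycAdjoin σ hl (by rw [pow_one]; exact hσ _ (self_mem_cycAdjoin l _))) hx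

theorem cyc_le_cycAdjoin_of_le {l c : ℕ} (hlc : l ≤ c) (β : Kbar p k) :
    cyc p k l ≤ cycAdjoin p k c β :=
  (cyc_mono hlc).trans (cyc_le_cycAdjoin c β)

/-- Supplies the ambient Galois group in which the filtration by stabilizers lives. -/
theorem isGaloisExt_cyc_cycAdjoin {l c : ℕ} (hlc : l ≤ c) {β : Kbar p k}
    (hβ : β ^ p ^ c ∈ cyc p k l) : IsGaloisExt (cyc_le_cycAdjoin_of_le hlc β) :=
  isGaloisExt_of_map_mem _ fun σ hσ _ hx => map_mem_cycAdjoin σ c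
    (map_root_mem_cycAdjoin σ le_rfl (hσ _ hβ)) hx

/-- The elements of `Kbar` lying in `E` and fixed by an automorphism `g` of `E`. -/
def fixedBy {E : IntermediateField (K0 p k) (Kbar p k)} (g : E ≃ₐ[K0 p k] E) :
    IntermediateField (K0 p k) (Kbar p k) :=
  lift (fixedField (Subgroup.zpowers g))

theorem mem_fixedBy_iff {E : IntermediateField (K0 p k) (Kbar p k)} (g : E ≃ₐ[K0 p k] E) (x : E) :
    (x : Kbar p k) ∈ fixedBy g ↔ g x = x := by
  unfold fixedBy
  rw [mem_lift, mem_fixedField_iff]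
  constructor
  · exact fun h => h g (Subgroup.mem_zpowers g)
  · intro h f hf
    have h1 : Subgroup.zpowers g ≤ MulAction.stabilizer (E ≃ₐ[K0 p k] E) x := by
      rw [Subgroup.zpowers_le]
      exact h
    exact h1 hf

variable {w : AbsoluteValue (Kbar p k) ℝ}

theorem IsPadicAbs.abs_algEquiv (hw : IsPadicAbs w) {E : IntermediateField (K0 p k) (Kbar p k)}
    (g : E ≃ₐ[K0 p k] E) (x : E) : absRestrict w E (g x) = absRestrict w E x := by
  have h1 := g.liftNormal_commutes (Kbar p k) x
  change w (algebraMap E (Kbar p k) (g x)) = w (algebraMap E (Kbar p k) x)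
  rw [← h1, hw.invariant]

section Tower

variable {B E : IntermediateField (K0 p k) (Kbar p k)} [Algebra B E] [IsScalarTower B E (Kbar p k)]

/-- The tower condition over `Kbar` forces any given algebra structure of $E$ over $B$ to be the
inclusion, so the later lemmas need not name the instance. -/
theorem coe_algebraMap (x : B) : ((algebraMap B E x : E) : Kbar p k) = x :=
  (IsScalarTower.algebraMap_apply B E (Kbar p k) x).symm

theorem isScalarTower_K0 : IsScalarTower (K0 p k) B E :=
  IsScalarTower.of_algebraMap_eq fun x => Subtype.ext (coe_algebraMap (algebraMap (K0 p k) B x)).symm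

theorem isScalarTower_witt_sub : IsScalarTower (WittVector p k) B E :=
  IsScalarTower.of_algebraMap_eq fun x =>
    Subtype.ext (coe_algebraMap (algebraMap (WittVector p k) B x)).symm

theorem algEquiv_eq_of_mem (g : E ≃ₐ[B] E) {x : E} (hx : (x : Kbar p k) ∈ B) : g x = x := by
  have : x = algebraMap B E ⟨x, hx⟩ := Subtype.ext (coe_algebraMap (E := E) ⟨(x : Kbar p k), hx⟩).symm
  rw [this, AlgEquiv.commutes]

theorem IsPadicAbs.abs_algEquiv_sub (hw : IsPadicAbs w) (g : E ≃ₐ[B] E) (x : E) :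
    absRestrict w E (g x) = absRestrict w E x := by
  have := isScalarTower_K0 (B := B) (E := E)
  exact hw.abs_algEquiv (g.restrictScalars (K0 p k)) x

theorem algEquiv_eq_of_mem_cycAdjoin {n : ℕ} {β : Kbar p k} (g : E ≃ₐ[B] E) (hB : cyc p k n ≤ B)
    (b : E) (hb : (b : Kbar p k) = β) (hg : g b = b) (hcyc : cyc p k n ≤ E) (x : E)
    (hx : (x : Kbar p k) ∈ cycAdjoin p k n β) : g x = x := by
  have := isScalarTower_K0 (B := B) (E := E)
  have h1 : cycAdjoin p k n β ≤ fixedBy (g.restrictScalars (K0 p k)) := by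
    refine cycAdjoin_le_iff.2 ⟨fun y hy => ?_, ?_⟩
    · exact (mem_fixedBy_iff (g.restrictScalars (K0 p k)) ⟨y, hcyc hy⟩).2
        (algEquiv_eq_of_mem g (hB hy))
    · rw [← hb]
      exact (mem_fixedBy_iff (g.restrictScalars (K0 p k)) b).2 hg
  exact (mem_fixedBy_iff (g.restrictScalars (K0 p k)) x).1 (h1 hx)

theorem finiteDimensional_of_tower [FiniteDimensional (K0 p k) E] :
    @FiniteDimensional B E _ _ Algebra.toModule :=
  letI : Module B E := Algebra.toModule
  have := isScalarTower_K0 (B := B) (E := E)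
  FiniteDimensional.right (K0 p k) B E

/-- The Galois correspondence for the subfields `K_n(β)` of `E`. -/
theorem mem_cycAdjoin_of_fixed {n : ℕ} {β : Kbar p k} [FiniteDimensional (K0 p k) E] [IsGalois B E]
    (hB : B ≤ cycAdjoin p k n β) (b : E) (hb : (b : Kbar p k) = β) (x : E)
    (hx : ∀ g : E ≃ₐ[B] E, g b = b → g x = x) : (x : Kbar p k) ∈ cycAdjoin p k n β := by
  have := finiteDimensional_of_tower (B := B) (E := E)
  have h1 : x ∈ adjoin B {b} := by
    rw [← IsGalois.fixedField_fixingSubgroup (adjoin B {b}), mem_fixedField_iff]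
    intro g hg
    exact hx g ((mem_fixingSubgroup_iff _ _).1 hg b (mem_adjoin_simple_self B b))
  let v : E →ₐ[B] Kbar p k := IsScalarTower.toAlgHom B E (Kbar p k)
  have h2 : adjoin B {b} ≤ (extendScalars hB).comap v := by
    rw [adjoin_simple_le_iff]
    change (b : Kbar p k) ∈ cycAdjoin p k n β
    rw [hb]
    exact self_mem_cycAdjoin n β
  exact h2 h1

end Tower

end GaloisExt

/-! ### Lower bound for the Herbrand function of the stabilizer -/

section LowerBound

open IntermediateField

variable {p : ℕ} [Fact p.Prime] {k : Type*} [Field k] [CharP k p] [IsAlgClosed k]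
  {w : AbsoluteValue (Kbar p k) ℝ} {l N n : ℕ} {δ : Kbar p k}
  {E : IntermediateField (K0 p k) (Kbar p k)} [FiniteDimensional (K0 p k) E]
  [Algebra (cyc p k (l + 1)) E] [IsScalarTower (cyc p k (l + 1)) E (Kbar p k)]
  [IsGalois (cyc p k (l + 1)) E] [Fintype (E ≃ₐ[cyc p k (l + 1)] E)]

/-- The recursion for the Herbrand functions along the Kummer tower. -/
theorem ramProd_stabilizer_le (hw : IsPadicAbs w) (hc : KummerCond p k l δ N n) {j : ℕ}
    {β : Kbar p k} (hj : KummerLevel w l δ N n j (β ^ p)) (hE : cycAdjoin p k (l + 1) β ≤ E)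
    (b : E) (hb : (b : Kbar p k) = β) {ϖ : E} (hϖ : absRestrict w E ϖ ≤ 1) :
    ∃ ρ : ℝ, 0 ≤ ρ ∧ ρ ^ (p ^ l * (p - 1) * p ^ (j + 1)) = w p ∧ ∀ r, 0 ≤ r → r ≤ 1 →
      ramProd (absRestrict w E) ϖ (MulAction.stabilizer (E ≃ₐ[cyc p k (l + 1)] E) (b ^ p)) r ≤
        ramProd (absRestrict w E) ϖ (MulAction.stabilizer (E ≃ₐ[cyc p k (l + 1)] E) b) r *
          max (ρ ^ (p ^ (l + 1 + j) - n + 1))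
            (ramProd (absRestrict w E) ϖ (MulAction.stabilizer (E ≃ₐ[cyc p k (l + 1)] E) b) r)
              ^ (p - 1) := by
  have hp : p.Prime := Fact.out
  obtain ⟨π, hπ, hπe, hj', hdiff⟩ := hj.succ hw hc
  refine ⟨w π, w.nonneg _, hπe, fun r hr0 hr1 => ?_⟩
  have hML : cycAdjoin p k (l + 1) (β ^ p) ≤ cycAdjoin p k (l + 1) β := cycAdjoin_pow_le _ _ _
  have hcycE : cyc p k (l + 1) ≤ E := (cyc_le_cycAdjoin _ _).trans hE
  have hbp : ((b ^ p : E) : Kbar p k) = β ^ p := by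
    rw [← hb]
    rfl
  -- Otherwise $\beta\in K_\ell(\beta^p)$ by Galois theory, contradicting the degree growth by $p$.
  obtain ⟨σ, hσ, hσb⟩ : ∃ σ : E ≃ₐ[cyc p k (l + 1)] E, σ (b ^ p) = b ^ p ∧ σ b ≠ b := by
    by_contra! hcon
    have h1 := mem_cycAdjoin_of_fixed (E := E) (cyc_le_cycAdjoin _ _) (b ^ p) hbp b hcon
    rw [hb] at h1
    have h2 : cycAdjoin p k (l + 1) (β ^ p) = cycAdjoin p k (l + 1) β :=
      le_antisymm hML (cycAdjoin_le_iff.2 ⟨cyc_le_cycAdjoin _ _, h1⟩)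
    have h3 := hj'.finrank_eq
    rw [← h2, hj.finrank_eq] at h3
    have := ramIdx_pos p l j
    rw [pow_succ, ← mul_assoc] at h3
    have := hp.two_le
    nlinarith
  have hb0 : b ≠ 0 := by
    rintro rfl
    exact hσb (map_zero σ)
  set η : Kbar p k := (σ b : Kbar p k) / b with hη
  have hb0' : (b : Kbar p k) ≠ 0 := fun h => hb0 (Subtype.ext h)
  have hηp : η ^ p = 1 := by
    have h1 : ((σ b : Kbar p k)) ^ p = (b : Kbar p k) ^ p := by
      rw [map_pow] at hσ
      exact congrArg Subtype.val hσ
    rw [hη, div_pow, h1, div_self (pow_ne_zero _ hb0')]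
  have hη1 : η ≠ 1 := by
    intro h
    rw [hη, div_eq_one_iff_eq hb0'] at h
    exact hσb (Subtype.ext h)
  have hηcyc : η ∈ cyc p k (l + 1) := by
    refine mem_cyc_of_pow_eq_one ?_
    rw [pow_succ', pow_mul, hηp, one_pow]
  have hσi : ∀ i : ℕ, (((σ ^ i) b : E) : Kbar p k) = η ^ i * b := by
    have h1 : ∀ i : ℕ, (σ ^ i) b = algebraMap (cyc p k (l + 1)) E ⟨η, hηcyc⟩ ^ i * b := by
      intro i
      induction i with
      | zero => simp
      | succ i ih =>
        have h2 : σ b = algebraMap (cyc p k (l + 1)) E ⟨η, hηcyc⟩ * b := by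
          apply Subtype.ext
          change _ = ((algebraMap (cyc p k (l + 1)) E ⟨η, hηcyc⟩ : E) : Kbar p k) * b
          rw [coe_algebraMap]
          change _ = η * b
          rw [hη, div_mul_cancel₀ _ hb0']
        rw [pow_succ', AlgEquiv.mul_apply, ih, map_mul, map_pow, AlgEquiv.commutes, h2]
        ring
    intro i
    rw [h1]
    change ((algebraMap (cyc p k (l + 1)) E ⟨η, hηcyc⟩ : E) : Kbar p k) ^ i * b = _
    rw [coe_algebraMap]
  have hηi : ∀ i, 0 < i → i < p → η ^ i ≠ 1 := by
    intro i h0 hi h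
    have h1 := orderOf_dvd_of_pow_eq_one h
    rw [orderOf_eq_prime hηp hη1] at h1
    exact absurd (Nat.le_of_dvd h0 h1) (by omega)
  have hwE := hw.integral.absRestrict E
  refine ramProd_le_mul hwE hw.abs_algEquiv_sub hϖ (σ := σ) ?_ ?_ hp.pos ?_ ?_ hr0 hr1
  · intro g hg
    have hg' : g b = b := hg
    change g (b ^ p) = b ^ p
    rw [map_pow, hg']
  · exact hσ
  · intro i h0 hi hmem
    have h1 : (σ ^ i) b = b := hmem
    have h2 := hσi i
    rw [h1] at h2
    refine hηi i h0 hi (mul_right_cancel₀ hb0' ?_)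
    rw [← h2, one_mul]
  -- An integral $x$ fixed by the stabilizer of $\beta$ lies in $K_\ell(\beta)$, hence is a
  -- polynomial in its uniformizer $\pi$ and moves no more than $\pi$, whose displacement is known.
  · intro i h0 hi x hx hx1
    have hxL : (x : Kbar p k) ∈ cycAdjoin p k (l + 1) β :=
      mem_cycAdjoin_of_fixed (cyc_le_cycAdjoin _ _) b hb x fun g hg => hx g hg
    have hgen := hw.isValueGen_of_pow_eq (cycAdjoin p k (l + 1) β) (ϖ := ⟨π, hπ⟩)
      (by rw [hj'.finrank_eq]; exact hπe)
    obtain ⟨P, hP⟩ := hw.generates hgen ⟨x, hxL⟩ hx1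
    set v : E := ⟨π, hE hπ⟩ with hv
    have hPv : Polynomial.aeval v P = x := by
      apply Subtype.ext
      have h1 := Polynomial.aeval_algebraMap_apply (Kbar p k) v P
      have h2 := Polynomial.aeval_algebraMap_apply (Kbar p k)
        (⟨π, hπ⟩ : cycAdjoin p k (l + 1) β) P
      rw [hP] at h2
      exact h1.symm.trans h2
    have htower := isScalarTower_witt_sub (B := cyc p k (l + 1)) (E := E)
    have hv1 : absRestrict w E v ≤ 1 := hgen.lt_one.le
    rw [← hPv, algEquiv_aeval]
    refine (hwE.abs_aeval_sub_le (by rwa [hw.abs_algEquiv_sub]) hv1 P).trans (le_of_eq ?_)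
    refine hdiff E ((σ ^ i : E ≃ₐ[cyc p k (l + 1)] E) : E →+* E) b v (η ^ i) hb rfl ?_
      (hML.trans hE) ?_ ?_ (hηi i h0 hi)
    · intro y hy
      refine algEquiv_eq_of_mem_cycAdjoin (σ ^ i) le_rfl (b ^ p) hbp ?_ hcycE y hy
      have h1 : σ ∈ MulAction.stabilizer (E ≃ₐ[cyc p k (l + 1)] E) (b ^ p) := hσ
      exact pow_mem h1 i
    · rw [← hb]
      exact hσi i
    · rw [← pow_mul, mul_comm, pow_mul, hηp, one_pow]

omit [IsGalois (cyc p k (l + 1)) E] in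
/-- The bound for the cyclotomic part of the tower. -/
theorem pow_mul_le_ramProd_top (hw : IsPadicAbs w) {c : ℕ} (hlc : l + 1 ≤ c) {ζ : E}
    (hζ : (ζ : Kbar p k) ^ p ^ c = 1) {ϖ : E} (hϖ : IsValueGen (absRestrict w E) ϖ)
    {g : E ≃ₐ[cyc p k (l + 1)] E} (hg : g ζ ≠ ζ) {ρ : ℝ} (hρ0 : 0 ≤ ρ) (hρ : ρ ^ (p - 1) = w p) :
    w p ^ (c - (l + 1)) * ρ ≤ ramProd (absRestrict w E) ϖ
      (⊤ : Subgroup (E ≃ₐ[cyc p k (l + 1)] E)) (absRestrict w E (g ϖ - ϖ)) := by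
  classical
  have hp : p.Prime := Fact.out
  have htower := isScalarTower_witt_sub (B := cyc p k (l + 1)) (E := E)
  have hwζ := abs_eq_one_of_pow_eq_one w (pow_ne_zero _ hp.ne_zero) hζ
  have hζ0 : (ζ : Kbar p k) ≠ 0 := by
    intro h
    rw [h, map_zero] at hwζ
    exact zero_ne_one hwζ
  have hfix : ∀ h : E ≃ₐ[cyc p k (l + 1)] E,
      ((h ζ : Kbar p k) / ζ) ^ p ^ (c - (l + 1)) = 1 := by
    intro h
    have h1 : ((ζ ^ p ^ (c - (l + 1)) : E) : Kbar p k) ∈ cyc p k (l + 1) := by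
      refine mem_cyc_of_pow_eq_one ?_
      change ((ζ : Kbar p k) ^ p ^ (c - (l + 1))) ^ p ^ (l + 1) = 1
      rw [← pow_mul, ← pow_add, Nat.sub_add_cancel hlc, hζ]
    have h2 := algEquiv_eq_of_mem h h1
    rw [map_pow] at h2
    have h3 : (h ζ : Kbar p k) ^ p ^ (c - (l + 1)) = (ζ : Kbar p k) ^ p ^ (c - (l + 1)) :=
      congrArg Subtype.val h2
    rw [div_pow, h3, div_self (pow_ne_zero _ hζ0)]
  have hsub : ∀ x : E, absRestrict w E (x - ζ) = w ((x : Kbar p k) / ζ - 1) := by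
    intro x
    have h1 : ((x : Kbar p k) / ζ - 1) = ((x : Kbar p k) - ζ) / ζ := by
      rw [sub_div, div_self hζ0]
    rw [h1, map_div₀, hwζ, div_one]
    rfl
  set S := (Finset.univ.image fun h : E ≃ₐ[cyc p k (l + 1)] E => h ζ).erase ζ with hS
  -- Dividing the conjugates of $\zeta$ by $\zeta$ gives nontrivial $p^{c-\ell}$-th roots of unity,
  -- whatever the set of conjugates is.
  have hC : w p ^ (c - (l + 1)) ≤ ∏ η ∈ S, absRestrict w E (η - ζ) := by
    have h1 : ∏ η ∈ S, absRestrict w E (η - ζ) =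
        ∏ η ∈ S.image fun x : E => (x : Kbar p k) / ζ, w (η - 1) := by
      rw [Finset.prod_image]
      · exact Finset.prod_congr rfl fun x _ => hsub x
      · intro x _ y _ hxy
        exact Subtype.ext ((div_left_inj' hζ0).1 hxy)
    rw [h1]
    refine hw.pow_le_prod_root_sub_one _ fun η hη => ?_
    obtain ⟨x, hx, rfl⟩ := Finset.mem_image.1 hη
    obtain ⟨hxζ, hx⟩ := Finset.mem_erase.1 hx
    obtain ⟨h, -, rfl⟩ := Finset.mem_image.1 hx
    exact ⟨hfix h, fun h1 => hxζ (Subtype.ext ((div_eq_one_iff_eq hζ0).1 h1))⟩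
  refine le_trans ?_ (mul_le_ramProd_top (hw.integral.absRestrict E) hw.abs_algEquiv_sub
    hϖ.lt_one.le (hw.generates hϖ) hwζ.le (g := g) (pow_nonneg hw.pos.le _) hC)
  refine mul_le_mul_of_nonneg_left ?_ (pow_nonneg hw.pos.le _)
  rw [hsub]
  exact hw.le_abs_root_sub_one (hfix g)
    (fun h1 => hg (Subtype.ext ((div_eq_one_iff_eq hζ0).1 h1))) hρ0 hρ

/-- Runs the numerical recursion on the stabilizers of $\alpha^{p^{c-j}}$. Here $\omega$ is the size
of a uniformizer of $K_\ell(\alpha)$, so the uniformizer at level $j+1$ has size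
$\omega^{p^{c-j-1}}$. -/
theorem pow_le_ramProd_stabilizer (hw : IsPadicAbs w) (hc : KummerCond p k l δ N n) {c : ℕ}
    (hlc : l + 1 ≤ c) {α : Kbar p k} (hα : α ^ p ^ c ∈ cyc p k (l + 1))
    (hlev : ∀ j ≤ c, KummerLevel w l δ N n j (α ^ p ^ (c - j)))
    (hcE : cyc p k c ≤ E) (hEc : E ≤ cycAdjoin p k c α) (a : E) (ha : (a : Kbar p k) = α)
    {ϖ : E} (hϖ : IsValueGen (absRestrict w E) ϖ) {g : E ≃ₐ[cyc p k (l + 1)] E} (hg1 : g ≠ 1)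
    (hga : g a = a) {ω : ℝ} (hω0 : 0 ≤ ω) (hω : ω ^ (p ^ l * (p - 1) * p ^ c) = w p) :
    ω ^ (p ^ (c + l) - n + 1) ≤ ramProd (absRestrict w E) ϖ
      (MulAction.stabilizer (E ≃ₐ[cyc p k (l + 1)] E) a) (absRestrict w E (g ϖ - ϖ)) := by
  have hp : p.Prime := Fact.out
  have he := ramIdx_pos p l c
  have hωpos : 0 < ω := by
    refine lt_of_le_of_ne hω0 fun h0 => ?_
    rw [← h0, zero_pow he.ne'] at hω
    exact hw.pos.ne hω
  have hω1 : ω < 1 := by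
    by_contra hcon
    have := one_le_pow₀ (not_lt.1 hcon) (n := p ^ l * (p - 1) * p ^ c)
    rw [hω] at this
    exact absurd hw.lt_one (not_lt.2 this)
  have hwE := hw.integral.absRestrict E
  set r := absRestrict w E (g ϖ - ϖ) with hr
  have hr1 : r ≤ 1 := abs_map_sub_le_one hwE hw.abs_algEquiv_sub hϖ.lt_one.le g
  have hcylE : cyc p k (l + 1) ≤ E := (cyc_mono hlc).trans hcE
  have hcoe : ∀ i : ℕ, ((a ^ i : E) : Kbar p k) = α ^ i := by
    intro i
    rw [← ha]
    rfl
  have key := pow_le_of_herbrand_recursion hp.two_le hlc hc.lt hωpos hω1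
    (fun j => ramProd (absRestrict w E) ϖ
      (MulAction.stabilizer (E ≃ₐ[cyc p k (l + 1)] E) (a ^ p ^ (c - j))) r) ?_ ?_
  · simpa only [Nat.sub_self, pow_zero, pow_one] using key
  · obtain ⟨ζ, hζ⟩ := exists_isPrimitiveRoot (p := p) (k := k) c
    have hζE : ζ ∈ E := hcE (mem_cyc_of_pow_eq_one hζ.pow_eq_one)
    have htop : MulAction.stabilizer (E ≃ₐ[cyc p k (l + 1)] E) (a ^ p ^ (c - 0)) = ⊤ := by
      rw [eq_top_iff]
      intro h _
      refine algEquiv_eq_of_mem h ?_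
      rw [hcoe]
      exact hα
    -- Since $g$ fixes $\alpha$, fixing $\zeta$ as well would make it trivial on
    -- $K_c(\alpha)\supseteq E$.
    have hgζ : g ⟨ζ, hζE⟩ ≠ ⟨ζ, hζE⟩ := by
      intro hgζ
      have htow := isScalarTower_K0 (B := cyc p k (l + 1)) (E := E)
      refine hg1 (AlgEquiv.ext fun x => ?_)
      have h1 : cycAdjoin p k c α ≤ fixedBy (g.restrictScalars (K0 p k)) := by
        refine cycAdjoin_le_iff.2 ⟨?_, ?_⟩
        · rw [cyc_eq_adjoin hζ, adjoin_simple_le_iff]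
          exact (mem_fixedBy_iff (g.restrictScalars (K0 p k)) ⟨ζ, hζE⟩).2 hgζ
        · rw [← ha]
          exact (mem_fixedBy_iff (g.restrictScalars (K0 p k)) a).2 hga
      exact (mem_fixedBy_iff (g.restrictScalars (K0 p k)) x).1 (h1 (hEc x.2))
    have h1 := pow_mul_le_ramProd_top hw hlc (ζ := ⟨ζ, hζE⟩) hζ.pow_eq_one hϖ hgζ
      (pow_nonneg hω0 (p ^ (l + c))) (by rw [← hω, ← pow_mul, pow_add]; congr 1; ring)
    simp only [htop]
    refine le_trans (le_of_eq ?_) h1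
    rw [← hω, ← pow_mul, ← pow_add]
    congr 1
    rw [show c + l = l + c by ring, pow_add]
    ring
  · intro j hj
    have hβ : (α ^ p ^ (c - (j + 1))) ^ p = α ^ p ^ (c - j) := by
      rw [← pow_mul, ← pow_succ]
      congr 2
      omega
    have haβ : (a ^ p ^ (c - (j + 1))) ^ p = a ^ p ^ (c - j) := by
      rw [← pow_mul, ← pow_succ]
      congr 2
      omega
    have hlev' := hlev j hj.le
    rw [← hβ] at hlev'
    have hE : cycAdjoin p k (l + 1) (α ^ p ^ (c - (j + 1))) ≤ E := by
      refine cycAdjoin_le_iff.2 ⟨hcylE, ?_⟩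
      rw [← hcoe]
      exact SetLike.coe_mem _
    obtain ⟨ρ, hρ0, hρ, hstep⟩ := ramProd_stabilizer_le hw hc hlev' hE _ (hcoe _) hϖ.lt_one.le
    have hρω : ρ = ω ^ p ^ (c - (j + 1)) := by
      refine (pow_left_inj₀ hρ0 (pow_nonneg hω0 _) (ramIdx_pos p l (j + 1)).ne').1 ?_
      rw [hρ, ← pow_mul, ← hω]
      congr 1
      have : p ^ c = p ^ (c - (j + 1)) * p ^ (j + 1) := by
        rw [← pow_add]
        congr 1
        omega
      rw [this]
      ring
    have h2 := hstep r ((absRestrict w E).nonneg _) hr1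
    rw [haβ, hρω, ← pow_mul] at h2
    exact h2

end LowerBound

theorem IsValueGen.of_eq {L : Type*} [Field L] {w : AbsoluteValue L ℝ} {ϖ π : L}
    (h : IsValueGen w ϖ) (hπ : w π = w ϖ) : IsValueGen w π :=
  ⟨hπ ▸ h.pos, hπ ▸ h.lt_one, hπ ▸ h.exists_zpow⟩

/-! ### Passing from the ambient Galois group to a relative one -/

section RestrictScalars

variable {B M E : Type*} [Field B] [Field M] [Field E] [Algebra B M] [Algebra M E] [Algebra B E]
  [IsScalarTower B M E]

theorem restrictScalars_ne_one {g : E ≃ₐ[M] E} (hg : g ≠ 1) : g.restrictScalars B ≠ 1 :=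
  fun h1 => hg (AlgEquiv.ext fun x => DFunLike.congr_fun h1 x)

theorem ramProd_stabilizer_le_prod [Fintype (E ≃ₐ[B] E)] [Fintype (E ≃ₐ[M] E)]
    {w : AbsoluteValue E ℝ} {ϖ a : E} (hw : ∀ g : E ≃ₐ[B] E, w (g ϖ - ϖ) ≤ 1)
    (ha : ∀ h : E ≃ₐ[M] E, h a = a) {r : ℝ} (hr : r ≤ 1) :
    ramProd w ϖ (MulAction.stabilizer (E ≃ₐ[B] E) a) r ≤
      ∏ h : E ≃ₐ[M] E, max (w (h ϖ - ϖ)) r := by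
  classical
  let φ : (E ≃ₐ[M] E) → MulAction.stabilizer (E ≃ₐ[B] E) a := fun h =>
    ⟨h.restrictScalars B, ha h⟩
  have hφ : Function.Injective φ := fun h h' hh =>
    AlgEquiv.ext fun x => DFunLike.congr_fun (congrArg Subtype.val hh) x
  exact prod_le_prod_comp_of_injective _ (fun _ => (w.nonneg _).trans (le_max_left _ _))
    (fun _ => max_le (hw _) hr) hφ

end RestrictScalars

/-! ### Conductors of the two extensions -/

section Conductor

open IntermediateField

variable {p : ℕ} [Fact p.Prime] {k : Type*} [Field k] [CharP k p]
  {w : AbsoluteValue (Kbar p k) ℝ} {l N n : ℕ} {δ α : Kbar p k}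

/-- A uniformizer of `E`, raised to the power `[E : M]`, is at most as large as a uniformizer of a
totally ramified subfield `M`. -/
theorem IsPadicAbs.pow_finrank_le (hw : IsPadicAbs w)
    {E : IntermediateField (K0 p k) (Kbar p k)} [FiniteDimensional (K0 p k) E] {e R : ℕ}
    (he : 0 < e) (hE : Module.finrank (K0 p k) E = e * R) {ϖ : E} (hϖ0 : ϖ ≠ 0)
    (hϖ1 : w (ϖ : Kbar p k) < 1) {ω : ℝ} (hω0 : 0 ≤ ω) (hω : ω ^ e = w p) :
    w (ϖ : Kbar p k) ^ R ≤ ω := by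
  have hpos : 0 < e * R := hE ▸ Module.finrank_pos
  obtain ⟨z, hz⟩ := hw.exists_zpow E ϖ ϖ.2 (by simpa using hϖ0)
  have hlt : w (ϖ : Kbar p k) ^ Module.finrank (K0 p k) E < 1 :=
    pow_lt_one₀ (w.nonneg _) hϖ1 (by omega)
  have hz1 : 1 ≤ z := by
    by_contra hcon
    rw [hz] at hlt
    exact absurd hlt (not_lt.2 (one_le_zpow_of_nonpos₀ hw.pos hw.lt_one.le (by omega)))
  refine (pow_le_pow_iff_left₀ (pow_nonneg (w.nonneg _) _) hω0 he.ne').1 ?_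
  rw [← pow_mul, mul_comm, ← hE, hz, hω]
  simpa using zpow_le_zpow_right_of_le_one₀ hw.pos hw.lt_one.le hz1

theorem IsPadicAbs.pow_card_le (hw : IsPadicAbs w)
    {M E : IntermediateField (K0 p k) (Kbar p k)} [Algebra M E] [IsScalarTower M E (Kbar p k)]
    [IsGalois M E] [FiniteDimensional (K0 p k) E] [Fintype (E ≃ₐ[M] E)] {ϖ : E} (hϖ0 : ϖ ≠ 0)
    (hϖ1 : w (ϖ : Kbar p k) < 1) {ω : ℝ} (hω0 : 0 ≤ ω)
    (hM : 0 < Module.finrank (K0 p k) M) (hω : ω ^ Module.finrank (K0 p k) M = w p) :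
    w (ϖ : Kbar p k) ^ Fintype.card (E ≃ₐ[M] E) ≤ ω := by
  let _ : Module M E := Algebra.toModule
  have := isScalarTower_K0 (B := M) (E := E)
  have := finiteDimensional_of_tower (B := M) (E := E)
  refine hw.pow_finrank_le hM ?_ hϖ0 hϖ1 hω0 hω
  rw [← Nat.card_eq_fintype_card, IsGalois.card_aut_eq_finrank]
  exact (Module.finrank_mul_finrank (K0 p k) M E).symm

/-- For a uniformizer $\varpi$ of $E$, $|\varpi|^{|\mathrm{Gal}(E/M)|}$ is at most the size $\omega$
of a uniformizer of $M$. So the criterion `ramConductor_le` follows from the lower bound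
$\omega^{m+1}$ for the Herbrand product. -/
theorem ramConductor_le_of_kummerLevel [IsAlgClosed k]
    {M E : IntermediateField (K0 p k) (Kbar p k)}
    [Algebra M E] [Algebra (cyc p k (l + 1)) E] [Algebra (cyc p k (l + 1)) M]
    [IsScalarTower M E (Kbar p k)] [IsScalarTower (cyc p k (l + 1)) E (Kbar p k)]
    [IsScalarTower (cyc p k (l + 1)) M E] [IsGalois M E] [IsGalois (cyc p k (l + 1)) E]
    [FiniteDimensional (K0 p k) E] [Fintype (E ≃ₐ[M] E)] [Fintype (E ≃ₐ[cyc p k (l + 1)] E)]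
    {c : ℕ} (hM : M = cycAdjoin p k (l + 1) α) (hE : E = cycAdjoin p k c α)
    (hw : IsPadicAbs w) (hc : KummerCond p k l δ N n) (hlc : l + 1 ≤ c)
    (hα : α ^ p ^ c ∈ cyc p k (l + 1))
    (hlev : ∀ j ≤ c, KummerLevel w l δ N n j (α ^ p ^ (c - j))) :
    ramConductor (WittVector p k) E M ≤ ((p ^ (c + l) - n : ℕ) : ℝ) := by
  have := isScalarTower_witt_sub (B := M) (E := E)
  obtain ⟨ϖ, hϖ⟩ := hw.exists_isValueGen E
  have hwE := hw.integral.absRestrict E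
  refine ramConductor_le hwE hϖ (fun π hπ => hw.generates (hϖ.of_eq hπ)) hw.abs_algEquiv_sub _
    fun g hg => ?_
  have hlevc := hlev c le_rfl
  rw [Nat.sub_self, pow_zero, pow_one] at hlevc
  obtain ⟨π, -, hπ⟩ := hlevc.exists_gen
  have hfin : Module.finrank (K0 p k) M = p ^ l * (p - 1) * p ^ c := by
    rw [hM]
    exact hlevc.finrank_eq
  have hcard : absRestrict w E ϖ ^ Fintype.card (E ≃ₐ[M] E) ≤ w π :=
    hw.pow_card_le ((absRestrict w E).pos_iff.1 hϖ.pos) hϖ.lt_one (w.nonneg π)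
      (hfin ▸ ramIdx_pos p l c) (by rw [hfin, hπ])
  have haE : α ∈ E := by
    rw [hE]
    exact self_mem_cycAdjoin c α
  have haM : α ∈ M := by
    rw [hM]
    exact self_mem_cycAdjoin (l + 1) α
  have hfix : ∀ h : E ≃ₐ[M] E, h ⟨α, haE⟩ = ⟨α, haE⟩ := fun h => algEquiv_eq_of_mem h haM
  have hcE : cyc p k c ≤ E := by
    rw [hE]
    exact cyc_le_cycAdjoin c α
  have hmain := pow_le_ramProd_stabilizer hw hc hlc hα hlev hcE hE.le ⟨α, haE⟩ rfl hϖ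
    (restrictScalars_ne_one hg) (hfix g) (w.nonneg π) hπ
  rw [pow_mul]
  exact (pow_le_pow_left₀ (pow_nonneg hϖ.pos.le _) hcard _).trans (hmain.trans
    (ramProd_stabilizer_le_prod (abs_map_sub_le_one hwE hw.abs_algEquiv_sub hϖ.lt_one.le) hfix
      (abs_map_sub_le_one hwE hw.abs_algEquiv_sub hϖ.lt_one.le g)))

theorem relConductor_le_of_kummerLevel [IsAlgClosed k]
    {M E : IntermediateField (K0 p k) (Kbar p k)} [FiniteDimensional (K0 p k) E] (h : M ≤ E)
    (hBM : cyc p k (l + 1) ≤ M) (hBE : cyc p k (l + 1) ≤ E) (hME : IsGaloisExt h)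
    (hgal : IsGaloisExt hBE) {c : ℕ} (hM : M = cycAdjoin p k (l + 1) α)
    (hE : E = cycAdjoin p k c α) (hw : IsPadicAbs w) (hc : KummerCond p k l δ N n)
    (hlc : l + 1 ≤ c) (hα : α ^ p ^ c ∈ cyc p k (l + 1))
    (hlev : ∀ j ≤ c, KummerLevel w l δ N n j (α ^ p ^ (c - j))) :
    relConductor h ≤ ((p ^ (c + l) - n : ℕ) : ℝ) := by
  let _ : Algebra M E := (inclusion h).toRingHom.toAlgebra
  let _ : Algebra (cyc p k (l + 1)) E := (inclusion hBE).toRingHom.toAlgebra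
  let _ : Algebra (cyc p k (l + 1)) M := (inclusion hBM).toRingHom.toAlgebra
  have t1 : IsScalarTower M E (Kbar p k) := IsScalarTower.of_algebraMap_eq fun _ => rfl
  have t2 : IsScalarTower (cyc p k (l + 1)) E (Kbar p k) :=
    IsScalarTower.of_algebraMap_eq fun _ => rfl
  have t3 : IsScalarTower (cyc p k (l + 1)) M E := IsScalarTower.of_algebraMap_eq fun _ => rfl
  have g1 : IsGalois M E := hME
  have g2 : IsGalois (cyc p k (l + 1)) E := hgal
  have f1 := finiteDimensional_of_tower (B := M) (E := E)
  have f2 := finiteDimensional_of_tower (B := cyc p k (l + 1)) (E := E)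
  exact ramConductor_le_of_kummerLevel hM hE hw hc hlc hα hlev

theorem ramConductor_eq_of_kummerLevel [IsAlgClosed k]
    {M E : IntermediateField (K0 p k) (Kbar p k)}
    [Algebra M E] [IsScalarTower M E (Kbar p k)] [IsGalois M E] [FiniteDimensional (K0 p k) E]
    [Fintype (E ≃ₐ[M] E)]
    (hM : M = cycAdjoin p k (l + 1) (α ^ p)) (hE : E = cycAdjoin p k (l + 1) α)
    (hw : IsPadicAbs w) (hc : KummerCond p k l δ N n) {j : ℕ}
    (hj : KummerLevel w l δ N n j (α ^ p)) :
    ramConductor (WittVector p k) E M = ((p ^ (l + 1 + j) - n : ℕ) : ℝ) := by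
  have hp : p.Prime := Fact.out
  obtain ⟨ϖ, hϖE, hϖ, hj', hdiff⟩ := hj.succ hw hc
  rw [← hM] at hdiff
  rw [← hE] at hϖE
  have hME : M ≤ E := by
    rw [hM, hE]
    exact cycAdjoin_pow_le (l + 1) p α
  have hfinE : Module.finrank (K0 p k) E = p ^ l * (p - 1) * p ^ (j + 1) := by
    rw [hE]
    exact hj'.finrank_eq
  have hfinM : Module.finrank (K0 p k) M = p ^ l * (p - 1) * p ^ j := by
    rw [hM]
    exact hj.finrank_eq
  let _ : Module M E := Algebra.toModule
  have := isScalarTower_witt_sub (B := M) (E := E)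
  have := isScalarTower_K0 (B := M) (E := E)
  have := finiteDimensional_of_tower (B := M) (E := E)
  have hgen : IsValueGen (absRestrict w E) ⟨ϖ, hϖE⟩ :=
    hw.isValueGen_of_pow_eq E (by rw [hfinE]; exact hϖ)
  refine ramConductor_eq (hw.integral.absRestrict E) hgen
    (fun π hπ => hw.generates (hgen.of_eq hπ)) hw.abs_algEquiv_sub _ (fun g hg => ?_) ?_
  · have hαE : α ∈ E := by
      rw [hE]
      exact self_mem_cycAdjoin (l + 1) α
    set b : E := ⟨α, hαE⟩ with hb
    have hBM : cyc p k (l + 1) ≤ M := by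
      rw [hM]
      exact cyc_le_cycAdjoin _ _
    have hgb : g b ≠ b := fun h => hg (AlgEquiv.ext fun x =>
      algEquiv_eq_of_mem_cycAdjoin g hBM b rfl h (hBM.trans hME) x (hE.le x.2))
    have hα0 : α ≠ 0 := by
      intro h0
      have : b = 0 := Subtype.ext h0
      rw [this, map_zero] at hgb
      exact hgb rfl
    have hαM : α ^ p ∈ M := by
      rw [hM]
      exact self_mem_cycAdjoin (l + 1) (α ^ p)
    have hgp : (g b : Kbar p k) ^ p = α ^ p := by
      have h1 : g (b ^ p) = b ^ p := algEquiv_eq_of_mem g hαM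
      rw [map_pow] at h1
      exact congrArg Subtype.val h1
    refine hdiff E (g : E →+* E) b ⟨ϖ, hϖE⟩ ((g b : Kbar p k) / α) rfl rfl
      (fun x hx => algEquiv_eq_of_mem g hx) hME (div_mul_cancel₀ _ hα0).symm ?_ ?_
    · rw [div_pow, hgp, div_self (pow_ne_zero _ hα0)]
    · exact fun h => hgb (Subtype.ext ((div_eq_one_iff_eq hα0).1 h))
  -- A trivial group would force equal degrees, against the factor $p$.
  · by_contra! hcon
    have h1 : Nat.card (E ≃ₐ[M] E) = 1 := by
      have : Subsingleton (E ≃ₐ[M] E) := ⟨fun g h => by rw [hcon g, hcon h]⟩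
      exact Nat.card_eq_one_iff_unique.2 ⟨this, ⟨1⟩⟩
    rw [IsGalois.card_aut_eq_finrank] at h1
    have h2 := Module.finrank_mul_finrank (K0 p k) M E
    rw [h1, mul_one, hfinM, hfinE, pow_succ, ← mul_assoc] at h2
    have := ramIdx_pos p l j
    have := hp.two_le
    nlinarith

theorem relConductor_eq_of_kummerLevel [IsAlgClosed k]
    {M E : IntermediateField (K0 p k) (Kbar p k)} [FiniteDimensional (K0 p k) E] (h : M ≤ E)
    (hgal : IsGaloisExt h) (hM : M = cycAdjoin p k (l + 1) (α ^ p))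
    (hE : E = cycAdjoin p k (l + 1) α) (hw : IsPadicAbs w) (hc : KummerCond p k l δ N n) {j : ℕ}
    (hj : KummerLevel w l δ N n j (α ^ p)) :
    relConductor h = ((p ^ (l + 1 + j) - n : ℕ) : ℝ) := by
  let _ : Algebra M E := (inclusion h).toRingHom.toAlgebra
  have t1 : IsScalarTower M E (Kbar p k) := IsScalarTower.of_algebraMap_eq fun _ => rfl
  have g1 : IsGalois M E := hgal
  have f1 := finiteDimensional_of_tower (B := M) (E := E)
  exact ramConductor_eq_of_kummerLevel hM hE hw hc hj

/-- The Kummer data of a `p`-primitive element. -/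
theorem IsPadicAbs.exists_kummerCond (hw : IsPadicAbs w) {a t : cyc p k (l + 1)} (hat : a = 1 + t)
    (ha : IsPrimitiveElt (WittVector p k) (cyc p k (l + 1)) p a)
    (ha0 : 0 ≤ cycVal p k (l + 1) a) :
    ∃ (δ : Kbar p k) (N n : ℕ), KummerCond p k l δ N n ∧
      cycVal p k (l + 1) t = ((n : ℤ) : WithTop ℤ) ∧ KummerLevel w l δ N n 0 (a : Kbar p k) := by
  have hp : p.Prime := Fact.out
  have hp1 : 0 < p - 1 := by have := hp.two_le; omega
  obtain ⟨ζ, hζ⟩ := exists_isPrimitiveRoot (p := p) (k := k) (l + 1)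
  have hζmem : ζ - 1 ∈ cyc p k (l + 1) :=
    sub_mem (mem_cyc_of_pow_eq_one hζ.pow_eq_one) (one_mem _)
  have hζw := hw.abs_primitiveRoot_sub_one hζ
  have hgen : IsValueGen (absRestrict w (cyc p k (l + 1))) ⟨ζ - 1, hζmem⟩ :=
    hw.isValueGen_of_pow_eq _ (by rw [hw.finrank_cyc]; exact hζw)
  set e := p ^ l * (p - 1) with he
  set ω := w (ζ - 1) with hω
  have hval : ∀ (x : cyc p k (l + 1)) (m : ℤ),
      val (WittVector p k) (cyc p k (l + 1)) x = m ↔ w (x : Kbar p k) = ω ^ m := fun x m =>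
    (hw.integral.absRestrict _).val_eq_coe_iff hgen x m
  have hωe : ∀ m : ℕ, (ω ^ m) ^ e = w p ^ m := fun m => by
    rw [← pow_mul, mul_comm, pow_mul, hζw]
  have hlevel : ∀ {δ N n}, w ((a : Kbar p k) - δ) ^ e = w p ^ N →
      w (a : Kbar p k) ^ e * w p ^ n = w p ^ N → KummerLevel w l δ N n 0 (a : Kbar p k) := by
    intro δ N n h1 h2
    refine ⟨?_, ?_, ?_, ζ - 1, cyc_le_cycAdjoin _ _ hζmem, ?_⟩ <;>
      rw [pow_zero, mul_one]
    · rw [cycAdjoin_eq_cyc a.2, hw.finrank_cyc]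
    · exact h1
    · exact h2
    · exact hζw
  have hta : (t : Kbar p k) = a - 1 := by
    rw [hat]
    change (t : Kbar p k) = 1 + t - 1
    ring
  rcases ha with ⟨N, hN, hpN⟩ | ⟨N, e', hN, he', hN0, hlt, hpN⟩
  · change 0 ≤ val _ _ a at ha0
    rw [hN] at ha0
    have hN0 : 0 ≤ N := by exact_mod_cast ha0
    lift N to ℕ using hN0
    have hpN' : ¬ p ∣ N := fun h => hpN (by exact_mod_cast h)
    have hNpos : N ≠ 0 := by
      rintro rfl
      exact hpN' (dvd_zero p)
    rw [hval, zpow_natCast] at hN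
    have ha1 : w (a : Kbar p k) < 1 := by
      rw [hN]
      exact pow_lt_one₀ hgen.pos.le hgen.lt_one hNpos
    refine ⟨0, N, 0, ⟨hpN', Or.inl ⟨rfl, rfl⟩⟩, ?_, hlevel ?_ ?_⟩
    -- Here $|a|<1$, so $t=a-1$ is a unit and $n=0$.
    · refine (hval t _).2 ?_
      rw [hta, w.map_sub, sub_eq_add_neg, abs_one_add_of_lt hw.integral.nonarch (by rwa [w.map_neg])]
      simp
    · rw [sub_zero, hN, hωe]
    · rw [pow_zero, mul_one, hN, hωe]
  · lift N to ℕ using hN0.le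
    have hpN' : ¬ p ∣ N := fun h => hpN (by exact_mod_cast h)
    have hN1 : w ((a : Kbar p k) - 1) = ω ^ N := by
      rw [hval, zpow_natCast] at hN
      exact hN
    have hee : e' = e := by
      have h1 : w (p : Kbar p k) = ω ^ e' := (hval (p : cyc p k (l + 1)) e').1 he'
      rw [← hζw, ← zpow_natCast] at h1
      exact ((zpow_eq_iff hgen.pos hgen.lt_one).1 h1).symm
    have hNlt : N < p ^ (l + 1) := by
      have hpr : (0 : ℝ) < (p : ℝ) - 1 := by
        have : (1 : ℝ) < p := by exact_mod_cast hp.one_lt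
        linarith
      -- The bound in the definition of primitivity is an integer here, because $e=p^l(p-1)$.
      have h1 : (p : ℝ) / ((p : ℝ) - 1) * (e' : ℝ) = (p : ℝ) ^ (l + 1) := by
        rw [hee, he]
        push_cast [Nat.cast_sub hp.one_le]
        field_simp
        ring
      rw [h1] at hlt
      exact_mod_cast hlt
    have hNpos : N ≠ 0 := by
      rintro rfl
      exact hpN' (dvd_zero p)
    have hlt1 : w ((a : Kbar p k) - 1) < 1 := by
      rw [hN1]
      exact pow_lt_one₀ hgen.pos.le hgen.lt_one hNpos
    have ha1 : w (a : Kbar p k) = 1 := by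
      have := abs_one_add_of_lt hw.integral.nonarch hlt1
      rwa [add_sub_cancel] at this
    refine ⟨1, N, N, ⟨hpN', Or.inr ⟨rfl, rfl, hNlt⟩⟩, ?_, hlevel ?_ ?_⟩
    · refine (hval t _).2 ?_
      rw [hta, hN1, zpow_natCast]
    · rw [hN1, hωe]
    · rw [ha1, one_pow, one_mul]

theorem KummerLevel.of_zero (hw : IsPadicAbs w) (hc : KummerCond p k l δ N n) {c : ℕ}
    (h0 : KummerLevel w l δ N n 0 (α ^ p ^ c)) :
    ∀ j ≤ c, KummerLevel w l δ N n j (α ^ p ^ (c - j)) := by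
  intro j
  induction j with
  | zero => exact fun _ => h0
  | succ j ih =>
    intro hj
    have h1 := ih (by omega)
    have h2 : (α ^ p ^ (c - (j + 1))) ^ p = α ^ p ^ (c - j) := by
      rw [← pow_mul, ← pow_succ]
      congr 2
      omega
    rw [← h2] at h1
    obtain ⟨-, -, -, h3, -⟩ := h1.succ hw hc
    exact h3

theorem exists_isPadicAbs (p : ℕ) [Fact p.Prime] (k : Type*) [Field k] [CharP k p]
    [IsAlgClosed k] : ∃ w : AbsoluteValue (Kbar p k) ℝ, IsPadicAbs w := by
  obtain ⟨w, h1, h2, h3, h4, h5⟩ := exists_abs_Kbar p k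
  exact ⟨w, h1, h2, h3, h4, h5⟩

end Conductor

end WildConductor

end

theorem lemma4p1 (p : ℕ) [Fact p.Prime] (k : Type*) [Field k] [CharP k p] [IsAlgClosed k]
    (l c : ℕ) (hl : 1 ≤ l) (hlc : l ≤ c)
    (a t : WildConductor.cyc p k l) (hat : a = 1 + t)
    (ha : WildConductor.IsPrimitiveElt (WittVector p k) (WildConductor.cyc p k l) p a)
    (ha0 : 0 ≤ WildConductor.cycVal p k l a)
    (α : WildConductor.Kbar p k) (hα : α ^ (p ^ c) = (a : WildConductor.Kbar p k)) :
    WildConductor.IsGaloisExt (WildConductor.cycAdjoin_mono hlc α) ∧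
    WildConductor.IsGaloisExt (WildConductor.cycAdjoin_pow_le l p α) ∧
    ∃ n : ℤ, WildConductor.cycVal p k l t = (n : WithTop ℤ) ∧
      WildConductor.relConductor (WildConductor.cycAdjoin_mono hlc α) ≤
        (p : ℝ) ^ (c + l - 1) - (n : ℝ) ∧
      WildConductor.relConductor (WildConductor.cycAdjoin_pow_le l p α) =
        (p : ℝ) ^ (c + l - 1) - (n : ℝ) := by
  refine ⟨WildConductor.isGaloisExt_cycAdjoin_mono hlc α,
    WildConductor.isGaloisExt_cycAdjoin_pow hl α, ?_⟩
  obtain ⟨w, hw⟩ := WildConductor.exists_isPadicAbs p k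
  -- The tower is indexed by $\ell-1$, so that $[K_\ell:K_0]=p^l(p-1)$ and $p^{c+\ell-1}$ becomes
  -- $p^{c+l}$.
  obtain ⟨l, rfl⟩ : ∃ m, l = m + 1 := ⟨l - 1, by omega⟩
  obtain ⟨δ, N, n, hc, hval, h0⟩ := hw.exists_kummerCond hat ha ha0
  rw [← hα] at h0
  have hlev := WildConductor.KummerLevel.of_zero hw hc h0
  have hαmem : α ^ p ^ c ∈ WildConductor.cyc p k (l + 1) := hα ▸ a.2
  have hp : p.Prime := Fact.out
  have hn : n ≤ p ^ (c + l) := hc.lt.le.trans (Nat.pow_le_pow_right hp.pos (by omega))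
  have hbound : (p : ℝ) ^ (c + (l + 1) - 1) - ((n : ℤ) : ℝ) = ((p ^ (c + l) - n : ℕ) : ℝ) := by
    push_cast [Nat.cast_sub hn]
    rfl
  refine ⟨n, hval, ?_, ?_⟩
  · rw [hbound]
    exact WildConductor.relConductor_le_of_kummerLevel _ (WildConductor.cyc_le_cycAdjoin _ _) _
      (WildConductor.isGaloisExt_cycAdjoin_mono hlc α)
      (WildConductor.isGaloisExt_cyc_cycAdjoin hlc hαmem) rfl rfl hw hc hlc hαmem hlev
  -- The last Kummer step starts at level $c-1$, whose element is $\alpha^p$.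
  · have h1 := hlev (c - 1) (by omega)
    rw [show c - (c - 1) = 1 by omega, pow_one] at h1
    rw [hbound, WildConductor.relConductor_eq_of_kummerLevel _
      (WildConductor.isGaloisExt_cycAdjoin_pow hl α) rfl rfl hw hc h1,
      show l + 1 + (c - 1) = c + l by omega]
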